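/- Fix $r\in(0,1)$ and let $\mathbb A_r=\{z\in\mathbb C: r<|z|<1\}$, $\mathbb D=\{z\in\mathbb C:|z|<1\}$. For every $x\in(r,1)$ there is a unique injective holomorphic map $f_x:\mathbb A_r\to\mathbb D$ such that $f_x(x)=0$, the unit circle corresponds to itself under $f_x$ (i.e. all limit points of $f_x(z)$ as $z\in\mathbb A_r$ tends to a point of $\partial\mathbb D$ lie on $\partial\mathbb D$), and $\Gamma_x:=\mathbb D\setminus f_x(\mathbb A_r)$ is a (closed, non-degenerate, proper) arc of a circle centred at the origin, symmetric with respect to the real axis and intersecting the interval $(-1,0)$. These maps have the following properties. (A) For each $x\in(r,1)$ the map $f_x$ has a holomorphic extension to $\mathbb A_{r,x}:=\{z\in\mathbb C: r^2/x<|z|<1/x\}$, and, with this extension again denoted by $f_x$, the function $(x,z)\mapsto f_x(z)$ is of class $C^\infty$ on $\{(x,z): x\in(r,1),\ z\in\mathbb A_{r,x}\}$. (B) For each $x\in(r,1)$ we have $f_\alpha(x)=-f_x(\alpha)$ for all $\alpha\in(r,1)$; moreover $f_x'(x)$ is real and $$\frac{d}{d\alpha}\Big|_{\alpha=x} f_\alpha(x)=-f_x'(x)<-\frac1{1-x^2}.$$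 (C) For each $x\in(r,1)$ the arc $\Gamma_x$ intersects the real line exactly at the point $-x$. (D) For each $x\in(r,1)$ exactly one endpoint $\Gamma_x^+$ of the arc $\Gamma_x$ lies in the open upper half-plane, and $x\mapsto\Gamma_x^+$ is a $C^\infty$ function on $(r,1)$. -/

import Mathlib

open scoped ContDiff

/-- The open annulus `{z : a < |z| < b}` centred at the origin. -/
def annulus (a b : ℝ) : Set ℂ := {z | a < ‖z‖ ∧ ‖z‖ < b}

/-- The set `{ρ e^{iθ} : a ≤ θ ≤ b}`. -/
noncomputable def circularArc (ρ a b : ℝ) : Set ℂ :=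
  (fun θ : ℝ => (ρ : ℂ) * Complex.exp ((θ : ℂ) * Complex.I)) '' Set.Icc a b

/-- `Γ` is a closed circular arc centred at the origin: neither a point nor a full circle. -/
def IsCircularArc (Γ : Set ℂ) : Prop :=
  ∃ ρ a b : ℝ, 0 < ρ ∧ a < b ∧ b < a + 2 * Real.pi ∧ Γ = circularArc ρ a b

/-- `e` is one of the two endpoints of the circular arc `Γ` centred at the origin. -/
def IsArcEndpoint (Γ : Set ℂ) (e : ℂ) : Prop :=
  ∃ ρ a b : ℝ, 0 < ρ ∧ a < b ∧ b < a + 2 * Real.pi ∧ Γ = circularArc ρ a b ∧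
    (e = (ρ : ℂ) * Complex.exp ((a : ℂ) * Complex.I) ∨
      e = (ρ : ℂ) * Complex.exp ((b : ℂ) * Complex.I))

/-- The complement in the unit disk of the image of `{r < |z| < 1}` under `f`. -/
def slit (r : ℝ) (f : ℂ → ℂ) : Set ℂ := Metric.ball 0 1 \ f '' annulus r 1

/-- `f` (only its values on `{r < |z| < 1}` matter) is a conformal map of this annulus into the
unit disk with `f x = 0`, under which the unit circle corresponds to the unit circle, and such
that the omitted set `slit r f` is a circular arc centred at the origin, symmetric with respect
to the real axis and meeting the interval `(-1, 0)`. -/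
structure IsCanonicalMap (r x : ℝ) (f : ℂ → ℂ) : Prop where
  holo : DifferentiableOn ℂ f (annulus r 1)
  inj : Set.InjOn f (annulus r 1)
  mapsTo : Set.MapsTo f (annulus r 1) (Metric.ball 0 1)
  map_zero : f (x : ℂ) = 0
  /-- All limit points of `f` at points of the unit circle lie on the unit circle. -/
  circle_to_circle : ∀ ζ ∈ Metric.sphere (0 : ℂ) 1, ∀ w : ℂ,
    MapClusterPt w (nhdsWithin ζ (annulus r 1)) f → w ∈ Metric.sphere (0 : ℂ) 1
  arc : IsCircularArc (slit r f)
  symm : ∀ w ∈ slit r f, (starRingEnd ℂ) w ∈ slit r f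
  meets : ∃ t : ℝ, -1 < t ∧ t < 0 ∧ (t : ℂ) ∈ slit r f

/-! The canonical map has a closed formula. With `q = r ^ 2` and `T(ζ) = ∏ (1 - qᵏ ζ)`, put `f(z) =
(z - x) T(qz/x) T(qx/z) / (T(zx) T(q/(zx)))`, a quotient of two theta functions. Holomorphy on the
larger annulus, joint smoothness and antisymmetry can be read off this formula. The equation `T(ζ) =
(1 - ζ) T(qζ)` gives `f(1/z) f(z) = 1` and `f(q/z) f(z) = x²`; since `f` commutes with conjugation,
`|f| = 1` on the unit circle and `|f| = x` on the inner circle.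

Univalence rests on two sign facts on the upper half annulus. Zeros and poles of the theta quotient
interlace on the positive axis, so the total angle they contribute stays in `[-π, 0]` and `Im f > 0`
(`canonMap_im_pos`). The logarithmic derivative `L = z f'/f` is real on both circles and on the real
axis, and its pole at `x` has the right sign, so `Im L < 0` by the maximum principle
(`canonLogDer_im_neg`). In the coordinate `log z` the half annulus is a convex rectangle on which
`log f` has derivative `L`, so the Noshiro–Warschawski criterion applies. The omitted set is the
image of the inner circle, an arc of radius `x` through `-x` (`exists_slit_canonMap`).

For uniqueness (`IsCanonicalMap.eqOn`), the quotient of two canonical maps has no zeros, has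
asymptotically constant modulus at each boundary circle, and has a logarithm near the inner circle
because both slits miss the positive axis. Such a function is a unimodular constant, and the
symmetry of the arcs makes it `1`.

The derivative bound in (B) comes from `f'(x) = T(q)² / (T(x²) T(q/x²))` and a termwise use of `y +
1/y > 2`. For (D), the upper endpoint is `f(r e^{iθ})` with `θ` the zero of `L(r e^{iθ})` in `(0,
π)`. A Hopf-type lemma shows that `θ ↦ L(r e^{iθ})` has positive derivative there, so the zero is
unique and the implicit function theorem applies. -/

open Complex Set Filter Topology Metric

/-! ### The `q`-Pochhammer symbol: logarithm and logarithmic derivative. -/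

/-- The logarithm `-∑ ζⁿ / (n (1 - qⁿ))` of the `q`-Pochhammer symbol `∏ (1 - qᵏ ζ)`. -/
noncomputable def pochLog (q : ℝ) (ζ : ℂ) : ℂ :=
  -∑' n : ℕ, ζ ^ (n + 1) / ((n + 1 : ℂ) * (1 - (q : ℂ) ^ (n + 1)))

section pochLog

variable {q : ℝ} (hq0 : 0 < q) (hq1 : q < 1)

include hq0 hq1

theorem one_sub_pow_lower (n : ℕ) : 1 - q ≤ (n + 1) * (1 - q ^ (n + 1)) := by
  have h1 : q ^ (n + 1) ≤ q := by
    simpa using pow_le_pow_of_le_one hq0.le hq1.le (Nat.succ_le_succ (Nat.zero_le n))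
  have h2 : (1 : ℝ) ≤ n + 1 := by linarith [(Nat.cast_nonneg n : (0 : ℝ) ≤ n)]
  nlinarith

theorem norm_pochLog_term_le (n : ℕ) (ζ : ℂ) :
    ‖ζ ^ (n + 1) / ((n + 1 : ℂ) * (1 - (q : ℂ) ^ (n + 1)))‖ ≤ ‖ζ‖ ^ (n + 1) / (1 - q) := by
  have e : ((n + 1 : ℂ) * (1 - (q : ℂ) ^ (n + 1))) = (((n + 1) * (1 - q ^ (n + 1)) : ℝ) : ℂ) := by
    push_cast; ring
  have h := one_sub_pow_lower hq0 hq1 n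
  rw [e, norm_div, norm_pow, Complex.norm_real, Real.norm_eq_abs, abs_of_nonneg (by linarith)]
  gcongr

theorem summable_pochLog {ζ : ℂ} (hζ : ‖ζ‖ < 1) :
    Summable fun n : ℕ => ζ ^ (n + 1) / ((n + 1 : ℂ) * (1 - (q : ℂ) ^ (n + 1))) := by
  refine Summable.of_norm_bounded (g := fun n : ℕ => ‖ζ‖ ^ (n + 1) / (1 - q)) ?_
    (fun n => norm_pochLog_term_le hq0 hq1 n ζ)
  exact ((summable_nat_add_iff 1).2
    (summable_geometric_of_lt_one (norm_nonneg _) hζ)).div_const _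

theorem differentiableOn_pochLog : DifferentiableOn ℂ (pochLog q) (ball 0 1) := by
  intro ζ hζ
  rw [mem_ball_zero_iff] at hζ
  obtain ⟨ρ, h1, h2⟩ := exists_between hζ
  have hρ : 0 ≤ ρ := (norm_nonneg _).trans h1.le
  have : DifferentiableOn ℂ (pochLog q) (ball 0 ρ) := by
    refine (differentiableOn_tsum_of_summable_norm (u := fun n : ℕ => ρ ^ (n + 1) / (1 - q))
      ?_ ?_ isOpen_ball ?_).neg
    · exact ((summable_nat_add_iff 1).2 (summable_geometric_of_lt_one hρ h2)).div_const _
    · intro n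
      fun_prop
    · intro n w hw
      refine (norm_pochLog_term_le hq0 hq1 n w).trans ?_
      have : ‖w‖ ≤ ρ := (mem_ball_zero_iff.1 hw).le
      gcongr
  exact (this.differentiableAt (isOpen_ball.mem_nhds (by simpa using h1))).differentiableWithinAt

theorem differentiableAt_pochLog {ζ : ℂ} (hζ : ‖ζ‖ < 1) : DifferentiableAt ℂ (pochLog q) ζ :=
  (differentiableOn_pochLog hq0 hq1).differentiableAt (isOpen_ball.mem_nhds (by simpa using hζ))

/-- Subtracting the series at `qζ` multiplies the `n`-th coefficient by `1 - qⁿ`, which leaves the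
Taylor series of `log (1 - ζ)`. All symmetries of the canonical map come from this equation. -/
theorem pochLog_sub {ζ : ℂ} (hζ : ‖ζ‖ < 1) :
    pochLog q ζ = log (1 - ζ) + pochLog q (q * ζ) := by
  have hqζ : ‖(q : ℂ) * ζ‖ < 1 := by
    rw [norm_mul, Complex.norm_real, Real.norm_eq_abs, abs_of_pos hq0]
    nlinarith [norm_nonneg ζ]
  have h1 := (summable_pochLog hq0 hq1 hζ).hasSum
  have h2 := (summable_pochLog hq0 hq1 hqζ).hasSum
  have h3 := h1.sub h2
  have h4 := (hasSum_nat_add_iff (f := fun n : ℕ => ζ ^ n / (n : ℂ)) (g := -log (1 - ζ)) 1).2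
    (by simpa using hasSum_taylorSeries_neg_log hζ)
  have h5 : ∀ n : ℕ, ζ ^ (n + 1) / ((n + 1 : ℂ) * (1 - (q : ℂ) ^ (n + 1))) -
      ((q : ℂ) * ζ) ^ (n + 1) / ((n + 1 : ℂ) * (1 - (q : ℂ) ^ (n + 1))) =
      ζ ^ (n + 1) / ((n + 1 : ℕ) : ℂ) := by
    intro n
    have a1 : ((n : ℂ) + 1) ≠ 0 := by exact_mod_cast Nat.succ_ne_zero n
    have a2 : (1 - (q : ℂ) ^ (n + 1)) ≠ 0 := by
      have : q ^ (n + 1) < 1 := pow_lt_one₀ hq0.le hq1 (Nat.succ_ne_zero n)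
      rw [sub_ne_zero]
      exact_mod_cast this.ne'
    push_cast
    field_simp
    ring
  simp only [h5] at h3
  have h6 := h3.unique h4
  simp only [pochLog]
  linear_combination -h6

theorem exp_pochLog_eq {ζ : ℂ} (hζ : ‖ζ‖ < 1) :
    exp (pochLog q ζ) = (1 - ζ) * exp (pochLog q (q * ζ)) := by
  rw [pochLog_sub hq0 hq1 hζ, exp_add, exp_log]
  rw [sub_ne_zero]
  rintro rfl
  simp at hζ

omit hq0 hq1 in
theorem pochLog_zero : pochLog q 0 = 0 := by simp [pochLog]

theorem tendsto_pochLog_pow_mul (ζ : ℂ) :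
    Tendsto (fun n : ℕ => pochLog q ((q : ℂ) ^ n * ζ)) atTop (𝓝 0) := by
  have h1 : ContinuousAt (pochLog q) 0 :=
    (differentiableAt_pochLog hq0 hq1 (by simp)).continuousAt
  have h2 : Tendsto (fun n : ℕ => (q : ℂ) ^ n * ζ) atTop (𝓝 0) := by
    simpa using (tendsto_pow_atTop_nhds_zero_of_norm_lt_one (x := (q : ℂ))
      (by simpa [abs_of_pos hq0] using hq1)).mul_const ζ
  have h3 := h1.tendsto.comp h2
  rwa [pochLog_zero] at h3

theorem norm_ofReal_pow_mul_lt {ζ : ℂ} (hζ : ‖ζ‖ < 1) (n : ℕ) : ‖(q : ℂ) ^ n * ζ‖ < 1 := by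
  rw [norm_mul, norm_pow, Complex.norm_real, Real.norm_eq_abs, abs_of_pos hq0]
  have : q ^ n ≤ 1 := pow_le_one₀ hq0.le hq1.le
  have : 0 < q ^ n := pow_pos hq0 n
  nlinarith [norm_nonneg ζ]

theorem exp_pochLog_eq_prod {ζ : ℂ} (hζ : ‖ζ‖ < 1) (n : ℕ) :
    exp (pochLog q ζ) =
      (∏ k ∈ Finset.range n, (1 - (q : ℂ) ^ k * ζ)) * exp (pochLog q ((q : ℂ) ^ n * ζ)) := by
  induction n with
  | zero => simp
  | succ n ih =>
    rw [ih, Finset.prod_range_succ, exp_pochLog_eq hq0 hq1 (norm_ofReal_pow_mul_lt hq0 hq1 hζ n),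
      pow_succ']
    ring_nf

/-- The finite products serve to track arguments: a finite product of linear factors has an explicit
argument, and a sign condition survives in the limit. -/
theorem tendsto_prod_exp_pochLog {ζ : ℂ} (hζ : ‖ζ‖ < 1) :
    Tendsto (fun n : ℕ => ∏ k ∈ Finset.range n, (1 - (q : ℂ) ^ k * ζ)) atTop
      (𝓝 (exp (pochLog q ζ))) := by
  have h := (continuous_exp.tendsto _).comp (tendsto_pochLog_pow_mul hq0 hq1 ζ).neg
  simp only [neg_zero, exp_zero] at h
  have h2 := h.const_mul (exp (pochLog q ζ))
  rw [mul_one] at h2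
  refine h2.congr fun n => ?_
  simp only [Function.comp]
  rw [exp_pochLog_eq_prod hq0 hq1 hζ n, mul_assoc, ← exp_add]
  simp

omit hq0 hq1 in
theorem pochLog_conj (ζ : ℂ) : pochLog q (starRingEnd ℂ ζ) = starRingEnd ℂ (pochLog q ζ) := by
  simp [pochLog, Complex.conj_tsum]

/-- The logarithmic derivative `ζ ↦ ζ T'(ζ) / T(ζ)` of the `q`-Pochhammer symbol. -/
noncomputable def pochDer (q : ℝ) (ζ : ℂ) : ℂ := ζ * deriv (pochLog q) ζ

theorem pochDer_sub {ζ : ℂ} (hζ : ‖ζ‖ < 1) :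
    pochDer q ζ = -ζ / (1 - ζ) + pochDer q (q * ζ) := by
  have hqζ : ‖(q : ℂ) * ζ‖ < 1 := by simpa using norm_ofReal_pow_mul_lt hq0 hq1 hζ 1
  have h1 : pochLog q =ᶠ[𝓝 ζ] fun w => log (1 - w) + pochLog q (q * w) := by
    filter_upwards [isOpen_ball.mem_nhds (show ζ ∈ ball (0 : ℂ) 1 by simpa using hζ)] with w hw
    exact pochLog_sub hq0 hq1 (by simpa using hw)
  have hs : 1 - ζ ∈ slitPlane := by
    left
    have := (Complex.re_le_norm ζ).trans_lt hζ
    simp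
    linarith
  have h2 : HasDerivAt (fun w => log (1 - w) + pochLog q (q * w))
      ((-1) / (1 - ζ) + deriv (pochLog q) (q * ζ) * q) ζ := by
    refine HasDerivAt.add ?_ ?_
    · exact ((hasDerivAt_id ζ).const_sub 1).clog hs
    · exact (differentiableAt_pochLog hq0 hq1 hqζ).hasDerivAt.comp ζ (by
        simpa using (hasDerivAt_id ζ).const_mul (q : ℂ))
  rw [pochDer, pochDer, h1.deriv_eq, h2.deriv]
  ring

theorem pochDer_conj {ζ : ℂ} (hζ : ‖ζ‖ < 1) :
    pochDer q (starRingEnd ℂ ζ) = starRingEnd ℂ (pochDer q ζ) := by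
  have h1 := (differentiableAt_pochLog hq0 hq1 hζ).hasDerivAt.conj_conj
  have h2 : (starRingEnd ℂ ∘ pochLog q ∘ starRingEnd ℂ) = pochLog q := by
    ext w
    simp [pochLog_conj]
  rw [h2] at h1
  rw [pochDer, h1.deriv, pochDer, map_mul]

theorem analyticOnNhd_pochLog : AnalyticOnNhd ℂ (pochLog q) (ball 0 1) :=
  (differentiableOn_pochLog hq0 hq1).analyticOnNhd isOpen_ball

theorem analyticOnNhd_pochDer : AnalyticOnNhd ℂ (pochDer q) (ball 0 1) :=
  analyticOnNhd_id.mul (analyticOnNhd_pochLog hq0 hq1).deriv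

end pochLog

/-! ### The explicit map and its functional equations. -/

/-- The range of the parameters: `q` is the squared inner radius and `x` the zero. -/
structure CanonParams (q x : ℝ) : Prop where
  q_pos : 0 < q
  x_pos : 0 < x
  x_lt_one : x < 1
  q_lt : q < x ^ 2

/-- The exponent of the nonvanishing factor of the canonical map. -/
noncomputable def canonExp (q x : ℝ) (z : ℂ) : ℂ :=
  pochLog q (q * z / x) + pochLog q (q * x / z) - pochLog q (z * x) - pochLog q (q / (z * x))

/-- The explicit canonical slit map of the annulus `√q < |z| < 1` with zero at `x`. -/
noncomputable def canonMap (q x : ℝ) (z : ℂ) : ℂ := (z - x) * exp (canonExp q x z)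

/-- The logarithmic derivative `z f'(z) / f(z)` of the canonical map. -/
noncomputable def canonLogDer (q x : ℝ) (z : ℂ) : ℂ :=
  z / (z - x) + pochDer q (q * z / x) - pochDer q (q * x / z) - pochDer q (z * x)
    + pochDer q (q / (z * x))

theorem isOpen_annulus (a b : ℝ) : IsOpen (annulus a b) :=
  (isOpen_lt continuous_const continuous_norm).inter (isOpen_lt continuous_norm continuous_const)

theorem annulus_mono {a b a' b' : ℝ} (h1 : a' ≤ a) (h2 : b ≤ b') : annulus a b ⊆ annulus a' b' :=
  fun _ hz => ⟨h1.trans_lt hz.1, hz.2.trans_le h2⟩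

theorem conj_mem_annulus {a b : ℝ} {z : ℂ} (hz : z ∈ annulus a b) :
    starRingEnd ℂ z ∈ annulus a b := by
  simpa [annulus] using hz

namespace CanonParams

variable {q x : ℝ} (h : CanonParams q x)

include h

theorem q_lt_one : q < 1 := by
  have := h.q_lt
  have := h.x_pos
  have := h.x_lt_one
  nlinarith

theorem norm_pos_of_mem {z : ℂ} (hz : z ∈ annulus (q / x) (1 / x)) : 0 < ‖z‖ :=
  (div_pos h.q_pos h.x_pos).trans hz.1

theorem ne_zero_of_mem {z : ℂ} (hz : z ∈ annulus (q / x) (1 / x)) : z ≠ 0 :=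
  norm_pos_iff.1 (h.norm_pos_of_mem hz)

theorem x_ne_zero : (x : ℂ) ≠ 0 := by exact_mod_cast h.x_pos.ne'

theorem norm_arg₁ {z : ℂ} (hz : z ∈ annulus (q / x) (1 / x)) : ‖(q : ℂ) * z / x‖ < 1 := by
  have hq := h.q_pos
  have hx := h.x_pos
  have hz2 := (lt_div_iff₀ hx).1 hz.2
  rw [norm_div, norm_mul, Complex.norm_real, Complex.norm_real, Real.norm_eq_abs, Real.norm_eq_abs,
    abs_of_pos hq, abs_of_pos hx, div_lt_one hx]
  have := h.q_lt
  nlinarith [norm_nonneg z]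

theorem norm_arg₂ {z : ℂ} (hz : z ∈ annulus (q / x) (1 / x)) : ‖(q : ℂ) * x / z‖ < 1 := by
  have hq := h.q_pos
  have hx := h.x_pos
  have hz1 := (div_lt_iff₀ hx).1 hz.1
  rw [norm_div, norm_mul, Complex.norm_real, Complex.norm_real, Real.norm_eq_abs, Real.norm_eq_abs,
    abs_of_pos hq, abs_of_pos hx, div_lt_one (h.norm_pos_of_mem hz)]
  have := h.x_lt_one
  nlinarith [norm_nonneg z]

/-- This bound and the next are equivalent to the two inequalities that define the annulus: the
poles of the map nearest to it are `1/x` and `q/x`. -/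
theorem norm_arg₃ {z : ℂ} (hz : z ∈ annulus (q / x) (1 / x)) : ‖z * x‖ < 1 := by
  have hz2 := (lt_div_iff₀ h.x_pos).1 hz.2
  rwa [norm_mul, Complex.norm_real, Real.norm_eq_abs, abs_of_pos h.x_pos]

theorem norm_arg₄ {z : ℂ} (hz : z ∈ annulus (q / x) (1 / x)) : ‖(q : ℂ) / (z * x)‖ < 1 := by
  have hz1 := (div_lt_iff₀ h.x_pos).1 hz.1
  rw [norm_div, norm_mul, Complex.norm_real, Complex.norm_real, Real.norm_eq_abs, Real.norm_eq_abs,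
    abs_of_pos h.q_pos, abs_of_pos h.x_pos,
    div_lt_one (mul_pos (h.norm_pos_of_mem hz) h.x_pos)]
  exact hz1

theorem hasDerivAt_canonExp {z : ℂ} (hz : z ∈ annulus (q / x) (1 / x)) :
    HasDerivAt (canonExp q x) ((canonLogDer q x z - z / (z - x)) / z) z := by
  have hz0 := h.ne_zero_of_mem hz
  have hx0 := h.x_ne_zero
  have d : ∀ {w : ℂ}, ‖w‖ < 1 → HasDerivAt (pochLog q) (deriv (pochLog q) w) w := fun hw =>
    (differentiableAt_pochLog h.q_pos h.q_lt_one hw).hasDerivAt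
  have h1 := (d (h.norm_arg₁ hz)).comp z
    (((hasDerivAt_id z).const_mul (q : ℂ)).div_const (x : ℂ))
  have h2 := (d (h.norm_arg₂ hz)).comp z
    ((hasDerivAt_const z ((q : ℂ) * x)).div (hasDerivAt_id z) hz0)
  have h3 := (d (h.norm_arg₃ hz)).comp z ((hasDerivAt_id z).mul_const (x : ℂ))
  have h4 := (d (h.norm_arg₄ hz)).comp z
    ((hasDerivAt_const z (q : ℂ)).div ((hasDerivAt_id z).mul_const (x : ℂ)) (mul_ne_zero hz0 hx0))
  refine (((h1.add h2).sub h3).sub h4).congr_deriv ?_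
  simp only [canonLogDer, pochDer, id]
  field_simp
  ring

theorem hasDerivAt_canonMap' {z : ℂ} (hz : z ∈ annulus (q / x) (1 / x)) :
    HasDerivAt (canonMap q x) (exp (canonExp q x z) + (z - x) *
      (exp (canonExp q x z) * ((canonLogDer q x z - z / (z - x)) / z))) z := by
  have := ((hasDerivAt_id z).sub_const (x : ℂ)).mul (h.hasDerivAt_canonExp hz).cexp
  simpa using! this

theorem hasDerivAt_canonMap {z : ℂ} (hz : z ∈ annulus (q / x) (1 / x)) (hzx : z ≠ x) :
    HasDerivAt (canonMap q x) (canonMap q x z * (canonLogDer q x z / z)) z := by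
  have hz0 := h.ne_zero_of_mem hz
  have : z - x ≠ 0 := sub_ne_zero.2 hzx
  refine (h.hasDerivAt_canonMap' hz).congr_deriv ?_
  rw [canonMap]
  field_simp
  ring

theorem differentiableOn_canonMap :
    DifferentiableOn ℂ (canonMap q x) (annulus (q / x) (1 / x)) :=
  fun _ hz => (h.hasDerivAt_canonMap' hz).differentiableAt.differentiableWithinAt

/-- The part of the logarithmic derivative that is regular at `x`. -/
theorem differentiableOn_canonLogDer_sub :
    DifferentiableOn ℂ (fun z => canonLogDer q x z - z / (z - x)) (annulus (q / x) (1 / x)) := by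
  intro z hz
  have hz0 := h.ne_zero_of_mem hz
  have d : ∀ {w : ℂ}, ‖w‖ < 1 → DifferentiableAt ℂ (pochDer q) w := fun hw =>
    (analyticOnNhd_pochDer h.q_pos h.q_lt_one _ (by simpa using hw)).differentiableAt
  have h1 := (d (h.norm_arg₁ hz)).comp z (f := fun z : ℂ => (q : ℂ) * z / x) (by fun_prop)
  have h2 := (d (h.norm_arg₂ hz)).comp z (f := fun z : ℂ => (q : ℂ) * x / z)
    (by fun_prop (disch := assumption))
  have h3 := (d (h.norm_arg₃ hz)).comp z (f := fun z : ℂ => z * x) (by fun_prop)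
  have h4 := (d (h.norm_arg₄ hz)).comp z (f := fun z : ℂ => (q : ℂ) / (z * x))
    (by fun_prop (disch := exact mul_ne_zero hz0 h.x_ne_zero))
  refine ((((h1.sub h2).sub h3).add h4).congr_of_eventuallyEq ?_).differentiableWithinAt
  refine Eventually.of_forall fun w => ?_
  simp only [canonLogDer, Pi.add_apply, Pi.sub_apply, Function.comp]
  ring

theorem differentiableOn_canonLogDer :
    DifferentiableOn ℂ (canonLogDer q x) (annulus (q / x) (1 / x) \ {(x : ℂ)}) := by
  have h1 := h.differentiableOn_canonLogDer_sub.mono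
    (sdiff_subset (s := annulus (q / x) (1 / x)) (t := {(x : ℂ)}))
  have h2 : DifferentiableOn ℂ (fun z : ℂ => z / (z - x))
      (annulus (q / x) (1 / x) \ {(x : ℂ)}) := by
    refine DifferentiableOn.div differentiableOn_id (differentiableOn_id.sub_const _) ?_
    intro z hz
    exact sub_ne_zero.2 hz.2
  refine (h1.add h2).congr fun z _ => ?_
  simp

omit h in
theorem canonMap_eq_zero_iff {z : ℂ} : canonMap q x z = 0 ↔ z = x := by
  simp [canonMap, exp_ne_zero, sub_eq_zero]

omit h in
theorem canonExp_conj (z : ℂ) :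
    canonExp q x (starRingEnd ℂ z) = starRingEnd ℂ (canonExp q x z) := by
  simp only [canonExp, map_add, map_sub, ← pochLog_conj, map_div₀, map_mul, conj_ofReal]

omit h in
theorem canonMap_conj (z : ℂ) :
    canonMap q x (starRingEnd ℂ z) = starRingEnd ℂ (canonMap q x z) := by
  simp only [canonMap, canonExp_conj, exp_conj, map_mul, map_sub, conj_ofReal]

theorem canonLogDer_conj {z : ℂ} (hz : z ∈ annulus (q / x) (1 / x)) :
    canonLogDer q x (starRingEnd ℂ z) = starRingEnd ℂ (canonLogDer q x z) := by
  simp only [canonLogDer, map_add, map_sub,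
    ← pochDer_conj h.q_pos h.q_lt_one (h.norm_arg₁ hz),
    ← pochDer_conj h.q_pos h.q_lt_one (h.norm_arg₂ hz),
    ← pochDer_conj h.q_pos h.q_lt_one (h.norm_arg₃ hz),
    ← pochDer_conj h.q_pos h.q_lt_one (h.norm_arg₄ hz), map_div₀, map_mul, conj_ofReal]

theorem norm_div_x_lt {z : ℂ} (hz : ‖z‖ < x) : ‖z / x‖ < 1 := by
  rw [norm_div, Complex.norm_real, Real.norm_eq_abs, abs_of_pos h.x_pos, div_lt_one h.x_pos]
  exact hz

theorem norm_x_div_lt {z : ℂ} (hz : x < ‖z‖) : ‖x / z‖ < 1 := by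
  rw [norm_div, Complex.norm_real, Real.norm_eq_abs, abs_of_pos h.x_pos,
    div_lt_one (h.x_pos.trans hz)]
  exact hz

omit h in
theorem one_sub_ne_zero_of_norm_lt {w : ℂ} (hw : ‖w‖ < 1) : 1 - w ≠ 0 := by
  rw [sub_ne_zero]
  rintro rfl
  simp at hw

/-- Up to factors `q`, the inversion `z ↦ 1/z` permutes the four Pochhammer arguments. The linear
factors released by `exp_pochLog_eq` cancel against `z - x` and `z⁻¹ - x`. On `|z| = 1` the inverse
is the conjugate, so the identity fixes the modulus there. -/
theorem canonMap_inv_mul {z : ℂ} (hz : z ∈ annulus x (1 / x)) :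
    canonMap q x z⁻¹ * canonMap q x z = 1 := by
  have hz' : z ∈ annulus (q / x) (1 / x) := by
    refine annulus_mono ?_ le_rfl hz
    rw [div_le_iff₀ h.x_pos, ← sq]
    exact h.q_lt.le
  have hz0 := h.ne_zero_of_mem hz'
  have hx0 := h.x_ne_zero
  have e1 := exp_pochLog_eq h.q_pos h.q_lt_one (h.norm_arg₃ hz')
  have e2 := exp_pochLog_eq h.q_pos h.q_lt_one (h.norm_x_div_lt hz.1)
  have n1 := one_sub_ne_zero_of_norm_lt (h.norm_arg₃ hz')
  have n2 := one_sub_ne_zero_of_norm_lt (h.norm_x_div_lt hz.1)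
  have a1 : (q : ℂ) * z⁻¹ / x = q / (z * x) := by field_simp
  have a2 : (q : ℂ) * x / z⁻¹ = q * (z * x) := by field_simp
  have a3 : z⁻¹ * x = x / z := by field_simp
  have a5 : (q : ℂ) * x / z = q * (x / z) := by ring
  simp only [canonMap, canonExp, a1, a2, a3, a5, exp_sub, exp_add, e1, e2]
  have n3 : z - x ≠ 0 := by
    intro e
    rw [sub_eq_zero.1 e] at n2
    simp [hx0] at n2
  have n2' : (1 - x / z) = (z - x) / z := by field_simp
  have n4 : z⁻¹ - x = (1 - z * x) / z := by field_simp
  rw [n2', n4]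
  have p : ∀ w : ℂ, exp w ≠ 0 := exp_ne_zero
  field_simp [p]

/-- The same cancellation for the reflection in the inner circle `|z|² = q`, where `q/z` is the
conjugate of `z`. -/
theorem canonMap_q_div_mul {z : ℂ} (hz : z ∈ annulus (q / x) x) :
    canonMap q x (q / z) * canonMap q x z = x ^ 2 := by
  have hz' : z ∈ annulus (q / x) (1 / x) := by
    refine annulus_mono le_rfl ?_ hz
    rw [le_div_iff₀ h.x_pos]
    nlinarith [h.x_pos, h.x_lt_one]
  have hz0 := h.ne_zero_of_mem hz'
  have hx0 := h.x_ne_zero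
  have hq0 : (q : ℂ) ≠ 0 := by exact_mod_cast h.q_pos.ne'
  have e1 := exp_pochLog_eq h.q_pos h.q_lt_one (h.norm_arg₄ hz')
  have e2 := exp_pochLog_eq h.q_pos h.q_lt_one (h.norm_div_x_lt hz.2)
  have n1 := one_sub_ne_zero_of_norm_lt (h.norm_arg₄ hz')
  have n2 := one_sub_ne_zero_of_norm_lt (h.norm_div_x_lt hz.2)
  have a1 : (q : ℂ) * (q / z) / x = q * (q / (z * x)) := by field_simp
  have a2 : (q : ℂ) * x / (q / z) = z * x := by field_simp
  have a3 : (q : ℂ) / z * x = q * x / z := by field_simp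
  have a4 : (q : ℂ) / (q * x / z) = z / x := by field_simp
  have a5 : (q : ℂ) * z / x = q * (z / x) := by ring
  simp only [canonMap, canonExp, a1, a2, a3, a4, a5, exp_sub, exp_add, e1, e2]
  have n2' : (1 - z / x) = -(z - x) / x := by field_simp; ring
  have n3 : z - x ≠ 0 := by
    intro e
    rw [n2', e] at n2
    simp at n2
  have n4 : (q : ℂ) / z - x = -(1 - q / (z * x)) * x := by field_simp; ring
  rw [n2', n4]
  have p : ∀ w : ℂ, exp w ≠ 0 := exp_ne_zero
  generalize 1 - (q : ℂ) / (z * x) = s at *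
  field_simp [p]

/-- Logarithmic derivative of `canonMap_inv_mul`; combined with conjugation symmetry it makes
`canonLogDer` real on the unit circle. -/
theorem canonLogDer_inv {z : ℂ} (hz : z ∈ annulus x (1 / x)) :
    canonLogDer q x z⁻¹ = canonLogDer q x z := by
  have hz' : z ∈ annulus (q / x) (1 / x) := by
    refine annulus_mono ?_ le_rfl hz
    rw [div_le_iff₀ h.x_pos, ← sq]
    exact h.q_lt.le
  have hz0 := h.ne_zero_of_mem hz'
  have hx0 := h.x_ne_zero
  have e1 := pochDer_sub h.q_pos h.q_lt_one (h.norm_arg₃ hz')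
  have e2 := pochDer_sub h.q_pos h.q_lt_one (h.norm_x_div_lt hz.1)
  have n1 := one_sub_ne_zero_of_norm_lt (h.norm_arg₃ hz')
  have n2 := one_sub_ne_zero_of_norm_lt (h.norm_x_div_lt hz.1)
  have a1 : (q : ℂ) * z⁻¹ / x = q / (z * x) := by field_simp
  have a2 : (q : ℂ) * x / z⁻¹ = q * (z * x) := by field_simp
  have a3 : z⁻¹ * x = x / z := by field_simp
  have a5 : (q : ℂ) * x / z = q * (x / z) := by ring
  simp only [canonLogDer, a1, a2, a3, a5, e1, e2]
  have n3 : z - x ≠ 0 := by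
    intro e
    rw [sub_eq_zero.1 e] at n2
    simp [hx0] at n2
  have n2' : (1 - x / z) = (z - x) / z := by field_simp
  have n4 : z⁻¹ - x = (1 - z * x) / z := by field_simp
  rw [n2', n4]
  field_simp
  ring

theorem canonLogDer_q_div {z : ℂ} (hz : z ∈ annulus (q / x) x) :
    canonLogDer q x (q / z) = canonLogDer q x z := by
  have hz' : z ∈ annulus (q / x) (1 / x) := by
    refine annulus_mono le_rfl ?_ hz
    rw [le_div_iff₀ h.x_pos]
    nlinarith [h.x_pos, h.x_lt_one]
  have hz0 := h.ne_zero_of_mem hz'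
  have hx0 := h.x_ne_zero
  have hq0 : (q : ℂ) ≠ 0 := by exact_mod_cast h.q_pos.ne'
  have e1 := pochDer_sub h.q_pos h.q_lt_one (h.norm_arg₄ hz')
  have e2 := pochDer_sub h.q_pos h.q_lt_one (h.norm_div_x_lt hz.2)
  have n1 := one_sub_ne_zero_of_norm_lt (h.norm_arg₄ hz')
  have n2 := one_sub_ne_zero_of_norm_lt (h.norm_div_x_lt hz.2)
  have a1 : (q : ℂ) * (q / z) / x = q * (q / (z * x)) := by field_simp
  have a2 : (q : ℂ) * x / (q / z) = z * x := by field_simp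
  have a3 : (q : ℂ) / z * x = q * x / z := by field_simp
  have a4 : (q : ℂ) / (q * x / z) = z / x := by field_simp
  have a5 : (q : ℂ) * z / x = q * (z / x) := by ring
  simp only [canonLogDer, a1, a2, a3, a4, a5, e1, e2]
  have n2' : (1 - z / x) = -(z - x) / x := by field_simp; ring
  have n3 : z - x ≠ 0 := by
    intro e
    rw [n2', e] at n2
    simp at n2
  have n1' : 1 - (q : ℂ) / (z * x) = (z * x - q) / (z * x) := by field_simp
  have n5 : z * x - q ≠ 0 := by
    intro e
    rw [n1', e] at n1
    simp at n1
  have n4 : (q : ℂ) / z - x = -(z * x - q) / z := by field_simp; ring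
  rw [n2', n4, n1']
  field_simp
  ring

end CanonParams

/-! ### Viewing angles, and the image of the upper half annulus. -/

/-- Up to a quarter turn, the direction from the real point `t` to `z`. -/
noncomputable def viewAngle (z : ℂ) (t : ℝ) : ℝ := Real.arctan ((t - z.re) / z.im)

theorem viewAngle_mono {z : ℂ} (hz : 0 < z.im) : Monotone (viewAngle z) := by
  intro s t hst
  refine Real.arctan_strictMono.monotone ?_
  gcongr

theorem sub_ofReal_eq_viewAngle {z : ℂ} (hz : 0 < z.im) (t : ℝ) :
    ∃ ρ : ℝ, 0 < ρ ∧ z - t = ρ * (I * exp (viewAngle z t * I)) := by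
  refine ⟨z.im * √(1 + ((t - z.re) / z.im) ^ 2), by positivity, ?_⟩
  rw [exp_mul_I, ← ofReal_cos, ← ofReal_sin, viewAngle, Real.cos_arctan, Real.sin_arctan]
  set u := (t - z.re) / z.im with hu
  have hs : √(1 + u ^ 2) ≠ 0 := by positivity
  have hu' : t = z.re + u * z.im := by rw [hu]; field_simp; ring
  apply Complex.ext
  · simp
    field_simp
    linarith
  · simp
    field_simp

theorem sub_div_sub_eq_viewAngle {z : ℂ} (hz : 0 < z.im) (a b : ℝ) :
    ∃ ρ : ℝ, 0 < ρ ∧ (z - a) / (z - b) = ρ * exp ((viewAngle z a - viewAngle z b : ℝ) * I) := by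
  obtain ⟨ρ, h1, h2⟩ := sub_ofReal_eq_viewAngle hz a
  obtain ⟨σ, h3, h4⟩ := sub_ofReal_eq_viewAngle hz b
  refine ⟨ρ / σ, div_pos h1 h3, ?_⟩
  have hσ : (σ : ℂ) ≠ 0 := by exact_mod_cast h3.ne'
  rw [h2, h4]
  push_cast
  rw [sub_mul, exp_sub]
  have := exp_ne_zero (viewAngle z b * I)
  field_simp [I_ne_zero]

theorem prod_sub_div_sub_eq_viewAngle {z : ℂ} (hz : 0 < z.im) (a b : ℕ → ℝ) (n : ℕ) :
    ∃ ρ : ℝ, 0 < ρ ∧ ∏ k ∈ Finset.range n, ((z - a k) / (z - b k)) =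
      ρ * exp ((∑ k ∈ Finset.range n, (viewAngle z (a k) - viewAngle z (b k)) : ℝ) * I) := by
  induction n with
  | zero => exact ⟨1, one_pos, by simp⟩
  | succ n ih =>
    obtain ⟨ρ, h1, h2⟩ := ih
    obtain ⟨σ, h3, h4⟩ := sub_div_sub_eq_viewAngle hz (a n) (b n)
    refine ⟨ρ * σ, mul_pos h1 h3, ?_⟩
    rw [Finset.prod_range_succ, Finset.sum_range_succ, h2, h4, ofReal_add, add_mul, exp_add]
    push_cast
    ring

namespace CanonParams

variable {q x : ℝ} (h : CanonParams q x)

include h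

theorem tendsto_prod_canonMap {z : ℂ} (hz : z ∈ annulus (q / x) (1 / x)) :
    Tendsto (fun n : ℕ => -(x : ℂ) * ((∏ k ∈ Finset.range (n + 1), (1 - (q : ℂ) ^ k * (z / x))) *
        (∏ k ∈ Finset.range (n + 1), (1 - (q : ℂ) ^ k * (q * x / z))) /
        ((∏ k ∈ Finset.range (n + 1), (1 - (q : ℂ) ^ k * (z * x))) *
          (∏ k ∈ Finset.range (n + 1), (1 - (q : ℂ) ^ k * (q / (z * x)))))))
      atTop (𝓝 (canonMap q x z)) := by
  have t : ∀ {w : ℂ}, ‖w‖ < 1 → _ := fun {w} hw =>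
    tendsto_prod_exp_pochLog (ζ := w) h.q_pos h.q_lt_one hw
  have h1 := t (h.norm_arg₁ hz)
  have h2 := (tendsto_add_atTop_iff_nat 1).2 (t (h.norm_arg₂ hz))
  have h3 := (tendsto_add_atTop_iff_nat 1).2 (t (h.norm_arg₃ hz))
  have h4 := (tendsto_add_atTop_iff_nat 1).2 (t (h.norm_arg₄ hz))
  have h5 := (((h1.mul h2).div (h3.mul h4) (mul_ne_zero (exp_ne_zero _) (exp_ne_zero _))).const_mul
    (z - (x : ℂ)))
  have hx0 := h.x_ne_zero
  have e : (z - (x : ℂ)) * (exp (pochLog q (q * z / x)) * exp (pochLog q (q * x / z)) /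
      (exp (pochLog q (z * x)) * exp (pochLog q (q / (z * x))))) = canonMap q x z := by
    rw [canonMap, canonExp, exp_sub, exp_sub, exp_add, div_div]
  rw [e] at h5
  refine h5.congr fun n => ?_
  -- The factor `z - x = -x (1 - z/x)` is the `k = 0` term missing from the product for `qz/x`.
  -- Hence `n` factors there become `n + 1`, and the other three products were shifted to match.
  rw [Finset.prod_range_succ' (fun k => (1 - (q : ℂ) ^ k * (z / x)))]
  have e2 : ∏ k ∈ Finset.range n, (1 - (q : ℂ) ^ (k + 1) * (z / x)) =
      ∏ k ∈ Finset.range n, (1 - (q : ℂ) ^ k * (q * z / x)) := by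
    refine Finset.prod_congr rfl fun k _ => ?_
    ring
  have e3 : z - x = -x * (1 - z / x) := by field_simp; ring
  rw [e2, e3]
  simp only [Pi.div_apply, pow_zero, one_mul]
  ring

/-- The zeros `x qᵏ` and poles `qᵏ / x`, over all integers `k`, interlace on the positive axis
because `q < x² < 1`. Pairing each zero with the next larger pole makes every angle difference
nonpositive, while pairing each pole with the next larger zero bounds the total below by `-π`. The
prefactor `-x` then turns the argument into the upper half-plane. -/
theorem canonMap_im_nonneg {z : ℂ} (hz : z ∈ annulus (q / x) (1 / x)) (hi : 0 < z.im) :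
    0 ≤ (canonMap q x z).im := by
  refine ge_of_tendsto' ((continuous_im.tendsto _).comp (h.tendsto_prod_canonMap hz)) fun n => ?_
  have hz0 := h.ne_zero_of_mem hz
  have hx0 := h.x_ne_zero
  have hq0 : (q : ℂ) ≠ 0 := by exact_mod_cast h.q_pos.ne'
  have hq := h.q_pos
  have hx := h.x_pos
  have hne : ∀ t : ℝ, z - t ≠ 0 := fun t e => by
    have := congrArg Complex.im e
    simp at this
    linarith
  obtain ⟨ρ, hρ, e1⟩ := prod_sub_div_sub_eq_viewAngle hi (fun k => x / q ^ k)
    (fun k => 1 / (q ^ k * x)) (n + 1)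
  obtain ⟨σ, hσ, e2⟩ := prod_sub_div_sub_eq_viewAngle hi (fun k => q ^ (k + 1) * x)
    (fun k => q ^ (k + 1) / x) (n + 1)
  -- Each pair contributes a ratio of leading coefficients `1 / x²`, which is positive and does not
  -- affect the argument.
  have f1 : (∏ k ∈ Finset.range (n + 1), (1 - (q : ℂ) ^ k * (z / x))) /
      (∏ k ∈ Finset.range (n + 1), (1 - (q : ℂ) ^ k * (z * x))) =
      ((1 / x ^ 2 : ℝ) : ℂ) ^ (n + 1) * ∏ k ∈ Finset.range (n + 1),
        ((z - (x / q ^ k : ℝ)) / (z - (1 / (q ^ k * x) : ℝ))) := by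
    rw [← Finset.prod_div_distrib, ← Finset.card_range (n + 1), ← Finset.prod_const,
      Finset.card_range, ← Finset.prod_mul_distrib]
    refine Finset.prod_congr rfl fun k _ => ?_
    have a1 := hne (1 / (q ^ k * x))
    have a2 : 1 - (q : ℂ) ^ k * (z * x) = -(q ^ k * x) * (z - (1 / (q ^ k * x) : ℝ)) := by
      push_cast
      field_simp
      ring
    have a3 : 1 - (q : ℂ) ^ k * (z / x) = -(q ^ k / x) * (z - (x / q ^ k : ℝ)) := by
      push_cast
      field_simp
      ring
    rw [a2, a3]
    generalize z - (1 / (q ^ k * x) : ℝ) = s at *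
    push_cast
    field_simp
  have f2 : (∏ k ∈ Finset.range (n + 1), (1 - (q : ℂ) ^ k * (q * x / z))) /
      (∏ k ∈ Finset.range (n + 1), (1 - (q : ℂ) ^ k * (q / (z * x)))) =
      ∏ k ∈ Finset.range (n + 1),
        ((z - (q ^ (k + 1) * x : ℝ)) / (z - (q ^ (k + 1) / x : ℝ))) := by
    rw [← Finset.prod_div_distrib]
    refine Finset.prod_congr rfl fun k _ => ?_
    have a1 := hne (q ^ (k + 1) / x)
    have a2 : 1 - (q : ℂ) ^ k * (q / (z * x)) = (z - (q ^ (k + 1) / x : ℝ)) / z := by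
      push_cast
      field_simp
      ring
    have a3 : 1 - (q : ℂ) ^ k * (q * x / z) = (z - (q ^ (k + 1) * x : ℝ)) / z := by
      push_cast
      field_simp
      ring
    rw [a2, a3, div_div_div_cancel_right₀ hz0]
  rw [Function.comp, mul_div_mul_comm, f1, f2, e1, e2]
  set S₁ := ∑ k ∈ Finset.range (n + 1),
    (viewAngle z (x / q ^ k) - viewAngle z (1 / (q ^ k * x))) with hS₁
  set S₂ := ∑ k ∈ Finset.range (n + 1),
    (viewAngle z (q ^ (k + 1) * x) - viewAngle z (q ^ (k + 1) / x)) with hS₂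
  have mono := viewAngle_mono hi
  have hxx : x ≤ 1 / x := by
    rw [le_div_iff₀ hx]
    nlinarith [h.x_lt_one]
  have b1 : S₁ ≤ 0 := by
    refine Finset.sum_nonpos fun k _ => sub_nonpos.2 (mono ?_)
    rw [mul_comm (q ^ k) x, ← div_div, div_le_div_iff_of_pos_right (pow_pos hq k)]
    exact hxx
  have b2 : S₂ ≤ 0 := by
    refine Finset.sum_nonpos fun k _ => sub_nonpos.2 (mono ?_)
    rw [div_eq_mul_one_div (q ^ (k + 1))]
    exact mul_le_mul_of_nonneg_left hxx (pow_pos hq _).le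
  -- Each pole is replaced by the next zero, which is where `q < x²` enters; the sum then
  -- telescopes. The terms `viewAngle z x` in this bound and in `b4` cancel.
  have b3 : viewAngle z x - Real.pi / 2 ≤ S₁ := by
    have t := Finset.sum_range_sub' (fun k : ℕ => viewAngle z (x / q ^ k)) (n + 1)
    have : viewAngle z (x / q ^ 0) - viewAngle z (x / q ^ (n + 1)) ≤ S₁ := by
      rw [← t]
      refine Finset.sum_le_sum fun k _ => sub_le_sub_left (mono ?_) _
      rw [div_le_div_iff₀ (by positivity) (by positivity), pow_succ]
      have := pow_pos hq k
      nlinarith [h.q_lt]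
    have p : viewAngle z (x / q ^ (n + 1)) < Real.pi / 2 := Real.arctan_lt_pi_div_two _
    simp only [pow_zero, div_one] at this
    linarith
  have b4 : -(Real.pi / 2) - viewAngle z x ≤ S₂ := by
    have t := Finset.sum_range_sub (fun k : ℕ => viewAngle z (q ^ k * x)) (n + 1)
    have : viewAngle z (q ^ (n + 1) * x) - viewAngle z (q ^ 0 * x) ≤ S₂ := by
      rw [← t]
      refine Finset.sum_le_sum fun k _ => sub_le_sub_left (mono ?_) _
      rw [div_le_iff₀ hx, pow_succ]
      have := pow_pos hq k
      nlinarith [h.q_lt]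
    have p : -(Real.pi / 2) < viewAngle z (q ^ (n + 1) * x) := Real.neg_pi_div_two_lt_arctan _
    simp only [pow_zero, one_mul] at this
    linarith
  have e3 : -(x : ℂ) * (((1 / x ^ 2 : ℝ) : ℂ) ^ (n + 1) * (ρ * exp (S₁ * I)) *
      (σ * exp (S₂ * I))) = ((-(x * (1 / x ^ 2) ^ (n + 1) * ρ * σ) : ℝ) : ℂ) *
        exp ((S₁ + S₂ : ℝ) * I) := by
    rw [ofReal_add, add_mul, exp_add]
    push_cast
    ring
  rw [e3, im_ofReal_mul, exp_ofReal_mul_I_im]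
  have b5 : Real.sin (S₁ + S₂) ≤ 0 :=
    Real.sin_nonpos_of_nonpos_of_neg_pi_le (by linarith) (by linarith)
  have b6 : 0 < x * (1 / x ^ 2) ^ (n + 1) * ρ * σ := by positivity
  nlinarith

end CanonParams

/-! ### Annuli in logarithmic coordinates. -/

theorem annulus_eq_exp_image {a b : ℝ} (ha : 0 < a) (hb : 0 < b) :
    annulus a b = exp '' {w : ℂ | Real.log a < w.re ∧ w.re < Real.log b} := by
  ext z
  constructor
  · intro hz
    have hz0 : 0 < ‖z‖ := ha.trans hz.1
    refine ⟨log z, ⟨?_, ?_⟩, exp_log (norm_pos_iff.1 hz0)⟩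
    · rw [log_re]
      exact Real.log_lt_log ha hz.1
    · rw [log_re]
      exact Real.log_lt_log hz0 hz.2
  · rintro ⟨w, ⟨h1, h2⟩, rfl⟩
    refine ⟨?_, ?_⟩
    · rw [norm_exp]
      exact (Real.log_lt_iff_lt_exp ha).1 h1
    · rw [norm_exp]
      exact (Real.lt_log_iff_exp_lt hb).1 h2

theorem convex_strip (a b : ℝ) : Convex ℝ {w : ℂ | a < w.re ∧ w.re < b} :=
  (convex_halfSpace_re_gt a).inter (convex_halfSpace_re_lt b)

theorem isPreconnected_annulus {a b : ℝ} (ha : 0 < a) (hb : 0 < b) :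
    IsPreconnected (annulus a b) := by
  rw [annulus_eq_exp_image ha hb]
  exact (convex_strip _ _).isPreconnected.image _ continuous_exp.continuousOn

/-- The rectangle mapped by `exp` to the upper half of an annulus. -/
def upperRect (a b : ℝ) : Set ℂ := {w | a < w.re ∧ w.re < b} ∩ {w | 0 < w.im ∧ w.im < Real.pi}

theorem convex_upperRect (a b : ℝ) : Convex ℝ (upperRect a b) :=
  (convex_strip a b).inter ((convex_halfSpace_im_gt 0).inter (convex_halfSpace_im_lt Real.pi))

theorem upper_annulus_eq_exp_image {a b : ℝ} (ha : 0 < a) (hb : 0 < b) :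
    annulus a b ∩ {z | 0 < z.im} = exp '' upperRect (Real.log a) (Real.log b) := by
  ext z
  constructor
  · rintro ⟨hz, hi⟩
    have hz0 : 0 < ‖z‖ := ha.trans hz.1
    refine ⟨log z, ⟨⟨?_, ?_⟩, ?_, ?_⟩, exp_log (norm_pos_iff.1 hz0)⟩
    · rw [log_re]
      exact Real.log_lt_log ha hz.1
    · rw [log_re]
      exact Real.log_lt_log hz0 hz.2
    · show 0 < (log z).im
      rw [log_im]
      refine lt_of_le_of_ne (arg_nonneg_iff.2 (le_of_lt hi)) fun e => ?_
      have := (arg_eq_zero_iff.1 e.symm).2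
      exact (ne_of_gt hi) this
    · show (log z).im < Real.pi
      rw [log_im, arg_lt_pi_iff]
      exact Or.inr (ne_of_gt hi)
  · rintro ⟨w, ⟨h1, h2⟩, rfl⟩
    refine ⟨?_, ?_⟩
    · rw [annulus_eq_exp_image ha hb]
      exact mem_image_of_mem _ h1
    · show 0 < (exp w).im
      rw [exp_im]
      exact mul_pos (Real.exp_pos _) (Real.sin_pos_of_pos_of_lt_pi h2.1 h2.2)

theorem frontier_annulus_subset {a b : ℝ} {z : ℂ} (hz : z ∈ frontier (annulus a b)) :
    ‖z‖ = a ∨ ‖z‖ = b := by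
  rw [(isOpen_annulus a b).frontier_eq] at hz
  have h1 : closure (annulus a b) ⊆ {z | a ≤ ‖z‖ ∧ ‖z‖ ≤ b} :=
    closure_minimal (fun z hz => ⟨hz.1.le, hz.2.le⟩)
      ((isClosed_le continuous_const continuous_norm).inter
        (isClosed_le continuous_norm continuous_const))
  obtain ⟨h2, h3⟩ := h1 hz.1
  by_contra hne
  push Not at hne
  exact hz.2 ⟨lt_of_le_of_ne h2 (Ne.symm hne.1), lt_of_le_of_ne h3 hne.2⟩

theorem closure_annulus_subset {a b c d : ℝ} (h1 : c < a) (h2 : b < d) :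
    closure (annulus a b) ⊆ annulus c d := by
  have h : closure (annulus a b) ⊆ {z | a ≤ ‖z‖ ∧ ‖z‖ ≤ b} :=
    closure_minimal (fun z hz => ⟨hz.1.le, hz.2.le⟩)
      ((isClosed_le continuous_const continuous_norm).inter
        (isClosed_le continuous_norm continuous_const))
  exact h.trans fun z hz => ⟨h1.trans_le hz.1, hz.2.trans_lt h2⟩

theorem isBounded_annulus (a b : ℝ) : Bornology.IsBounded (annulus a b) :=
  isBounded_ball.subset (fun _ hz => mem_ball_zero_iff.2 hz.2 : annulus a b ⊆ ball 0 b)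

theorem conj_eq_div_of_norm_sq {q : ℝ} {z : ℂ} (hz0 : z ≠ 0) (hz : ‖z‖ ^ 2 = q) :
    starRingEnd ℂ z = q / z := by
  rw [eq_div_iff hz0, mul_comm, mul_conj, normSq_eq_norm_sq, hz]

/-! ### Boundary values of the map and the sign of its logarithmic derivative. -/

namespace CanonParams

variable {q x : ℝ} (h : CanonParams q x)

include h

theorem mem_of_norm_one {z : ℂ} (hz : ‖z‖ = 1) : z ∈ annulus x (1 / x) := by
  refine ⟨hz ▸ h.x_lt_one, ?_⟩
  rw [hz, lt_div_iff₀ h.x_pos, one_mul]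
  exact h.x_lt_one

theorem mem_of_norm_sq {z : ℂ} (hz : ‖z‖ ^ 2 = q) : z ∈ annulus (q / x) x := by
  have h1 : ‖z‖ < x := by
    refine lt_of_pow_lt_pow_left₀ 2 h.x_pos.le ?_
    rw [hz]
    exact h.q_lt
  have h2 : 0 < ‖z‖ := by
    refine lt_of_le_of_ne (norm_nonneg _) fun e => ?_
    rw [← e] at hz
    have := h.q_pos
    norm_num at hz
    linarith
  refine ⟨?_, h1⟩
  rw [div_lt_iff₀ h.x_pos, ← hz]
  nlinarith

theorem outer_subset : annulus x (1 / x) ⊆ annulus (q / x) (1 / x) := by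
  refine annulus_mono ?_ le_rfl
  rw [div_le_iff₀ h.x_pos, ← sq]
  exact h.q_lt.le

theorem inner_subset : annulus (q / x) x ⊆ annulus (q / x) (1 / x) := by
  refine annulus_mono le_rfl ?_
  rw [le_div_iff₀ h.x_pos]
  nlinarith [h.x_pos, h.x_lt_one]

theorem norm_canonMap_of_norm_one {z : ℂ} (hz : ‖z‖ = 1) : ‖canonMap q x z‖ = 1 := by
  have hm := h.mem_of_norm_one hz
  have h1 := h.canonMap_inv_mul hm
  have hz0 : z ≠ 0 := h.ne_zero_of_mem (h.outer_subset hm)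
  have h2 := conj_eq_div_of_norm_sq (q := 1) hz0 (by rw [hz]; norm_num)
  rw [ofReal_one, one_div] at h2
  rw [← h2, canonMap_conj, mul_comm, mul_conj, normSq_eq_norm_sq] at h1
  have h3 : ‖canonMap q x z‖ ^ 2 = 1 := by exact_mod_cast h1
  nlinarith [norm_nonneg (canonMap q x z)]

theorem norm_canonMap_of_norm_sq {z : ℂ} (hz : ‖z‖ ^ 2 = q) : ‖canonMap q x z‖ = x := by
  have hm := h.mem_of_norm_sq hz
  have h1 := h.canonMap_q_div_mul hm
  have hz0 : z ≠ 0 := h.ne_zero_of_mem (h.inner_subset hm)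
  have h2 := conj_eq_div_of_norm_sq hz0 hz
  rw [← h2, canonMap_conj, mul_comm, mul_conj, normSq_eq_norm_sq] at h1
  have h3 : ‖canonMap q x z‖ ^ 2 = x ^ 2 := by exact_mod_cast h1
  exact (pow_left_inj₀ (norm_nonneg _) h.x_pos.le two_ne_zero).1 h3

theorem canonLogDer_im_of_im {z : ℂ} (hz : z ∈ annulus (q / x) (1 / x)) (hi : z.im = 0) :
    (canonLogDer q x z).im = 0 := by
  rw [← conj_eq_iff_im, ← h.canonLogDer_conj hz, conj_eq_iff_im.2 hi]

theorem canonLogDer_im_of_norm_one {z : ℂ} (hz : ‖z‖ = 1) : (canonLogDer q x z).im = 0 := by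
  have hm := h.mem_of_norm_one hz
  have hz0 : z ≠ 0 := h.ne_zero_of_mem (h.outer_subset hm)
  have h2 := conj_eq_div_of_norm_sq (q := 1) hz0 (by rw [hz]; norm_num)
  rw [ofReal_one, one_div] at h2
  rw [← conj_eq_iff_im, ← h.canonLogDer_conj (h.outer_subset hm), h2, h.canonLogDer_inv hm]

theorem canonLogDer_im_of_norm_sq {z : ℂ} (hz : ‖z‖ ^ 2 = q) : (canonLogDer q x z).im = 0 := by
  have hm := h.mem_of_norm_sq hz
  have hz0 : z ≠ 0 := h.ne_zero_of_mem (h.inner_subset hm)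
  rw [← conj_eq_iff_im, ← h.canonLogDer_conj (h.inner_subset hm), conj_eq_div_of_norm_sq hz0 hz,
    h.canonLogDer_q_div hm]

theorem isOpen_image_canonMap {s : Set ℂ} (hs : s ⊆ annulus (q / x) (1 / x)) (ho : IsOpen s) :
    IsOpen (canonMap q x '' s) := by
  have han : AnalyticOnNhd ℂ (canonMap q x) (annulus (q / x) (1 / x)) :=
    h.differentiableOn_canonMap.analyticOnNhd (isOpen_annulus _ _)
  rcases han.is_constant_or_isOpen
    (isPreconnected_annulus (div_pos h.q_pos h.x_pos) (one_div_pos.2 h.x_pos)) with ⟨c, hc⟩ | ho'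
  · exfalso
    have h1 : (1 : ℂ) ∈ annulus (q / x) (1 / x) := h.outer_subset (h.mem_of_norm_one (by simp))
    have h2 : (x : ℂ) ∈ annulus (q / x) (1 / x) := by
      have : ‖(x : ℂ)‖ = x := by simp [abs_of_pos h.x_pos]
      refine ⟨?_, ?_⟩
      · rw [this, div_lt_iff₀ h.x_pos, ← sq]
        exact h.q_lt
      · rw [this, lt_div_iff₀ h.x_pos]
        nlinarith [h.x_pos, h.x_lt_one]
    have h3 : canonMap q x 1 = 0 := by
      rw [hc 1 h1, ← hc x h2]
      exact canonMap_eq_zero_iff.2 rfl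
    have h4 := canonMap_eq_zero_iff.1 h3
    have h5 : (1 : ℝ) = x := by exact_mod_cast h4
    exact h.x_lt_one.ne h5.symm
  · exact ho' s hs ho

/-- The image of the upper half is open, so the weak inequality becomes strict. -/
theorem canonMap_im_pos {z : ℂ} (hz : z ∈ annulus (q / x) (1 / x)) (hi : 0 < z.im) :
    0 < (canonMap q x z).im := by
  have ho := h.isOpen_image_canonMap (s := annulus (q / x) (1 / x) ∩ {z | 0 < z.im})
    inter_subset_left ((isOpen_annulus _ _).inter (isOpen_lt continuous_const continuous_im))
  have hsub : canonMap q x '' (annulus (q / x) (1 / x) ∩ {z | 0 < z.im}) ⊆ {w | 0 ≤ w.im} := by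
    rintro _ ⟨w, hw, rfl⟩
    exact h.canonMap_im_nonneg hw.1 hw.2
  have := interior_maximal hsub ho ⟨z, ⟨hz, hi⟩, rfl⟩
  rwa [interior_setOfPred_le_im] at this

theorem canonMap_im_neg {z : ℂ} (hz : z ∈ annulus (q / x) (1 / x)) (hi : z.im < 0) :
    (canonMap q x z).im < 0 := by
  have := h.canonMap_im_pos (conj_mem_annulus hz) (by simpa using hi)
  rw [canonMap_conj] at this
  simpa using this

omit h in
theorem canonMap_im_of_im {z : ℂ} (hi : z.im = 0) : (canonMap q x z).im = 0 := by
  rw [← conj_eq_iff_im, ← canonMap_conj, conj_eq_iff_im.2 hi]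

variable {r : ℝ} (hr : 0 < r) (hrq : r ^ 2 = q)

include hr hrq

omit hr in
theorem r_lt_x : r < x := lt_of_pow_lt_pow_left₀ 2 h.x_pos.le (hrq ▸ h.q_lt)

theorem q_div_x_lt : q / x < r := by
  rw [div_lt_iff₀ h.x_pos, ← hrq, sq]
  exact mul_lt_mul_of_pos_left (h.r_lt_x hrq) hr

omit hr hrq in
theorem one_lt_one_div : 1 < 1 / x := by
  rw [lt_div_iff₀ h.x_pos, one_mul]
  exact h.x_lt_one

theorem annulus_subset : annulus r 1 ⊆ annulus (q / x) (1 / x) :=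
  annulus_mono (h.q_div_x_lt hr hrq).le (h.one_lt_one_div).le

theorem closure_subset : closure (annulus r 1) ⊆ annulus (q / x) (1 / x) :=
  closure_annulus_subset (h.q_div_x_lt hr hrq) (h.one_lt_one_div)

omit hr in
theorem x_mem : (x : ℂ) ∈ annulus r 1 := by
  have : ‖(x : ℂ)‖ = x := by simp [abs_of_pos h.x_pos]
  exact ⟨by rw [this]; exact h.r_lt_x hrq, by rw [this]; exact h.x_lt_one⟩

theorem norm_canonMap_lt {z : ℂ} (hz : z ∈ annulus r 1) : ‖canonMap q x z‖ < 1 := by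
  have h1 : canonMap q x '' annulus r 1 ⊆ closedBall 0 1 := by
    rintro _ ⟨w, hw, rfl⟩
    rw [mem_closedBall_zero_iff]
    refine norm_le_of_forall_mem_frontier_norm_le (isBounded_annulus r 1)
      (h.differentiableOn_canonMap.mono (h.closure_subset hr hrq)).diffContOnCl (fun u hu => ?_)
      (subset_closure hw)
    rcases frontier_annulus_subset hu with e | e
    · rw [h.norm_canonMap_of_norm_sq (by rw [e, hrq])]
      exact h.x_lt_one.le
    · rw [h.norm_canonMap_of_norm_one e]
  have h2 := interior_maximal h1
    (h.isOpen_image_canonMap (h.annulus_subset hr hrq) (isOpen_annulus r 1)) ⟨z, hz, rfl⟩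
  rw [interior_closedBall _ one_ne_zero] at h2
  simpa using h2

omit hr hrq in
theorem div_sub_im_nonpos {z : ℂ} (hi : 0 ≤ z.im) : (z / (z - x)).im ≤ 0 := by
  have : (z / (z - x)).im = -(x * z.im / normSq (z - x)) := by
    rw [div_im]
    simp
    ring
  rw [this, neg_nonpos]
  exact div_nonneg (mul_nonneg h.x_pos.le hi) (normSq_nonneg _)

/-- The imaginary part vanishes on the boundary of the half annulus except at the pole `x`. Near `x`
the singular part `z / (z - x)` has nonpositive imaginary part and the regular part is real at `x`,
so a small half-disc can be removed at the cost of an error `δ`. -/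
theorem canonLogDer_im_nonpos {z : ℂ} (hz : z ∈ annulus r 1) (hi : 0 < z.im) :
    (canonLogDer q x z).im ≤ 0 := by
  refine le_of_forall_pos_le_add fun δ hδ => ?_
  rw [zero_add]
  have hxm := h.annulus_subset hr hrq (h.x_mem hrq)
  have hcont : ContinuousAt (fun z => (canonLogDer q x z - z / (z - x)).im) (x : ℂ) :=
    continuous_im.continuousAt.comp (h.differentiableOn_canonLogDer_sub.differentiableAt
      ((isOpen_annulus _ _).mem_nhds hxm)).continuousAt
  have hval : (fun z => (canonLogDer q x z - z / (z - x)).im) (x : ℂ) < δ := by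
    simp [h.canonLogDer_im_of_im hxm (ofReal_im x), hδ]
  obtain ⟨η, hη, hball⟩ := Metric.eventually_nhds_iff.1 (hcont.eventually_lt_const hval)
  have hzx : 0 < ‖z - x‖ := by
    rw [norm_pos_iff, sub_ne_zero]
    rintro rfl
    simp at hi
  set ε := min (η / 2) (‖z - x‖ / 2) with hε
  have hε0 : 0 < ε := lt_min (by linarith) (by linarith)
  set U : Set ℂ := (annulus r 1 ∩ {w | 0 < w.im}) ∩ {w | ε < ‖w - x‖} with hU
  have hUo : IsOpen U := ((isOpen_annulus r 1).inter (isOpen_lt continuous_const continuous_im)).inter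
    (isOpen_lt continuous_const (by fun_prop))
  have hzU : z ∈ U := ⟨⟨hz, hi⟩, (min_le_right _ _).trans_lt (half_lt_self hzx)⟩
  have hcl : closure U ⊆ (closure (annulus r 1) ∩ {w | 0 ≤ w.im}) ∩ {w | ε ≤ ‖w - x‖} := by
    refine closure_minimal ?_ ((isClosed_closure.inter
      (isClosed_le continuous_const continuous_im)).inter
        (isClosed_le continuous_const (by fun_prop)))
    intro w hw
    have h1 : 0 < w.im := hw.1.2
    have h2 : ε < ‖w - x‖ := hw.2
    exact ⟨⟨subset_closure hw.1.1, h1.le⟩, h2.le⟩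
  -- The modulus of `exp (-i L)` is `exp (Im L)`, so the maximum modulus principle bounds `Im L`.
  have hd : DifferentiableOn ℂ (fun w => exp (-I * canonLogDer q x w)) (closure U) := by
    refine ((h.differentiableOn_canonLogDer.mono fun w hw => ?_).const_mul (-I)).cexp
    refine ⟨h.closure_subset hr hrq (hcl hw).1.1, ?_⟩
    rintro rfl
    have := (hcl hw).2
    simp at this
    linarith
  have hnorm : ∀ w, ‖exp (-I * canonLogDer q x w)‖ = Real.exp (canonLogDer q x w).im := by
    intro w
    rw [norm_exp]
    simp
  have key := norm_le_of_forall_mem_frontier_norm_le (C := Real.exp δ)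
    ((isBounded_annulus r 1).subset (inter_subset_left.trans inter_subset_left : U ⊆ annulus r 1))
    hd.diffContOnCl (fun w hw => ?_) (subset_closure hzU)
  · rwa [hnorm, Real.exp_le_exp] at key
  · rw [hnorm, Real.exp_le_exp]
    have hw1 := hcl (frontier_subset_closure hw)
    have hw2 : w ∉ U := fun hmem => by
      rw [hUo.frontier_eq] at hw
      exact hw.2 hmem
    have hwm := h.closure_subset hr hrq hw1.1.1
    by_cases c1 : w ∈ annulus r 1
    · by_cases c2 : 0 < w.im
      · have c3 : ‖w - x‖ = ε := by
          refine le_antisymm (not_lt.1 fun c => hw2 ⟨⟨c1, c2⟩, c⟩) hw1.2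
        have := @hball w (by
          rw [dist_eq_norm, c3]
          exact (min_le_left _ _).trans_lt (by linarith))
        rw [sub_im] at this
        linarith [h.div_sub_im_nonpos c2.le]
      · have c3 : w.im = 0 := le_antisymm (not_lt.1 c2) hw1.1.2
        rw [h.canonLogDer_im_of_im hwm c3]
        exact hδ.le
    · have : w ∈ frontier (annulus r 1) := by
        rw [(isOpen_annulus r 1).frontier_eq]
        exact ⟨hw1.1.1, c1⟩
      rcases frontier_annulus_subset this with e | e
      · rw [h.canonLogDer_im_of_norm_sq (by rw [e, hrq])]
        exact hδ.le
      · rw [h.canonLogDer_im_of_norm_one e]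
        exact hδ.le

theorem canonLogDer_im_neg {z : ℂ} (hz : z ∈ annulus r 1) (hi : 0 < z.im) :
    (canonLogDer q x z).im < 0 := by
  set V : Set ℂ := annulus r 1 ∩ {w | 0 < w.im} with hV
  have hVo : IsOpen V := (isOpen_annulus r 1).inter (isOpen_lt continuous_const continuous_im)
  have hVp : IsPreconnected V := by
    rw [hV, upper_annulus_eq_exp_image hr one_pos]
    exact (convex_upperRect _ _).isPreconnected.image _ continuous_exp.continuousOn
  have hVx : ∀ w ∈ V, w ≠ x := by
    rintro w hw rfl
    have := hw.2
    simp at this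
  have han : AnalyticOnNhd ℂ (canonLogDer q x) V :=
    (h.differentiableOn_canonLogDer.mono fun w hw =>
      ⟨h.annulus_subset hr hrq hw.1, hVx w hw⟩).analyticOnNhd hVo
  rcases han.is_constant_or_isOpen hVp with ⟨c, hc⟩ | ho
  -- A constant is impossible: `(z - x) L(z)` tends to `x`, the contribution of the simple zero of
  -- the map, whereas `c (z - x)` tends to `0`.
  · exfalso
    have hxm := h.x_mem hrq
    have hcl : (x : ℂ) ∈ closure V := by
      have t : Tendsto (fun t : ℝ => (x : ℂ) + t * I) (𝓝[>] 0) (𝓝 (x : ℂ)) := by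
        have : Continuous fun t : ℝ => (x : ℂ) + t * I := by fun_prop
        simpa using (this.tendsto 0).mono_left nhdsWithin_le_nhds
      refine mem_closure_of_tendsto t ?_
      filter_upwards [t.eventually ((isOpen_annulus r 1).mem_nhds hxm), self_mem_nhdsWithin]
        with s h1 h2
      exact ⟨h1, by simpa using h2⟩
    have : (𝓝[V] (x : ℂ)).NeBot := mem_closure_iff_nhdsWithin_neBot.1 hcl
    have hcont : ContinuousAt (fun z => canonLogDer q x z - z / (z - x)) (x : ℂ) :=
      (h.differentiableOn_canonLogDer_sub.differentiableAt
        ((isOpen_annulus _ _).mem_nhds (h.annulus_subset hr hrq hxm))).continuousAt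
    have hs : Tendsto (fun w : ℂ => w - x) (𝓝 (x : ℂ)) (𝓝 0) := by
      have : Continuous fun w : ℂ => w - x := by fun_prop
      simpa using this.tendsto (x : ℂ)
    have t1 := ((hcont.tendsto.mul hs).add (tendsto_id (x := 𝓝 (x : ℂ)))).mono_left
      (nhdsWithin_le_nhds (s := V))
    have t2 := (hs.const_mul c).mono_left (nhdsWithin_le_nhds (s := V))
    have t3 := t2.congr' (f₂ := fun w => (canonLogDer q x w - w / (w - x)) * (w - x) + id w) (by
      filter_upwards [self_mem_nhdsWithin] with w hw
      have := sub_ne_zero.2 (hVx w hw)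
      rw [hc w hw]
      simp only [id]
      field_simp
      ring)
    have := tendsto_nhds_unique t1 t3
    simp [h.x_pos.ne'] at this
  · have hsub : canonLogDer q x '' V ⊆ {w | w.im ≤ 0} := by
      rintro _ ⟨w, hw, rfl⟩
      exact h.canonLogDer_im_nonpos hr hrq hw.1 hw.2
    have := interior_maximal hsub (ho V Subset.rfl hVo) ⟨z, ⟨hz, hi⟩, rfl⟩
    rwa [interior_setOfPred_im_le] at this

end CanonParams

/-! ### Univalence of the explicit map. -/

/-- The Noshiro–Warschawski criterion: a function on a convex set whose derivative has negative
imaginary part is injective. -/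
theorem injOn_of_deriv_im_neg {f f' : ℂ → ℂ} {s : Set ℂ} (hs : Convex ℝ s)
    (hf : ∀ w ∈ s, HasDerivAt f (f' w) w) (hf' : ∀ w ∈ s, (f' w).im < 0) : InjOn f s := by
  intro a ha b hb hab
  by_contra hne
  have hba : b - a ≠ 0 := sub_ne_zero.2 (Ne.symm hne)
  have hmem : ∀ t ∈ Icc (0 : ℝ) 1, a + t * (b - a) ∈ s := by
    intro t ht
    have := hs.add_smul_sub_mem ha hb ht
    simpa using this
  have hd : ∀ t ∈ Icc (0 : ℝ) 1, HasDerivAt (fun t : ℝ => (f (a + t * (b - a)) / (b - a)).im)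
      (f' (a + t * (b - a))).im t := by
    intro t ht
    have h1 : HasDerivAt (fun t : ℝ => a + (t : ℂ) * (b - a)) (b - a) t := by
      simpa using ((hasDerivAt_id t).ofReal_comp.mul_const (b - a)).const_add a
    have h2 := ((hf _ (hmem t ht)).comp t h1).div_const (b - a)
    have h3 := imCLM.hasFDerivAt.comp_hasDerivAt t h2
    refine h3.congr_deriv ?_
    simp [mul_div_cancel_right₀ _ hba]
  -- Rolle's theorem along the segment: after division by `b - a`, the derivative of the imaginary
  -- part is exactly `Im f'`.
  obtain ⟨c, hc, h0⟩ := exists_hasDerivAt_eq_zero (zero_lt_one' ℝ)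
    (fun t ht => (hd t ht).continuousAt.continuousWithinAt) (by simp [hab])
    (fun t ht => hd t (Ioo_subset_Icc_self ht))
  exact (hf' _ (hmem c (Ioo_subset_Icc_self hc))).ne h0

theorem mem_closure_annulus_of_norm_eq {r : ℝ} (hr : 0 < r) (hr1 : r < 1) {b : ℂ} (hb : ‖b‖ = r) :
    b ∈ closure (annulus r 1) := by
  have t : Tendsto (fun s : ℝ => (s : ℂ) * b) (𝓝[>] 1) (𝓝 b) := by
    have : Continuous fun s : ℝ => (s : ℂ) * b := by fun_prop
    simpa using (this.tendsto 1).mono_left nhdsWithin_le_nhds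
  refine mem_closure_of_tendsto t ?_
  have h1 : ∀ᶠ w : ℂ in 𝓝 b, ‖w‖ < 1 :=
    (isOpen_lt continuous_norm continuous_const).mem_nhds (by simpa [hb] using hr1)
  filter_upwards [t.eventually h1, self_mem_nhdsWithin] with s h1 h2
  refine ⟨?_, h1⟩
  have h2' : 1 < s := h2
  rw [norm_mul, Complex.norm_real, Real.norm_eq_abs, abs_of_pos (by linarith), hb]
  nlinarith

namespace CanonParams

variable {q x : ℝ} (h : CanonParams q x)

include h

theorem im_pos_of_canonMap {z : ℂ} (hz : z ∈ annulus (q / x) (1 / x))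
    (hi : 0 < (canonMap q x z).im) : 0 < z.im := by
  rcases lt_trichotomy z.im 0 with c | c | c
  · linarith [h.canonMap_im_neg hz c]
  · linarith [canonMap_im_of_im (q := q) (x := x) c]
  · exact c

theorem im_eq_zero_of_canonMap {z : ℂ} (hz : z ∈ annulus (q / x) (1 / x))
    (hi : (canonMap q x z).im = 0) : z.im = 0 := by
  rcases lt_trichotomy z.im 0 with c | c | c
  · linarith [h.canonMap_im_neg hz c]
  · exact c
  · linarith [h.canonMap_im_pos hz c]

variable {r : ℝ} (hr : 0 < r) (hrq : r ^ 2 = q)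

include hr hrq

-- The constant `c` rotates the values into the domain of the principal logarithm: `1` serves on the
-- open upper half annulus, `-I` on its inner boundary.
omit hr hrq in
theorem hasDerivAt_log_canonMap_exp (c : ℂ) (hc : c ≠ 0) {w : ℂ}
    (hw : exp w ∈ annulus (q / x) (1 / x)) (hwx : exp w ≠ x)
    (hs : c * canonMap q x (exp w) ∈ slitPlane) :
    HasDerivAt (fun w => log (c * canonMap q x (exp w))) (canonLogDer q x (exp w)) w := by
  have h1 := (((h.hasDerivAt_canonMap hw hwx).comp w (hasDerivAt_exp w)).const_mul c).clog hs
  refine h1.congr_deriv ?_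
  have h2 : canonMap q x (exp w) ≠ 0 := fun e => hwx (canonMap_eq_zero_iff.1 e)
  have h3 := exp_ne_zero w
  simp only [Function.comp]
  field_simp

theorem injOn_canonMap_upper : InjOn (canonMap q x) (annulus r 1 ∩ {z | 0 < z.im}) := by
  have key : InjOn (fun w => log (1 * canonMap q x (exp w)))
      (upperRect (Real.log r) (Real.log 1)) := by
    have hm : ∀ w ∈ upperRect (Real.log r) (Real.log 1), exp w ∈ annulus r 1 ∩ {z | 0 < z.im} := by
      intro w hw
      rw [upper_annulus_eq_exp_image hr one_pos]
      exact mem_image_of_mem _ hw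
    refine injOn_of_deriv_im_neg (convex_upperRect _ _) (fun w hw => ?_)
      (fun w hw => h.canonLogDer_im_neg hr hrq (hm w hw).1 (hm w hw).2)
    refine h.hasDerivAt_log_canonMap_exp 1 one_ne_zero
      (h.annulus_subset hr hrq (hm w hw).1) ?_ ?_
    · intro e
      have := (hm w hw).2
      rw [e] at this
      simp at this
    · rw [one_mul]
      exact Or.inr (h.canonMap_im_pos (h.annulus_subset hr hrq (hm w hw).1) (hm w hw).2).ne'
  rw [upper_annulus_eq_exp_image hr one_pos]
  rintro _ ⟨w₁, hw₁, rfl⟩ _ ⟨w₂, hw₂, rfl⟩ e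
  rw [key hw₁ hw₂ (by simp only [e])]

theorem injOn_canonMap : InjOn (canonMap q x) (annulus r 1) := by
  have hup := h.injOn_canonMap_upper hr hrq
  have hsub := h.annulus_subset hr hrq
  intro a ha b hb hab
  rcases lt_trichotomy a.im 0 with c | c | c
  · have ea : 0 < (canonMap q x (starRingEnd ℂ a)).im :=
      h.canonMap_im_pos (conj_mem_annulus (hsub ha)) (by simpa using c)
    have e : canonMap q x (starRingEnd ℂ a) = canonMap q x (starRingEnd ℂ b) := by
      rw [canonMap_conj, canonMap_conj, hab]
    have := hup ⟨conj_mem_annulus ha, by simpa using c⟩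
      ⟨conj_mem_annulus hb, h.im_pos_of_canonMap (conj_mem_annulus (hsub hb)) (e ▸ ea)⟩ e
    exact (starRingEnd ℂ).injective this
  -- For real `a`, two distinct preimages of one real value have disjoint neighbourhoods with open
  -- images. A value slightly above the real axis would then have two preimages in the upper half
  -- annulus.
  · by_contra hne
    obtain ⟨U, V, hU, hV, haU, hbV, hUV⟩ := t2_separation hne
    have hA := isOpen_annulus r 1
    have o1 := h.isOpen_image_canonMap (s := annulus r 1 ∩ U) (inter_subset_left.trans hsub)
      (hA.inter hU)
    have o2 := h.isOpen_image_canonMap (s := annulus r 1 ∩ V) (inter_subset_left.trans hsub)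
      (hA.inter hV)
    have hF : (canonMap q x a).im = 0 := canonMap_im_of_im c
    have t : Tendsto (fun t : ℝ => canonMap q x a + t * I) (𝓝[>] 0) (𝓝 (canonMap q x a)) := by
      have : Continuous fun t : ℝ => canonMap q x a + t * I := by fun_prop
      simpa using (this.tendsto 0).mono_left nhdsWithin_le_nhds
    obtain ⟨s, hs1, hs2⟩ := ((t.eventually ((o1.inter o2).mem_nhds
      ⟨⟨a, ⟨ha, haU⟩, rfl⟩, ⟨b, ⟨hb, hbV⟩, hab.symm⟩⟩)).and self_mem_nhdsWithin).exists
    obtain ⟨⟨u, hu, eu⟩, ⟨v, hv, ev⟩⟩ := hs1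
    have hpos : 0 < (canonMap q x a + s * I).im := by simpa [hF] using hs2
    have := hup ⟨hu.1, h.im_pos_of_canonMap (hsub hu.1) (eu ▸ hpos)⟩
      ⟨hv.1, h.im_pos_of_canonMap (hsub hv.1) (ev ▸ hpos)⟩ (eu.trans ev.symm)
    subst this
    exact hUV.le_bot ⟨hu.2, hv.2⟩
  · have ea : 0 < (canonMap q x a).im := h.canonMap_im_pos (hsub ha) c
    exact hup ⟨ha, c⟩ ⟨hb, h.im_pos_of_canonMap (hsub hb) (hab ▸ ea)⟩ hab

/-! ### The omitted set as the image of the inner circle. -/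

omit hr hrq in
theorem r_lt_one (hrq : r ^ 2 = q) : r < 1 := (h.r_lt_x hrq).trans h.x_lt_one

theorem canonMap_ne_of_norm_eq {a b : ℂ} (ha : a ∈ annulus r 1) (hb : ‖b‖ = r) :
    canonMap q x a ≠ canonMap q x b := by
  intro hab
  have hne : a ≠ b := by
    rintro rfl
    exact ha.1.ne' hb
  have hsub := h.annulus_subset hr hrq
  obtain ⟨U, V, hU, hV, haU, hbV, hUV⟩ := t2_separation hne
  have o1 := h.isOpen_image_canonMap (s := annulus r 1 ∩ U) (inter_subset_left.trans hsub)
    ((isOpen_annulus r 1).inter hU)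
  have hbm : b ∈ annulus (q / x) (1 / x) := h.inner_subset (h.mem_of_norm_sq (by rw [hb, hrq]))
  have hcont : ContinuousAt (canonMap q x) b :=
    (h.differentiableOn_canonMap.differentiableAt ((isOpen_annulus _ _).mem_nhds hbm)).continuousAt
  have hev := hcont.eventually (o1.mem_nhds ⟨a, ⟨ha, haU⟩, hab⟩)
  obtain ⟨b', ⟨⟨u, hu, eu⟩, hb'V⟩, hb'⟩ := mem_closure_iff_nhds.1
    (mem_closure_annulus_of_norm_eq hr (h.r_lt_one hrq) hb) _
    (Filter.inter_mem hev (hV.mem_nhds hbV))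
  have := h.injOn_canonMap hr hrq hu.1 hb' eu
  subst this
  exact hUV.le_bot ⟨hu.2, hb'V⟩

-- The value is real of modulus `x`, with the sign of `t - x`. Thus both ends of the upper inner
-- semicircle go to `-x`.
omit hr in
theorem canonMap_of_real {t : ℝ} (ht : |t| = r) : canonMap q x t = -x := by
  have hn : ‖canonMap q x t‖ = x := h.norm_canonMap_of_norm_sq (by
    rw [Complex.norm_real, Real.norm_eq_abs, ht, hrq])
  have e1 : (canonExp q x t).im = 0 := by
    rw [← conj_eq_iff_im, ← canonExp_conj, conj_ofReal]
  have e2 : canonMap q x t = (((t - x) * Real.exp (canonExp q x t).re : ℝ) : ℂ) := by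
    have e3 : canonExp q x t = ((canonExp q x t).re : ℂ) := by
      apply Complex.ext <;> simp [e1]
    rw [canonMap, e3]
    push_cast
    simp
  have hlt : t < x := (le_abs_self t).trans_lt (ht ▸ h.r_lt_x hrq)
  have hneg : (t - x) * Real.exp (canonExp q x t).re < 0 :=
    mul_neg_of_neg_of_pos (by linarith) (Real.exp_pos _)
  rw [e2, Complex.norm_real, Real.norm_eq_abs, abs_of_neg hneg] at hn
  have e4 : (t - x) * Real.exp (canonExp q x t).re = -x := by linarith
  rw [e2, e4, ofReal_neg]

omit hr in
theorem canonMap_eq_neg_of_im {b : ℂ} (hb : ‖b‖ = r) (hi : b.im = 0) : canonMap q x b = -x := by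
  have e : b = (b.re : ℂ) := by apply Complex.ext <;> simp [hi]
  rw [e]
  refine h.canonMap_of_real hrq ?_
  rw [← hb, e]
  simp

theorem slit_canonMap_eq_image : slit r (canonMap q x) = canonMap q x '' sphere 0 r := by
  have hsub := h.annulus_subset hr hrq
  have hx := h.x_pos
  have hopen := h.isOpen_image_canonMap hsub (isOpen_annulus r 1)
  have hK : IsCompact (closure (annulus r 1)) := (isBounded_annulus r 1).isCompact_closure
  have hKc : ContinuousOn (canonMap q x) (closure (annulus r 1)) :=
    h.differentiableOn_canonMap.continuousOn.mono (h.closure_subset hr hrq)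
  have hcl : closure (canonMap q x '' annulus r 1) ⊆ canonMap q x '' closure (annulus r 1) :=
    closure_minimal (image_mono subset_closure) (hK.image_of_continuousOn hKc).isClosed
  -- The image is open, and by compactness of the closed annulus it is relatively closed in the disk
  -- minus the image of the inner circle. A connected set in that region which meets the image
  -- therefore lies in it.
  have key : ∀ S : Set ℂ, IsPreconnected S → S ⊆ ball 0 1 \ (canonMap q x '' sphere 0 r) →
      (S ∩ canonMap q x '' annulus r 1).Nonempty → S ⊆ canonMap q x '' annulus r 1 := by
    intro S hS hS1 hS2
    refine hS.subset_of_closure_inter_subset hopen hS2 ?_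
    rintro w ⟨hw1, hw2⟩
    obtain ⟨z, hz, rfl⟩ := hcl hw1
    by_cases hzA : z ∈ annulus r 1
    · exact ⟨z, hzA, rfl⟩
    · exfalso
      have : z ∈ frontier (annulus r 1) := by
        rw [(isOpen_annulus r 1).frontier_eq]
        exact ⟨hz, hzA⟩
      rcases frontier_annulus_subset this with e | e
      · exact (hS1 hw2).2 ⟨z, by simpa using e, rfl⟩
      · have h1 := (hS1 hw2).1
        rw [mem_ball_zero_iff, h.norm_canonMap_of_norm_one e] at h1
        exact lt_irrefl _ h1
  have hΓ : ∀ w ∈ canonMap q x '' sphere 0 r, ‖w‖ = x := by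
    rintro _ ⟨z, hz, rfl⟩
    rw [mem_sphere_zero_iff_norm] at hz
    exact h.norm_canonMap_of_norm_sq (by rw [hz, hrq])
  have h0 : (0 : ℂ) ∈ canonMap q x '' annulus r 1 :=
    ⟨x, h.x_mem hrq, canonMap_eq_zero_iff.2 rfl⟩
  have c1 : ∀ w : ℂ, ‖w‖ ≤ x → w ∉ canonMap q x '' sphere 0 r → w ∈ canonMap q x '' annulus r 1 := by
    intro w hw hwΓ
    -- Adding a boundary point keeps the disk connected, so single points of `|w| = x` off the arc
    -- are reached too.
    have hpre : IsPreconnected (insert w (ball (0 : ℂ) x)) := by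
      refine (convex_ball (0 : ℂ) x).isPreconnected.subset_closure (subset_insert _ _) ?_
      rw [closure_ball _ hx.ne']
      exact insert_subset (by simpa using hw) ball_subset_closedBall
    refine key _ hpre ?_ ⟨0, Or.inr (by simpa using hx), h0⟩ (mem_insert _ _)
    refine insert_subset ⟨?_, hwΓ⟩ fun u hu => ⟨?_, fun hu' => ?_⟩
    · simpa using hw.trans_lt h.x_lt_one
    · exact ball_subset_ball h.x_lt_one.le hu
    · rw [mem_ball_zero_iff, hΓ u hu'] at hu
      exact lt_irrefl _ hu
  -- The point `x` is the gate through which the argument passes from the disk `|w| < x` to the ring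
  -- outside it.
  have hxΓ : (x : ℂ) ∉ canonMap q x '' sphere 0 r := by
    rintro ⟨z, hz, e⟩
    rw [mem_sphere_zero_iff_norm] at hz
    have hzm := h.inner_subset (h.mem_of_norm_sq (z := z) (by rw [hz, hrq]))
    have hi := h.im_eq_zero_of_canonMap hzm (by rw [e]; simp)
    rw [h.canonMap_eq_neg_of_im hrq hz hi] at e
    have : -x = x := by exact_mod_cast e
    linarith
  have hxn : ‖(x : ℂ)‖ = x := by simp [abs_of_pos hx]
  have hxA := c1 x hxn.le hxΓ
  have c2 : ∀ w : ℂ, x < ‖w‖ → ‖w‖ < 1 → w ∈ canonMap q x '' annulus r 1 := by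
    intro w hw1 hw2
    have hpre : IsPreconnected (insert (x : ℂ) (annulus x 1)) :=
      (isPreconnected_annulus hx one_pos).subset_closure (subset_insert _ _)
        (insert_subset (mem_closure_annulus_of_norm_eq hx h.x_lt_one hxn) subset_closure)
    refine key _ hpre ?_ ⟨x, mem_insert _ _, hxA⟩ (Or.inr ⟨hw1, hw2⟩)
    refine insert_subset ⟨?_, hxΓ⟩ fun u hu => ⟨?_, fun hu' => ?_⟩
    · rw [mem_ball_zero_iff, hxn]
      exact h.x_lt_one
    · simpa using hu.2
    · exact hu.1.ne' (hΓ u hu')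
  ext w
  constructor
  · rintro ⟨hw1, hw2⟩
    rw [mem_ball_zero_iff] at hw1
    by_contra hw
    rcases le_or_gt ‖w‖ x with c | c
    · exact hw2 (c1 w c hw)
    · exact hw2 (c2 w c hw1)
  · rintro ⟨z, hz, rfl⟩
    refine ⟨?_, ?_⟩
    · rw [mem_ball_zero_iff, hΓ _ ⟨z, hz, rfl⟩]
      exact h.x_lt_one
    · rintro ⟨a, ha, e⟩
      exact h.canonMap_ne_of_norm_eq hr hrq ha (by simpa using hz) e

end CanonParams

/-! ### Circular arcs determine their radius and endpoints. -/

theorem ofReal_mul_exp_mem_circularArc_iff {ρ a b t : ℝ} (hρ : 0 < ρ) :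
    (ρ : ℂ) * exp (t * I) ∈ circularArc ρ a b ↔ ∃ n : ℤ, t + n * (2 * Real.pi) ∈ Icc a b := by
  have hρ' : (ρ : ℂ) ≠ 0 := by exact_mod_cast hρ.ne'
  constructor
  · rintro ⟨s, hs, e⟩
    obtain ⟨n, hn⟩ := exp_eq_exp_iff_exists_int.1 (mul_left_cancel₀ hρ' e)
    refine ⟨n, ?_⟩
    have h2 := congrArg Complex.im hn
    have h1 : s = t + n * (2 * Real.pi) := by simpa using h2
    rwa [← h1]
  · rintro ⟨n, hn⟩
    refine ⟨_, hn, ?_⟩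
    show (ρ : ℂ) * exp (((t + n * (2 * Real.pi) : ℝ) : ℂ) * I) = ρ * exp (t * I)
    congr 1
    rw [exp_eq_exp_iff_exists_int]
    refine ⟨n, ?_⟩
    push_cast
    ring

theorem norm_of_mem_circularArc {ρ a b : ℝ} (hρ : 0 < ρ) {w : ℂ} (hw : w ∈ circularArc ρ a b) :
    ‖w‖ = ρ := by
  obtain ⟨s, -, rfl⟩ := hw
  simp [norm_exp_ofReal_mul_I, abs_of_pos hρ]

theorem exists_int_of_circularArc_eq {ρ a b a' b' : ℝ} (hρ : 0 < ρ) (hab : a < b)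
    (hab2 : b < a + 2 * Real.pi) (h : circularArc ρ a b = circularArc ρ a' b') :
    ∃ n : ℤ, a + n * (2 * Real.pi) = a' := by
  have hπ := Real.pi_pos
  have h1 : (ρ : ℂ) * exp (a * I) ∈ circularArc ρ a' b' := h ▸ ⟨a, ⟨le_rfl, hab.le⟩, rfl⟩
  obtain ⟨n, hn1, hn2⟩ := (ofReal_mul_exp_mem_circularArc_iff hρ).1 h1
  refine ⟨n, le_antisymm (not_lt.1 fun hlt => ?_) hn1⟩
  -- If the second arc began strictly before `a` (mod `2π`), it would contain an angle `s` in the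
  -- gap `(b - 2π, a)` omitted by the first.
  obtain ⟨s, hs1, hs2⟩ := exists_between (max_lt (show a' - n * (2 * Real.pi) < a by linarith)
    (show b - 2 * Real.pi < a by linarith))
  rw [max_lt_iff] at hs1
  have h2 : (ρ : ℂ) * exp (s * I) ∈ circularArc ρ a b :=
    h ▸ (ofReal_mul_exp_mem_circularArc_iff hρ).2 ⟨n, by linarith, by linarith⟩
  obtain ⟨m, hm1, hm2⟩ := (ofReal_mul_exp_mem_circularArc_iff hρ).1 h2
  rcases le_or_gt m 0 with c | c
  · have : (m : ℝ) ≤ 0 := by exact_mod_cast c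
    nlinarith
  · have : (1 : ℝ) ≤ m := by exact_mod_cast c
    nlinarith

theorem circularArc_conj {ρ a b : ℝ} :
    starRingEnd ℂ '' circularArc ρ a b = circularArc ρ (-b) (-a) := by
  have key : ∀ a b : ℝ, starRingEnd ℂ '' circularArc ρ a b ⊆ circularArc ρ (-b) (-a) := by
    rintro a b _ ⟨_, ⟨t, ht, rfl⟩, rfl⟩
    refine ⟨-t, ⟨neg_le_neg ht.2, neg_le_neg ht.1⟩, ?_⟩
    simp [← exp_conj]
  refine (key a b).antisymm fun w hw => ?_
  have := key (-b) (-a) (mem_image_of_mem _ hw)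
  rw [neg_neg, neg_neg] at this
  exact ⟨_, this, conj_conj w⟩

/-- The endpoints of a circular arc are determined up to a common multiple of `2π`. -/
theorem circularArc_inj {ρ a b a' b' : ℝ} (hρ : 0 < ρ) (hab : a < b)
    (hab2 : b < a + 2 * Real.pi) (hab' : a' < b') (hab2' : b' < a' + 2 * Real.pi)
    (h : circularArc ρ a b = circularArc ρ a' b') :
    ∃ n : ℤ, a' = a + n * (2 * Real.pi) ∧ b' = b + n * (2 * Real.pi) := by
  have hπ := Real.pi_pos
  obtain ⟨n, hn⟩ := exists_int_of_circularArc_eq hρ hab hab2 h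
  -- Conjugation swaps the two ends, so the statement about initial points also covers final points.
  obtain ⟨m, hm⟩ := exists_int_of_circularArc_eq (a := -b) (b := -a) (a' := -b') (b' := -a') hρ
    (by linarith) (by linarith) (by rw [← circularArc_conj, ← circularArc_conj, h])
  have h1 : ((n + m : ℤ) : ℝ) * (2 * Real.pi) = (b - a) - (b' - a') := by
    push_cast
    linarith
  have h2 : n + m = 0 := by
    by_contra hne
    rcases lt_or_gt_of_ne hne with c | c
    · have : ((n + m : ℤ) : ℝ) ≤ -1 := by exact_mod_cast (by omega : n + m ≤ -1)
      nlinarith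
    · have : (1 : ℝ) ≤ ((n + m : ℤ) : ℝ) := by exact_mod_cast c
      nlinarith
  refine ⟨n, hn.symm, ?_⟩
  rw [h2] at h1
  simp at h1
  linarith

theorem circularArc_radius {ρ a b ρ' a' b' : ℝ} (hρ : 0 < ρ) (hρ' : 0 < ρ') (hab : a < b)
    (h : circularArc ρ a b = circularArc ρ' a' b') : ρ = ρ' := by
  have h1 : (ρ : ℂ) * exp (a * I) ∈ circularArc ρ a b := ⟨a, ⟨le_rfl, hab.le⟩, rfl⟩
  rw [← norm_of_mem_circularArc hρ h1, norm_of_mem_circularArc hρ' (h ▸ h1)]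

/-! ### The slit of the explicit map is a symmetric arc, and the map is canonical. -/

namespace CanonParams

variable {q x : ℝ} (h : CanonParams q x) {r : ℝ} (hr : 0 < r) (hrq : r ^ 2 = q)

include h hr hrq

omit h hrq in
theorem norm_mul_exp_I (θ : ℝ) : ‖(r : ℂ) * exp (θ * I)‖ = r := by
  rw [norm_mul, norm_exp_ofReal_mul_I, Complex.norm_real, Real.norm_eq_abs, abs_of_pos hr, mul_one]

theorem inner_mem (θ : ℝ) : (r : ℂ) * exp (θ * I) ∈ annulus (q / x) x :=
  h.mem_of_norm_sq (by rw [norm_mul_exp_I hr, hrq])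

theorem inner_ne (θ : ℝ) : (r : ℂ) * exp (θ * I) ≠ x := by
  intro e
  have := congrArg norm e
  rw [norm_mul_exp_I hr, Complex.norm_real, Real.norm_eq_abs, abs_of_pos h.x_pos] at this
  exact (h.r_lt_x hrq).ne this

/-- On the upper inner semicircle the map is `x e^{iψ(θ)}`, with `ψ = π` at both ends and `0 < ψ <
π` between. The minimum `m` of `ψ` is interior, the values fill `[m, π]`, and conjugation supplies
the rest. Since `ψ' = L` on the circle, the minimum is a zero of `canonLogDer`; this
characterisation later gives smoothness. -/
theorem exists_slit_canonMap :
    ∃ θ ∈ Ioo 0 Real.pi, ∃ m ∈ Ioo 0 Real.pi,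
      canonMap q x (r * exp (θ * I)) = x * exp (m * I) ∧
      canonLogDer q x (r * exp (θ * I)) = 0 ∧
      slit r (canonMap q x) = circularArc x m (2 * Real.pi - m) := by
  have hπ := Real.pi_pos
  set p : ℝ → ℂ := fun θ => r * exp (θ * I) with hp
  have hpn : ∀ θ, ‖p θ‖ = r := norm_mul_exp_I hr
  have hpm : ∀ θ, p θ ∈ annulus (q / x) (1 / x) := fun θ => h.inner_subset (h.inner_mem hr hrq θ)
  have hpi : ∀ θ, (p θ).im = r * Real.sin θ := fun θ => by
    simp only [hp, im_ofReal_mul, exp_ofReal_mul_I_im]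
  have hpos : ∀ θ ∈ Ioo 0 Real.pi, 0 < (canonMap q x (p θ)).im := fun θ hθ =>
    h.canonMap_im_pos (hpm θ) (by
      rw [hpi]
      exact mul_pos hr (Real.sin_pos_of_pos_of_lt_pi hθ.1 hθ.2))
  have hends : ∀ θ, Real.sin θ = 0 → canonMap q x (p θ) = -x := fun θ hθ =>
    h.canonMap_eq_neg_of_im hrq (hpn θ) (by rw [hpi, hθ, mul_zero])
  have hcases : ∀ θ ∈ Icc 0 Real.pi, θ ∈ Ioo 0 Real.pi ∨ Real.sin θ = 0 := by
    intro θ hθ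
    rcases eq_or_lt_of_le hθ.1 with c | c
    · exact Or.inr (by rw [← c, Real.sin_zero])
    rcases eq_or_lt_of_le hθ.2 with d | d
    · exact Or.inr (by rw [d, Real.sin_pi])
    · exact Or.inl ⟨c, d⟩
  -- Multiplication by `-I` sends the upper half-plane to the right half-plane and `-x` to `xI`, so
  -- one branch of the logarithm is continuous up to both ends.
  have hslit : ∀ θ ∈ Icc 0 Real.pi, -I * canonMap q x (p θ) ∈ slitPlane := by
    intro θ hθ
    rcases hcases θ hθ with c | c
    · left
      simpa using hpos θ c
    · right
      rw [hends θ c]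
      simp [h.x_pos.ne']
  set ψ : ℝ → ℝ := fun θ => (log (-I * canonMap q x (p θ))).im + Real.pi / 2 with hψ
  have hpd : ∀ θ, p θ = exp (Real.log r + θ * I) := fun θ => by
    rw [exp_add, ← ofReal_exp, Real.exp_log hr]
  have hderiv : ∀ θ ∈ Icc 0 Real.pi, HasDerivAt ψ (canonLogDer q x (p θ)).re θ := by
    intro θ hθ
    have h1 : HasDerivAt (fun w => log (-I * canonMap q x (exp w)))
        (canonLogDer q x (exp (Real.log r + θ * I))) (Real.log r + θ * I) :=
      h.hasDerivAt_log_canonMap_exp (-I) (neg_ne_zero.2 I_ne_zero) (by rw [← hpd]; exact hpm θ)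
        (by rw [← hpd]; exact h.inner_ne hr hrq θ) (by rw [← hpd]; exact hslit θ hθ)
    have h2 : HasDerivAt (fun t : ℝ => (Real.log r : ℂ) + t * I) I θ := by
      simpa using ((hasDerivAt_id θ).ofReal_comp.mul_const I).const_add (Real.log r : ℂ)
    have h3 := (imCLM.hasFDerivAt.comp_hasDerivAt θ (h1.comp θ h2)).add_const (Real.pi / 2)
    rw [← hpd] at h3
    refine (h3.congr_of_eventuallyEq (Eventually.of_forall fun t => ?_)).congr_deriv (by simp)
    simp only [hψ, Function.comp, ← hpd, imCLM_apply]
  have hcont : ContinuousOn ψ (Icc 0 Real.pi) :=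
    fun θ hθ => (hderiv θ hθ).continuousAt.continuousWithinAt
  have hexp : ∀ θ ∈ Icc 0 Real.pi, canonMap q x (p θ) = x * exp (ψ θ * I) := by
    intro θ hθ
    have h1 := norm_mul_exp_arg_mul_I (-I * canonMap q x (p θ))
    have h2 : ‖-I * canonMap q x (p θ)‖ = x := by
      rw [norm_mul, h.norm_canonMap_of_norm_sq (by rw [hpn, hrq])]
      simp
    rw [h2] at h1
    simp only [hψ, log_im]
    have h3 : (((arg (-I * canonMap q x (p θ)) + Real.pi / 2 : ℝ) : ℂ)) * I =
        arg (-I * canonMap q x (p θ)) * I + Real.pi / 2 * I := by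
      push_cast
      ring
    rw [h3, exp_add, exp_pi_div_two_mul_I, ← mul_assoc, h1]
    linear_combination (canonMap q x (p θ)) * I_sq
  have hψend : ∀ θ, Real.sin θ = 0 → ψ θ = Real.pi := by
    intro θ hθ
    have : -I * canonMap q x (p θ) = x * I := by
      rw [hends θ hθ]
      ring
    simp only [hψ, log_im, this, arg_real_mul I h.x_pos, arg_I]
    ring
  have hψint : ∀ θ ∈ Ioo 0 Real.pi, ψ θ ∈ Ioo 0 Real.pi := by
    intro θ hθ
    have h1 : 0 < (-I * canonMap q x (p θ)).re := by simpa using hpos θ hθ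
    have h2 := abs_lt.1 (abs_arg_lt_pi_div_two_iff.2 (Or.inl h1))
    simp only [hψ, log_im]
    exact ⟨by linarith, by linarith⟩
  obtain ⟨θ₀, hθ₀, hmin⟩ := isCompact_Icc.exists_isMinOn (nonempty_Icc.2 hπ.le) hcont
  have hhalf : Real.pi / 2 ∈ Ioo 0 Real.pi := ⟨by linarith, by linarith⟩
  have hlt : ψ θ₀ < Real.pi :=
    (hmin (Ioo_subset_Icc_self hhalf)).trans_lt (hψint _ hhalf).2
  have hθ₀' : θ₀ ∈ Ioo 0 Real.pi := by
    rcases hcases θ₀ hθ₀ with c | c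
    · exact c
    · exact absurd (hψend θ₀ c) hlt.ne
  have himg : ∀ t ∈ Icc (ψ θ₀) Real.pi, ∃ θ ∈ Icc 0 Real.pi, ψ θ = t := by
    intro t ht
    have := isPreconnected_Icc.intermediate_value hθ₀ (right_mem_Icc.2 hπ.le) hcont
    rw [hψend _ Real.sin_pi] at this
    exact this ht
  have hcrit : (canonLogDer q x (p θ₀)).re = 0 :=
    (hmin.isLocalMin (Icc_mem_nhds hθ₀'.1 hθ₀'.2)).hasDerivAt_eq_zero (hderiv θ₀ hθ₀)
  refine ⟨θ₀, hθ₀', ψ θ₀, hψint θ₀ hθ₀', hexp θ₀ hθ₀, ?_, ?_⟩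
  · refine Complex.ext hcrit ?_
    exact h.canonLogDer_im_of_norm_sq (by rw [norm_mul_exp_I hr, hrq])
  rw [h.slit_canonMap_eq_image hr hrq]
  have hψle : ∀ θ ∈ Icc 0 Real.pi, ψ θ ≤ Real.pi := by
    intro θ hθ
    rcases hcases θ hθ with c | c
    · exact (hψint θ c).2.le
    · exact (hψend θ c).le
  have hflip : ∀ t : ℝ, starRingEnd ℂ ((x : ℂ) * exp (t * I)) =
      x * exp ((2 * Real.pi - t : ℝ) * I) := by
    intro t
    rw [map_mul, conj_ofReal, ← exp_conj, map_mul, conj_ofReal, conj_I]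
    congr 1
    rw [exp_eq_exp_iff_exists_int]
    refine ⟨-1, ?_⟩
    push_cast
    ring
  have hup : ∀ z : ℂ, ‖z‖ = r → 0 ≤ z.im → ∃ θ ∈ Icc 0 Real.pi, z = p θ := by
    intro z hz hi
    refine ⟨arg z, ⟨arg_nonneg_iff.2 hi, arg_le_pi z⟩, ?_⟩
    rw [hp, ← hz]
    exact (norm_mul_exp_arg_mul_I z).symm
  ext w
  constructor
  · rintro ⟨z, hz, rfl⟩
    rw [mem_sphere_zero_iff_norm] at hz
    rcases le_total 0 z.im with c | c
    · obtain ⟨θ, hθ, rfl⟩ := hup z hz c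
      rw [hexp θ hθ]
      exact ⟨ψ θ, ⟨hmin hθ, by linarith [hψle θ hθ]⟩, rfl⟩
    · obtain ⟨θ, hθ, e⟩ := hup (starRingEnd ℂ z) (by simpa using hz) (by simpa using c)
      have e2 : canonMap q x z = starRingEnd ℂ (canonMap q x (p θ)) := by
        rw [← e, canonMap_conj, conj_conj]
      rw [e2, hexp θ hθ, hflip]
      have : ψ θ₀ ≤ ψ θ := hmin hθ
      exact ⟨2 * Real.pi - ψ θ, ⟨by linarith [hψle θ hθ], by linarith⟩, rfl⟩
  · rintro ⟨t, ht, rfl⟩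
    rcases le_total t Real.pi with c | c
    · obtain ⟨θ, hθ, e⟩ := himg t ⟨ht.1, c⟩
      refine ⟨p θ, by simpa using hpn θ, ?_⟩
      rw [hexp θ hθ, e]
    · obtain ⟨θ, hθ, e⟩ := himg (2 * Real.pi - t) ⟨by linarith [ht.2], by linarith⟩
      refine ⟨starRingEnd ℂ (p θ), by simpa using hpn θ, ?_⟩
      rw [canonMap_conj, hexp θ hθ, e, hflip]
      norm_num

theorem slit_canonMap_inter_real :
    slit r (canonMap q x) ∩ {w : ℂ | w.im = 0} = {(-x : ℂ)} := by
  rw [h.slit_canonMap_eq_image hr hrq]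
  ext w
  constructor
  · rintro ⟨⟨z, hz, rfl⟩, hi⟩
    rw [mem_sphere_zero_iff_norm] at hz
    have hzm := h.inner_subset (h.mem_of_norm_sq (z := z) (by rw [hz, hrq]))
    exact h.canonMap_eq_neg_of_im hrq hz (h.im_eq_zero_of_canonMap hzm hi)
  · rintro rfl
    refine ⟨⟨r, by simp [abs_of_pos hr], h.canonMap_of_real hrq (abs_of_pos hr)⟩, ?_⟩
    simp

theorem isCanonicalMap_canonMap : IsCanonicalMap r x (canonMap q x) where
  holo := h.differentiableOn_canonMap.mono (h.annulus_subset hr hrq)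
  inj := h.injOn_canonMap hr hrq
  mapsTo := fun z hz => by simpa using h.norm_canonMap_lt hr hrq hz
  map_zero := canonMap_eq_zero_iff.2 rfl
  circle_to_circle := by
    intro ζ hζ w hw
    have hn : ‖ζ‖ = 1 := by simpa using hζ
    have hc : ContinuousAt (canonMap q x) ζ := (h.differentiableOn_canonMap.differentiableAt
      ((isOpen_annulus _ _).mem_nhds (h.outer_subset (h.mem_of_norm_one hn)))).continuousAt
    have h1 : ClusterPt w (𝓝 (canonMap q x ζ)) :=
      hw.clusterPt.mono (hc.tendsto.mono_left nhdsWithin_le_nhds)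
    rw [eq_of_nhds_neBot h1]
    simpa using h.norm_canonMap_of_norm_one hn
  arc := by
    obtain ⟨θ, -, m, hm, -, -, e⟩ := h.exists_slit_canonMap hr hrq
    exact ⟨x, m, 2 * Real.pi - m, h.x_pos, by linarith [hm.2], by linarith [hm.1], e⟩
  symm := by
    rw [h.slit_canonMap_eq_image hr hrq]
    rintro _ ⟨z, hz, rfl⟩
    exact ⟨starRingEnd ℂ z, by simpa using hz, canonMap_conj z⟩
  meets := by
    refine ⟨-x, by linarith [h.x_lt_one], by linarith [h.x_pos], ?_⟩
    have : (-x : ℂ) ∈ slit r (canonMap q x) ∩ {w : ℂ | w.im = 0} := by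
      rw [h.slit_canonMap_inter_real hr hrq]
      exact mem_singleton _
    simpa using this.1

end CanonParams

/-! ### Arbitrary canonical maps and their boundary behaviour. -/

theorem deriv_ne_zero_of_injOn_nhds {f : ℂ → ℂ} {x : ℂ} {s : Set ℂ} (hf : AnalyticAt ℂ f x)
    (hs : s ∈ 𝓝 x) (hinj : InjOn f s) : deriv f x ≠ 0 := by
  have hg : AnalyticAt ℂ (fun z => f z - f x) x := hf.sub analyticAt_const
  have hne : ¬ ∀ᶠ z in 𝓝 x, f z - f x = 0 := by
    intro hev
    have h1 : ∀ᶠ z in 𝓝[≠] x, z = x := by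
      filter_upwards [(hev.and hs).filter_mono nhdsWithin_le_nhds] with z hz
      exact hinj hz.2 (mem_of_mem_nhds hs) (sub_eq_zero.1 hz.1)
    obtain ⟨z, hz1, hz2⟩ := (h1.and self_mem_nhdsWithin).exists
    exact hz2 hz1
  obtain ⟨n, k, hk, hk0, hev⟩ := hg.exists_eventuallyEq_pow_smul_nonzero_iff.2 hne
  simp only [smul_eq_mul] at hev
  have hn0 : n ≠ 0 := by
    rintro rfl
    have := hev.self_of_nhds
    simp at this
    exact hk0 this.symm
  obtain ⟨c, hc⟩ := IsAlgClosed.exists_pow_nat_eq (k x) (Nat.pos_of_ne_zero hn0)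
  have hc0 : c ≠ 0 := by
    rintro rfl
    rw [zero_pow hn0] at hc
    exact hk0 hc.symm
  -- A holomorphic `n`-th root of `k` near `x`, so that `f - f x` is the `n`-th power of the local
  -- coordinate `(z - x) κ z`.
  set κ : ℂ → ℂ := fun z => c * exp (log (k z / k x) / n) with hκ
  have hκa : AnalyticAt ℂ κ x := by
    refine analyticAt_const.mul (AnalyticAt.cexp ?_)
    refine AnalyticAt.div (AnalyticAt.clog (hk.div analyticAt_const hk0) ?_) analyticAt_const ?_
    · rw [div_self hk0]
      exact one_mem_slitPlane
    · exact_mod_cast hn0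
  have hκx : κ x = c := by simp [hκ, div_self hk0]
  have hκn : ∀ᶠ z in 𝓝 x, κ z ^ n = k z := by
    filter_upwards [hk.continuousAt.eventually_ne hk0] with z hz
    have hn0' : (n : ℂ) ≠ 0 := by exact_mod_cast hn0
    simp only [hκ]
    rw [mul_pow, hc, ← exp_nat_mul, mul_div_cancel₀ _ hn0', exp_log (div_ne_zero hz hk0),
      mul_div_cancel₀ _ hk0]
  have hua : AnalyticAt ℂ (fun z => (z - x) * κ z) x :=
    (analyticAt_id.sub analyticAt_const).mul hκa
  have hud : HasDerivAt (fun z => (z - x) * κ z) c x := by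
    have := ((hasDerivAt_id x).sub_const x).mul hκa.differentiableAt.hasDerivAt
    simpa [hκx] using! this
  have hus : HasStrictDerivAt (fun z => (z - x) * κ z) c x := by
    have := hua.hasStrictDerivAt
    rwa [hud.deriv] at this
  have hmap := hus.map_nhds_eq hc0
  simp only [sub_self, zero_mul] at hmap
  by_cases hn1 : n = 1
  · subst hn1
    have h1 : HasDerivAt f c x := by
      refine (hud.add_const (f x)).congr_of_eventuallyEq ?_
      filter_upwards [hev, hκn] with z h1 h2
      rw [pow_one] at h1 h2
      rw [h2, ← h1]
      ring
    rw [h1.deriv]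
    exact hc0
  exfalso
  have hN : ∀ᶠ z in 𝓝 x, z ∈ s ∧ f z - f x = ((z - x) * κ z) ^ n := by
    filter_upwards [hs, hev, hκn] with z h1 h2 h3
    exact ⟨h1, by rw [h2, mul_pow, h3]⟩
  have himg : (fun z => (z - x) * κ z) '' {z | z ∈ s ∧ f z - f x = ((z - x) * κ z) ^ n} ∈
      𝓝 (0 : ℂ) := by
    rw [← hmap]
    exact image_mem_map hN
  obtain ⟨δ, hδ, hball⟩ := Metric.mem_nhds_iff.1 himg
  -- For `n > 1` two distinct points, whose coordinates differ by a primitive `n`-th root of unity,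
  -- would have the same value under `f`.
  have hζ := isPrimitiveRoot_exp n hn0
  set ζ := exp (2 * Real.pi * I / n)
  have hζn : ‖ζ‖ = 1 := hζ.norm'_eq_one hn0
  have hv : ‖((δ / 2 : ℝ) : ℂ)‖ = δ / 2 := by
    rw [Complex.norm_real, Real.norm_eq_abs, abs_of_pos (by linarith)]
  obtain ⟨a, ⟨ha1, ha2⟩, ea⟩ := @hball ((δ / 2 : ℝ) : ℂ) (by
    rw [mem_ball_zero_iff, hv]; linarith)
  obtain ⟨b, ⟨hb1, hb2⟩, eb⟩ := @hball (ζ * ((δ / 2 : ℝ) : ℂ)) (by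
    rw [mem_ball_zero_iff, norm_mul, hv, hζn]; linarith)
  simp only at ea eb
  rw [ea] at ha2
  rw [eb, mul_pow, hζ.pow_eq_one, one_mul] at hb2
  have hab : a = b := hinj ha1 hb1 (by linear_combination ha2 - hb2)
  rw [← hab, ea] at eb
  have hv0 : ((δ / 2 : ℝ) : ℂ) ≠ 0 := by exact_mod_cast (by linarith : δ / 2 ≠ 0)
  have hζ1 : ζ = 1 := by
    have : (ζ - 1) * ((δ / 2 : ℝ) : ℂ) = 0 := by linear_combination -eb
    rcases mul_eq_zero.1 this with e | e
    · exact sub_eq_zero.1 e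
    · exact absurd e hv0
  rw [hζ1] at hζ
  exact hn1 (hζ.unique IsPrimitiveRoot.one)

/-- The filter of points of the annulus `r < |z| < 1` whose modulus tends to `s`. -/
noncomputable def circleFilter (r s : ℝ) : Filter ℂ := comap norm (𝓝 s) ⊓ 𝓟 (annulus r 1)

theorem eventually_circleFilter {r s : ℝ} {p : ℂ → Prop} :
    (∀ᶠ z in circleFilter r s, p z) ↔
      ∃ ε > 0, ∀ z ∈ annulus r 1, |‖z‖ - s| < ε → p z := by
  rw [circleFilter, eventually_inf_principal,
    ((Metric.nhds_basis_ball (x := s)).comap norm).eventually_iff]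
  constructor
  · rintro ⟨ε, hε, h⟩
    exact ⟨ε, hε, fun z hz hz2 => h hz2 hz⟩
  · rintro ⟨ε, hε, h⟩
    exact ⟨ε, hε, fun z hz hz2 => h z hz2 hz⟩

theorem circleFilter_neBot {r s : ℝ} (hr : 0 < r) (hs : s = r ∨ s = 1) (hr1 : r < 1) :
    (circleFilter r s).NeBot := by
  by_contra hbot
  rw [not_neBot] at hbot
  have : ∀ᶠ z in circleFilter r s, False := by rw [hbot]; exact eventually_bot
  obtain ⟨ε, hε, h⟩ := eventually_circleFilter.1 this
  obtain ⟨t, ht1, ht2⟩ : ∃ t, t ∈ Ioo r 1 ∧ |t - s| < ε := by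
    rcases hs with rfl | rfl
    · obtain ⟨t, h1, h2⟩ := exists_between (lt_min hr1 (by linarith : s < s + ε))
      rw [lt_min_iff] at h2
      exact ⟨t, ⟨h1, h2.1⟩, by rw [abs_of_pos] <;> linarith⟩
    · obtain ⟨t, h1, h2⟩ := exists_between (max_lt hr1 (by linarith : 1 - ε < 1))
      rw [max_lt_iff] at h1
      exact ⟨t, ⟨h1.1, h2⟩, by rw [abs_of_neg] <;> linarith⟩
  have hn : ‖(t : ℂ)‖ = t := by simp [abs_of_pos (hr.trans ht1.1)]
  exact h t (by rw [annulus]; exact ⟨by rw [hn]; exact ht1.1, by rw [hn]; exact ht1.2⟩)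
    (by rwa [hn])

theorem exists_limit_of_ultrafilter {r s : ℝ} {F : Ultrafilter ℂ} (hF : ↑F ≤ circleFilter r s) :
    ∃ b : ℂ, ‖b‖ = s ∧ (F : Filter ℂ) ≤ 𝓝[annulus r 1] b := by
  have hA : (F : Filter ℂ) ≤ 𝓟 (annulus r 1) := hF.trans inf_le_right
  have h1 : (F : Filter ℂ) ≤ 𝓟 (closedBall 0 1) := hA.trans (by
    rw [principal_mono]
    exact fun z hz => by simpa using hz.2.le)
  obtain ⟨b, -, hb⟩ := isCompact_iff_ultrafilter_le_nhds.1 (isCompact_closedBall (0 : ℂ) 1) F h1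
  refine ⟨b, ?_, le_inf hb hA⟩
  have t1 : Tendsto norm (F : Filter ℂ) (𝓝 ‖b‖) := (continuous_norm.tendsto b).mono_left hb
  have t2 : Tendsto norm (F : Filter ℂ) (𝓝 s) :=
    tendsto_comap.mono_left (hF.trans inf_le_left)
  exact tendsto_nhds_unique t1 t2

/-- Compactness of the closed disk turns control of the cluster values at each point of the circle
into control uniform along it. -/
theorem eventually_mem_of_mapClusterPt {r s : ℝ} {g : ℂ → ℂ}
    (hg : MapsTo g (annulus r 1) (ball 0 1)) {O : Set ℂ} (hO : IsOpen O)
    (hc : ∀ b : ℂ, ‖b‖ = s → ∀ w, ‖w‖ ≤ 1 → MapClusterPt w (𝓝[annulus r 1] b) g → w ∈ O) :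
    ∀ᶠ z in circleFilter r s, g z ∈ O := by
  by_contra hne
  have hfr := not_eventually.1 hne
  have : (circleFilter r s ⊓ 𝓟 {z | g z ∉ O}).NeBot := frequently_iff_neBot.1 hfr
  set F := Ultrafilter.of (circleFilter r s ⊓ 𝓟 {z | g z ∉ O})
  have hF : (F : Filter ℂ) ≤ circleFilter r s ⊓ 𝓟 {z | g z ∉ O} := Ultrafilter.of_le _
  obtain ⟨b, hb1, hb2⟩ := exists_limit_of_ultrafilter (hF.trans inf_le_left)
  have hA : ∀ᶠ z in (F : Filter ℂ), z ∈ annulus r 1 :=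
    le_principal_iff.1 ((hF.trans inf_le_left).trans inf_le_right)
  have h1 : ((F.map g : Ultrafilter ℂ) : Filter ℂ) ≤ 𝓟 (closedBall 0 1) := by
    rw [le_principal_iff]
    show ∀ᶠ z in (F : Filter ℂ), g z ∈ closedBall (0 : ℂ) 1
    filter_upwards [hA] with z hz
    exact ball_subset_closedBall (hg hz)
  obtain ⟨w, hw1, hw⟩ :=
    isCompact_iff_ultrafilter_le_nhds.1 (isCompact_closedBall (0 : ℂ) 1) _ h1
  have ht : Tendsto g (F : Filter ℂ) (𝓝 w) := hw
  have hwO : w ∈ O := hc b hb1 w (by simpa using hw1)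
    (MapClusterPt.mono (ht.mapClusterPt) hb2)
  have h2 : ∀ᶠ z in (F : Filter ℂ), g z ∈ O := ht (hO.mem_nhds hwO)
  have h3 : ∀ᶠ z in (F : Filter ℂ), g z ∉ O := le_principal_iff.1 (hF.trans inf_le_right)
  obtain ⟨z, hz1, hz2⟩ := (h2.and h3).exists
  exact hz2 hz1

namespace IsCanonicalMap

variable {r x : ℝ} {g : ℂ → ℂ} (hg : IsCanonicalMap r x g) (hr : 0 < r) (hr1 : r < 1)

include hg

/-- Conjugation symmetry puts the middle of the arc at angle `-nπ`, hence on the real axis. Since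
the arc contains an angle `π + 2πm` and has half-width less than `π`, the integer `n + 2m + 1` is
`0` and the middle is at `π`. -/
theorem exists_slit_eq : ∃ ρ β : ℝ, 0 < ρ ∧ ρ < 1 ∧ 0 < β ∧ β < Real.pi ∧
    slit r g = circularArc ρ (Real.pi - β) (Real.pi + β) := by
  have hπ := Real.pi_pos
  obtain ⟨ρ, a, b, hρ, hab, hab2, e⟩ := hg.arc
  have hconj : circularArc ρ a b = circularArc ρ (-b) (-a) := by
    rw [← circularArc_conj, ← e]
    refine Subset.antisymm (fun w hw => ⟨_, hg.symm w hw, conj_conj w⟩) ?_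
    rintro _ ⟨w, hw, rfl⟩
    exact hg.symm w hw
  obtain ⟨n, hn1, hn2⟩ := circularArc_inj hρ hab hab2 (by linarith) (by linarith) hconj
  obtain ⟨t, ht1, ht2, ht3⟩ := hg.meets
  rw [e] at ht3
  have htρ : -t = ρ := by
    have := norm_of_mem_circularArc hρ ht3
    rwa [Complex.norm_real, Real.norm_eq_abs, abs_of_neg ht2] at this
  have htπ : (t : ℂ) = ρ * exp (Real.pi * I) := by
    rw [exp_pi_mul_I, ← htρ]
    push_cast
    ring
  rw [htπ] at ht3
  obtain ⟨m, hm1, hm2⟩ := (ofReal_mul_exp_mem_circularArc_iff hρ).1 ht3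
  have hnm : n + 2 * m + 1 = 0 := by
    have h1 : ((n + 2 * m + 1 : ℤ) : ℝ) * (2 * Real.pi) < 2 * Real.pi := by
      push_cast
      nlinarith
    have h2 : -(2 * Real.pi) < ((n + 2 * m + 1 : ℤ) : ℝ) * (2 * Real.pi) := by
      push_cast
      nlinarith
    have h3 : ((n + 2 * m + 1 : ℤ) : ℝ) < 1 := by nlinarith
    have h4 : (-1 : ℝ) < ((n + 2 * m + 1 : ℤ) : ℝ) := by nlinarith
    have h3' : n + 2 * m + 1 < 1 := by exact_mod_cast h3
    have h4' : -1 < n + 2 * m + 1 := by exact_mod_cast h4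
    omega
  have hnm' : (n : ℝ) = -2 * m - 1 := by
    have : ((n + 2 * m + 1 : ℤ) : ℝ) = 0 := by exact_mod_cast hnm
    push_cast at this
    linarith
  refine ⟨ρ, (b - a) / 2, hρ, by linarith, by linarith, by linarith, ?_⟩
  rw [e]
  have ha : a = Real.pi - (b - a) / 2 + m * (2 * Real.pi) := by
    rw [hnm'] at hn1
    linarith
  have hb : b = Real.pi + (b - a) / 2 + m * (2 * Real.pi) := by
    rw [hnm'] at hn1
    linarith
  have hshift : ∀ (s : ℝ) (k : ℤ), (ρ : ℂ) * exp ((s + k * (2 * Real.pi) : ℝ) * I) =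
      ρ * exp (s * I) := by
    intro s k
    congr 1
    rw [exp_eq_exp_iff_exists_int]
    refine ⟨k, ?_⟩
    push_cast
    ring
  ext w
  constructor
  · rintro ⟨s, hs, rfl⟩
    refine ⟨s + (-m : ℤ) * (2 * Real.pi), ⟨?_, ?_⟩, hshift s (-m)⟩
    · push_cast
      linarith [hs.1]
    · push_cast
      linarith [hs.2]
  · rintro ⟨s, hs, rfl⟩
    exact ⟨s + m * (2 * Real.pi), ⟨by linarith [hs.1], by linarith [hs.2]⟩, hshift s m⟩

theorem analyticOnNhd : AnalyticOnNhd ℂ g (annulus r 1) :=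
  hg.holo.analyticOnNhd (isOpen_annulus r 1)

theorem deriv_ne_zero {z : ℂ} (hz : z ∈ annulus r 1) : deriv g z ≠ 0 :=
  deriv_ne_zero_of_injOn_nhds (hg.analyticOnNhd z hz) ((isOpen_annulus r 1).mem_nhds hz) hg.inj

theorem isOpen_image {s : Set ℂ} (hs : s ⊆ annulus r 1) (ho : IsOpen s) : IsOpen (g '' s) := by
  rw [isOpen_iff_mem_nhds]
  rintro _ ⟨z, hz, rfl⟩
  rw [← (hg.analyticOnNhd z (hs hz)).hasStrictDerivAt.map_nhds_eq (hg.deriv_ne_zero (hs hz))]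
  exact image_mem_map (ho.mem_nhds hz)

/-- If the value were taken at `a`, the open image of a neighbourhood of `a` would also be hit by
points near `b`, against injectivity. -/
theorem notMem_image_of_mapClusterPt {b w : ℂ} (hb : b ∉ annulus r 1)
    (hw : MapClusterPt w (𝓝[annulus r 1] b) g) : w ∉ g '' annulus r 1 := by
  rintro ⟨a, ha, rfl⟩
  have hne : a ≠ b := by
    rintro rfl
    exact hb ha
  obtain ⟨U, V, hU, hV, haU, hbV, hUV⟩ := t2_separation hne
  have ho := hg.isOpen_image inter_subset_left ((isOpen_annulus r 1).inter hU)
  have hfr := hw.frequently (ho.mem_nhds ⟨a, ⟨ha, haU⟩, rfl⟩)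
  have hev : ∀ᶠ z in 𝓝[annulus r 1] b, z ∈ V ∩ annulus r 1 :=
    Filter.inter_mem (mem_nhdsWithin_of_mem_nhds (hV.mem_nhds hbV)) self_mem_nhdsWithin
  obtain ⟨z, ⟨u, hu, eu⟩, hz⟩ := (hfr.and_eventually hev).exists
  have := hg.inj hu.1 hz.2 eu
  subst this
  exact hUV.le_bot ⟨hu.2, hz.1⟩

theorem mem_slit_or_of_mapClusterPt {b w : ℂ} (hb : b ∉ annulus r 1) (hw1 : ‖w‖ ≤ 1)
    (hw : MapClusterPt w (𝓝[annulus r 1] b) g) : w ∈ slit r g ∨ ‖w‖ = 1 := by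
  rcases hw1.lt_or_eq with c | c
  · exact Or.inl ⟨by simpa using c, hg.notMem_image_of_mapClusterPt hb hw⟩
  · exact Or.inr c

include hr hr1

omit hr hr1 in
theorem tendsto_norm_outer : Tendsto (fun z => ‖g z‖) (circleFilter r 1) (𝓝 1) := by
  rw [tendsto_def]
  intro s hs
  obtain ⟨O, hOs, hO, h1⟩ := _root_.mem_nhds_iff.1 hs
  have := eventually_mem_of_mapClusterPt (s := 1) hg.mapsTo (hO.preimage continuous_norm)
    (fun b hb w _ hw => by
      have h2 := hg.circle_to_circle b (by simpa using hb) w hw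
      rw [mem_sphere_zero_iff_norm] at h2
      show ‖w‖ ∈ O
      rwa [h2])
  filter_upwards [this] with z hz
  exact hOs hz

/-- Near the inner circle the values of a canonical map are close to the slit. -/
theorem eventually_mem_inner {O : Set ℂ} (hO : IsOpen O) (hsub : slit r g ⊆ O) :
    ∀ᶠ z in circleFilter r r, g z ∈ O := by
  obtain ⟨ρ, β, hρ, hρ1, -, -, e⟩ := hg.exists_slit_eq
  -- The circle `|w| = ρ₁` separates the slit from the unit circle, the two places where cluster
  -- values at the inner boundary may lie.
  obtain ⟨ρ₁, hρ₁, hρ₁'⟩ := exists_between hρ1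
  have hslit : ∀ w ∈ slit r g, ‖w‖ = ρ := fun w hw => norm_of_mem_circularArc hρ (e ▸ hw)
  have hnot : ∀ b : ℂ, ‖b‖ = r → b ∉ annulus r 1 := fun b hb hb' => hb'.1.ne' hb
  have hev : ∀ᶠ z in circleFilter r r, g z ∈ {w : ℂ | ‖w‖ < ρ₁} ∪ {w : ℂ | ρ₁ < ‖w‖} := by
    refine eventually_mem_of_mapClusterPt hg.mapsTo
      ((isOpen_lt continuous_norm continuous_const).union
        (isOpen_lt continuous_const continuous_norm)) fun b hb w hw1 hw => ?_
    rcases hg.mem_slit_or_of_mapClusterPt (hnot b hb) hw1 hw with c | c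
    · exact Or.inl (by show ‖w‖ < ρ₁; rw [hslit w c]; exact hρ₁)
    · exact Or.inr (by show ρ₁ < ‖w‖; rw [c]; exact hρ₁')
  obtain ⟨ε, hε, hev⟩ := eventually_circleFilter.1 hev
  set s := min (r + ε) 1 with hs
  have hsr : r < s := lt_min (by linarith) hr1
  have hsubA : annulus r s ⊆ annulus r 1 := annulus_mono le_rfl (min_le_right _ _)
  have hpre : IsPreconnected ((fun z => ‖g z‖) '' annulus r s) :=
    (isPreconnected_annulus hr (hr.trans hsr)).image _ (hg.holo.continuousOn.mono hsubA).norm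
  have hin : ∀ z ∈ annulus r s, |‖z‖ - r| < ε := by
    intro z hz
    have h2 := hz.2.trans_le (min_le_left _ _)
    rw [abs_of_pos (by linarith [hz.1])]
    linarith
  have hthin : ∀ᶠ z in circleFilter r r, z ∈ annulus r s := by
    refine eventually_circleFilter.2 ⟨s - r, by linarith, fun z hz h1 => ⟨hz.1, ?_⟩⟩
    rw [abs_of_pos (by linarith [hz.1])] at h1
    linarith
  -- A thin ring at the inner boundary is connected and `‖g‖` avoids `ρ₁` on it, so all its values
  -- lie on one side.
  have hdich : (∀ z ∈ annulus r s, ‖g z‖ < ρ₁) ∨ (∀ z ∈ annulus r s, ρ₁ < ‖g z‖) := by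
    have hsubs : (fun z => ‖g z‖) '' annulus r s ⊆ Iio ρ₁ ∪ Ioi ρ₁ := by
      rintro _ ⟨z, hz, rfl⟩
      exact hev z (hsubA hz) (hin z hz)
    by_contra hcon
    push Not at hcon
    obtain ⟨⟨z₁, h1, h1'⟩, ⟨z₂, h2, h2'⟩⟩ := hcon
    have h3 : ρ₁ ∈ (fun z => ‖g z‖) '' annulus r s :=
      hpre.ordConnected.out ⟨z₂, h2, rfl⟩ ⟨z₁, h1, rfl⟩ ⟨h2', h1'⟩
    rcases hsubs h3 with c | c
    · exact lt_irrefl _ (mem_Iio.1 c)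
    · exact lt_irrefl _ (mem_Ioi.1 c)
  rcases hdich with hlow | hhigh
  · have hev2 : ∀ᶠ z in circleFilter r r, g z ∈ O ∪ {w : ℂ | ρ₁ < ‖w‖} := by
      refine eventually_mem_of_mapClusterPt hg.mapsTo
        (hO.union (isOpen_lt continuous_const continuous_norm)) fun b hb w hw1 hw => ?_
      rcases hg.mem_slit_or_of_mapClusterPt (hnot b hb) hw1 hw with c | c
      · exact Or.inl (hsub c)
      · exact Or.inr (by show ρ₁ < ‖w‖; rw [c]; exact hρ₁')
    filter_upwards [hev2, hthin] with z h1 h2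
    rcases h1 with c | c
    · exact c
    · exact absurd c (not_lt.2 (hlow z h2).le)
  -- If the values stayed above `ρ₁`, no cluster value could lie on the slit. The image would then
  -- be open and closed in the disk, hence the whole disk, although the slit is nonempty.
  · exfalso
    have hball : ball (0 : ℂ) 1 ⊆ g '' annulus r 1 := by
      obtain ⟨t, ht⟩ : (annulus r 1).Nonempty := by
        obtain ⟨t, ht1, ht2⟩ := exists_between hr1
        refine ⟨t, ?_⟩
        simp only [annulus, mem_ofPred_eq, Complex.norm_real, Real.norm_eq_abs,
          abs_of_pos (hr.trans ht1)]
        exact ⟨ht1, ht2⟩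
      refine (convex_ball (0 : ℂ) 1).isPreconnected.subset_of_closure_inter_subset
        (hg.isOpen_image Subset.rfl (isOpen_annulus r 1)) ⟨g t, hg.mapsTo ht, t, ht, rfl⟩ ?_
      rintro w ⟨hw1, hw2⟩
      have hne : (comap g (𝓝 w) ⊓ 𝓟 (annulus r 1)).NeBot := by
        rw [mem_closure_iff_clusterPt] at hw1
        have : (map g (comap g (𝓝 w) ⊓ 𝓟 (annulus r 1))).NeBot := by
          rw [Filter.push_pull', map_principal]
          exact hw1
        exact this.of_map
      set F := Ultrafilter.of (comap g (𝓝 w) ⊓ 𝓟 (annulus r 1))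
      have hF : (F : Filter ℂ) ≤ comap g (𝓝 w) ⊓ 𝓟 (annulus r 1) := Ultrafilter.of_le _
      have hA : (F : Filter ℂ) ≤ 𝓟 (annulus r 1) := hF.trans inf_le_right
      have ht : Tendsto g (F : Filter ℂ) (𝓝 w) := tendsto_comap.mono_left (hF.trans inf_le_left)
      have h1 : (F : Filter ℂ) ≤ 𝓟 (closedBall 0 1) := hA.trans (by
        rw [principal_mono]
        exact fun z hz => by simpa using hz.2.le)
      obtain ⟨b, -, hb⟩ :=
        isCompact_iff_ultrafilter_le_nhds.1 (isCompact_closedBall (0 : ℂ) 1) F h1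
      have hbA : (F : Filter ℂ) ≤ 𝓝[annulus r 1] b := le_inf hb hA
      have hcl : MapClusterPt w (𝓝[annulus r 1] b) g := ht.mapClusterPt.mono hbA
      by_cases hbm : b ∈ annulus r 1
      · have hc : ContinuousAt g b := (hg.analyticOnNhd b hbm).continuousAt
        exact ⟨b, hbm, tendsto_nhds_unique (hc.tendsto.mono_left hb) ht⟩
      exfalso
      have hbf : b ∈ frontier (annulus r 1) := by
        rw [(isOpen_annulus r 1).frontier_eq]
        refine ⟨?_, hbm⟩
        rw [mem_closure_iff_nhdsWithin_neBot]
        exact neBot_of_le hbA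
      rw [mem_ball_zero_iff] at hw2
      rcases frontier_annulus_subset hbf with c | c
      · rcases hg.mem_slit_or_of_mapClusterPt hbm hw2.le hcl with d | d
        · have hev3 : ∀ᶠ z in (F : Filter ℂ), ρ₁ < ‖g z‖ := by
            have hopen : {z : ℂ | ‖z‖ < s} ∈ 𝓝 b :=
              (isOpen_lt continuous_norm continuous_const).mem_nhds (by
                show ‖b‖ < s
                rw [c]
                exact hsr)
            filter_upwards [hb hopen, le_principal_iff.1 hA] with z h2 h3
            exact hhigh z ⟨h3.1, h2⟩
          have := ge_of_tendsto ht.norm (hev3.mono fun z hz => hz.le)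
          rw [hslit w d] at this
          linarith
        · exact hw2.ne d
      · have := hg.circle_to_circle b (by simpa using c) w hcl
        exact hw2.ne (by simpa using this)
    obtain ⟨t, -, -, ht⟩ := hg.meets
    exact ht.2 (hball ht.1)

end IsCanonicalMap

/-! ### Rigidity on the annulus and uniqueness of the canonical map. -/

/-- A holomorphic function without zeros on an open convex set has a holomorphic logarithm. -/
theorem exists_exp_eq_of_convex {f : ℂ → ℂ} {s : Set ℂ} (hs : Convex ℝ s) (ho : IsOpen s)
    (hf : DifferentiableOn ℂ f s) (hf0 : ∀ w ∈ s, f w ≠ 0) :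
    ∃ K : ℂ → ℂ, DifferentiableOn ℂ K s ∧ ∀ w ∈ s, exp (K w) = f w := by
  rcases s.eq_empty_or_nonempty with rfl | ⟨a, ha⟩
  · exact ⟨0, by simp, by simp⟩
  obtain ⟨K, hK⟩ := hs.exists_forall_hasDerivWithinAt
    ((hf.deriv ho).div hf hf0)
  have hK' : ∀ w ∈ s, HasDerivAt K (deriv f w / f w) w := fun w hw =>
    (hK w hw).hasDerivAt (ho.mem_nhds hw)
  have hder : ∀ w ∈ s, HasDerivAt (fun w => exp (-K w) * f w) 0 w := by
    intro w hw
    have h1 := (hK' w hw).neg.cexp.mul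
      (hf.differentiableAt (ho.mem_nhds hw)).hasDerivAt
    refine h1.congr_deriv ?_
    have := hf0 w hw
    simp only [Pi.neg_apply]
    field_simp
    ring
  have hconst : ∀ w ∈ s, exp (-K w) * f w = exp (-K a) * f a := by
    intro w hw
    refine ho.is_const_of_deriv_eq_zero hs.isPreconnected
      (fun u hu => (hder u hu).differentiableAt.differentiableWithinAt)
      (fun u hu => (hder u hu).deriv) hw ha
  refine ⟨fun w => K w + log (exp (-K a) * f a), ?_, fun w hw => ?_⟩
  · exact fun w hw => ((hK' w hw).differentiableAt.add_const _).differentiableWithinAt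
  · rw [exp_add, exp_log (mul_ne_zero (exp_ne_zero _) (hf0 a ha)), ← hconst w hw, ← mul_assoc,
      ← exp_add]
    simp

section

variable {r : ℝ} (hr : 0 < r) (hr1 : r < 1)

include hr

theorem exp_mem_annulus_iff {w : ℂ} :
    exp w ∈ annulus r 1 ↔ Real.log r < w.re ∧ w.re < Real.log 1 := by
  rw [annulus]
  show r < ‖exp w‖ ∧ ‖exp w‖ < 1 ↔ _
  rw [norm_exp, Real.log_lt_iff_lt_exp hr, Real.lt_log_iff_exp_lt one_pos]

include hr1

/-- A maximum principle for multivalued functions: only the modulus need be single-valued. -/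
theorem norm_exp_le_one_of_tendsto {Φ : ℂ → ℂ} {N : ℂ → ℝ}
    (hΦ : DifferentiableOn ℂ Φ {w | Real.log r < w.re ∧ w.re < Real.log 1})
    (hN : ContinuousOn N (annulus r 1)) (hΦN : ∀ w, exp w ∈ annulus r 1 → ‖Φ w‖ = N (exp w))
    (hin : Tendsto N (circleFilter r r) (𝓝 1)) (hout : Tendsto N (circleFilter r 1) (𝓝 1)) :
    ∀ z ∈ annulus r 1, N z ≤ 1 := by
  intro z₀ hz₀
  by_contra! hgt
  obtain ⟨ε₁, hε₁, h1⟩ := eventually_circleFilter.1 (hin.eventually_lt_const hgt)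
  obtain ⟨ε₂, hε₂, h2⟩ := eventually_circleFilter.1 (hout.eventually_lt_const hgt)
  set Q : Set ℂ := {z | r + ε₁ ≤ ‖z‖ ∧ ‖z‖ ≤ 1 - ε₂} with hQ
  have hQc : IsCompact Q := by
    refine Metric.isCompact_of_isClosed_isBounded
      ((isClosed_le continuous_const continuous_norm).inter
        (isClosed_le continuous_norm continuous_const)) ?_
    exact (isBounded_closedBall (x := (0 : ℂ)) (r := 1 - ε₂)).subset
      fun z hz => by simpa using hz.2
  have hQA : Q ⊆ annulus r 1 := fun z hz => ⟨by linarith [hz.1], by linarith [hz.2]⟩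
  have hnQ : ∀ z ∈ annulus r 1, z ∉ Q → N z < N z₀ := by
    intro z hz hzQ
    rcases lt_or_ge ‖z‖ (r + ε₁) with c | c
    · refine h1 z hz ?_
      rw [abs_of_pos (by linarith [hz.1])]
      linarith
    · rcases lt_or_ge (1 - ε₂) ‖z‖ with d | d
      · refine h2 z hz ?_
        rw [abs_of_neg (by linarith [hz.2])]
        linarith
      · exact absurd ⟨c, d⟩ hzQ
  have hz₀Q : z₀ ∈ Q := by
    by_contra hcon
    exact lt_irrefl _ (hnQ z₀ hz₀ hcon)
  obtain ⟨z₁, hz₁, hmax⟩ := hQc.exists_isMaxOn ⟨z₀, hz₀Q⟩ (hN.mono hQA)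
  have hmax' : ∀ z ∈ annulus r 1, N z ≤ N z₁ := by
    intro z hz
    by_cases hzQ : z ∈ Q
    · exact hmax hzQ
    · exact (hnQ z hz hzQ).le.trans (hmax hz₀Q)
  have hz₁0 : z₁ ≠ 0 := norm_pos_iff.1 (hr.trans (hQA hz₁).1)
  have hw₁ : log z₁ ∈ {w : ℂ | Real.log r < w.re ∧ w.re < Real.log 1} := by
    refine (exp_mem_annulus_iff hr).1 ?_
    rw [exp_log hz₁0]
    exact hQA hz₁
  have hS : IsOpen {w : ℂ | Real.log r < w.re ∧ w.re < Real.log 1} :=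
    (isOpen_lt continuous_const continuous_re).inter (isOpen_lt continuous_re continuous_const)
  -- An interior maximum makes `N` constant, with a value greater than `1`; this contradicts its
  -- limit `1` at the outer circle.
  have heq := norm_eqOn_of_isPreconnected_of_isMaxOn (convex_strip _ _).isPreconnected hS hΦ hw₁
    (fun w hw => by
      have hw' := (exp_mem_annulus_iff hr).2 hw
      show ‖Φ w‖ ≤ ‖Φ (log z₁)‖
      rw [hΦN w hw', hΦN _ ((exp_mem_annulus_iff hr).2 hw₁), exp_log hz₁0]
      exact hmax' _ hw')
  have hconst : ∀ z ∈ annulus r 1, N z = N z₁ := by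
    intro z hz
    have hz0 : z ≠ 0 := norm_pos_iff.1 (hr.trans hz.1)
    have hm : exp (log z) ∈ annulus r 1 := by rwa [exp_log hz0]
    have := heq ((exp_mem_annulus_iff hr).1 hm)
    simp only [Function.comp, Function.const] at this
    rw [hΦN _ hm, hΦN _ ((exp_mem_annulus_iff hr).2 hw₁), exp_log hz0, exp_log hz₁0] at this
    exact this
  have := circleFilter_neBot hr (Or.inr rfl : (1 : ℝ) = r ∨ (1 : ℝ) = 1) hr1
  have ht : Tendsto N (circleFilter r 1) (𝓝 (N z₁)) := by
    refine tendsto_const_nhds.congr' ?_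
    have : ∀ᶠ z in circleFilter r 1, z ∈ annulus r 1 := le_principal_iff.1 inf_le_right
    filter_upwards [this] with z hz
    exact (hconst z hz).symm
  have h3 := tendsto_nhds_unique ht hout
  have h4 := hmax' z₀ hz₀
  linarith

/-- A zero-free holomorphic function on an annulus whose modulus is asymptotically constant on both
boundary circles, and which has a logarithm near the inner one, is constant. -/
theorem exists_eq_const_of_tendsto_norm {f H : ℂ → ℂ} {c s : ℝ} (hc : 0 < c) (hs : r < s)
    (hf : DifferentiableOn ℂ f (annulus r 1)) (hf0 : ∀ z ∈ annulus r 1, f z ≠ 0)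
    (hin : Tendsto (fun z => ‖f z‖) (circleFilter r r) (𝓝 c))
    (hout : Tendsto (fun z => ‖f z‖) (circleFilter r 1) (𝓝 1))
    (hH : DifferentiableOn ℂ H (annulus r s ∩ annulus r 1))
    (hHf : ∀ z ∈ annulus r s ∩ annulus r 1, exp (H z) = f z) :
    ∃ u : ℂ, ‖u‖ = 1 ∧ ∀ z ∈ annulus r 1, f z = u := by
  set S : Set ℂ := {w | Real.log r < w.re ∧ w.re < Real.log 1} with hSdef
  have hSo : IsOpen S :=
    (isOpen_lt continuous_const continuous_re).inter (isOpen_lt continuous_re continuous_const)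
  have hSc : Convex ℝ S := convex_strip _ _
  have hSA : ∀ w ∈ S, exp w ∈ annulus r 1 := fun w hw => (exp_mem_annulus_iff hr).2 hw
  obtain ⟨K, hKd, hK⟩ := exists_exp_eq_of_convex hSc hSo
    (hf.comp differentiable_exp.differentiableOn hSA) (fun w hw => hf0 _ (hSA w hw))
  have hlogr : Real.log r < 0 := Real.log_neg hr hr1
  -- The exponent is chosen so that `|z|^κ` has the same limits as `‖f‖`: `r^κ = c` and `1^κ = 1`.
  -- The multivalued `f / z^κ` and its inverse then have modulus at most `1`.
  set κ : ℝ := Real.log c / Real.log r with hκ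
  have hrκ : r ^ κ = c := by
    rw [Real.rpow_def_of_pos hr, hκ, mul_div_cancel₀ _ hlogr.ne, Real.exp_log hc]
  have hnorm : ∀ s : ℝ, s = r ∨ s = 1 → Tendsto (fun z : ℂ => ‖z‖ ^ κ) (circleFilter r s)
      (𝓝 (s ^ κ)) := by
    intro s hs
    have hs0 : s ≠ 0 := by
      rcases hs with rfl | rfl
      · exact hr.ne'
      · exact one_ne_zero
    exact ((Real.continuousAt_rpow_const s κ (Or.inl hs0)).tendsto).comp
      (tendsto_comap.mono_left inf_le_left)
  have hnorm0 : ∀ z ∈ annulus r 1, 0 < ‖z‖ := fun z hz => hr.trans hz.1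
  have hcontn : ContinuousOn (fun z : ℂ => ‖z‖ ^ κ) (annulus r 1) := fun z hz =>
    ((Real.continuousAt_rpow_const _ κ (Or.inl (hnorm0 z hz).ne')).comp
      continuous_norm.continuousAt).continuousWithinAt
  have hexpκ : ∀ w : ℂ, ‖exp (κ * w)‖ = ‖exp w‖ ^ κ := by
    intro w
    rw [norm_exp, norm_exp, ← Real.exp_mul]
    simp [mul_comm]
  have hle1 : ∀ z ∈ annulus r 1, ‖f z‖ / ‖z‖ ^ κ ≤ 1 := by
    refine norm_exp_le_one_of_tendsto hr hr1 (Φ := fun w => exp (K w - κ * w)) ?_ ?_ ?_ ?_ ?_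
    · exact (hKd.sub (differentiableOn_id.const_mul _)).cexp
    · exact hf.continuousOn.norm.div hcontn fun z hz => (Real.rpow_pos_of_pos (hnorm0 z hz) κ).ne'
    · intro w hw
      rw [exp_sub, norm_div, hexpκ, hK w ((exp_mem_annulus_iff hr).1 hw)]
      rfl
    · have := hin.div (hnorm r (Or.inl rfl)) (by rw [hrκ]; exact hc.ne')
      rwa [hrκ, div_self hc.ne'] at this
    · have := hout.div (hnorm 1 (Or.inr rfl)) (by simp)
      rwa [Real.one_rpow, div_one] at this
  have hle2 : ∀ z ∈ annulus r 1, ‖z‖ ^ κ / ‖f z‖ ≤ 1 := by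
    refine norm_exp_le_one_of_tendsto hr hr1 (Φ := fun w => exp (κ * w - K w)) ?_ ?_ ?_ ?_ ?_
    · exact ((differentiableOn_id.const_mul _).sub hKd).cexp
    · exact hcontn.div hf.continuousOn.norm fun z hz => (norm_pos_iff.2 (hf0 z hz)).ne'
    · intro w hw
      rw [exp_sub, norm_div, hexpκ, hK w ((exp_mem_annulus_iff hr).1 hw)]
      rfl
    · have := (hnorm r (Or.inl rfl)).div hin hc.ne'
      rwa [hrκ, div_self hc.ne'] at this
    · have := (hnorm 1 (Or.inr rfl)).div hout one_ne_zero
      rwa [Real.one_rpow, div_one] at this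
  have hone : ∀ w ∈ S, ‖exp (K w - κ * w)‖ = 1 := by
    intro w hw
    have hz := hSA w hw
    have p1 := Real.rpow_pos_of_pos (hnorm0 _ hz) κ
    have p2 := norm_pos_iff.2 (hf0 _ hz)
    have l1 := (div_le_one p1).1 (hle1 _ hz)
    have l2 := (div_le_one p2).1 (hle2 _ hz)
    rw [exp_sub, norm_div, hexpκ, hK w hw]
    show ‖f (exp w)‖ / ‖exp w‖ ^ κ = 1
    rw [le_antisymm l1 l2, div_self p1.ne']
  obtain ⟨w₀, hw₀⟩ : ∃ w₀ : ℂ, w₀ ∈ S := by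
    refine ⟨((Real.log r / 2 : ℝ) : ℂ), ?_, ?_⟩
    · rw [ofReal_re]
      linarith
    · rw [ofReal_re, Real.log_one]
      linarith
  set u := exp (K w₀ - κ * w₀) with hu
  have hconst : ∀ w ∈ S, exp (K w - κ * w) = u := by
    intro w hw
    exact eqOn_of_isPreconnected_of_isMaxOn_norm hSc.isPreconnected hSo
      ((hKd.sub (differentiableOn_id.const_mul (κ : ℂ))).cexp) hw₀
      (fun v hv => by
        show ‖exp (K v - κ * v)‖ ≤ ‖exp (K w₀ - κ * w₀)‖
        rw [hone v hv, hone w₀ hw₀]) hw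
  have hu0 : u ≠ 0 := exp_ne_zero _
  have hfu : ∀ w ∈ S, f (exp w) = u * exp (κ * w) := by
    intro w hw
    rw [← hconst w hw, ← exp_add, sub_add_cancel, hK w hw]
    rfl
  set s' := min s 1 with hs'
  have hs'r : r < s' := lt_min hs hr1
  have hs'0 : 0 < s' := hr.trans hs'r
  set S' : Set ℂ := {w | Real.log r < w.re ∧ w.re < Real.log s'} with hS'
  have hS'o : IsOpen S' :=
    (isOpen_lt continuous_const continuous_re).inter (isOpen_lt continuous_re continuous_const)
  have hS'c : Convex ℝ S' := convex_strip _ _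
  have hS'm : ∀ w ∈ S', exp w ∈ annulus r s ∩ annulus r 1 := by
    intro w hw
    have : exp w ∈ annulus r s' := by
      rw [annulus_eq_exp_image hr hs'0]
      exact mem_image_of_mem _ hw
    exact ⟨annulus_mono le_rfl (min_le_left _ _) this, annulus_mono le_rfl (min_le_right _ _) this⟩
  have hS'S : ∀ w ∈ S', w ∈ S := fun w hw => (exp_mem_annulus_iff hr).1 (hS'm w hw).2
  have hHo : IsOpen (annulus r s ∩ annulus r 1) := (isOpen_annulus r s).inter (isOpen_annulus r 1)
  have hDd : DifferentiableOn ℂ (fun w => H (exp w) - κ * w) S' :=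
    (hH.comp differentiable_exp.differentiableOn hS'm).sub (differentiableOn_id.const_mul _)
  have hDe : ∀ w ∈ S', exp (H (exp w) - κ * w) = u := by
    intro w hw
    rw [exp_sub, hHf _ (hS'm w hw), hfu w (hS'S w hw), mul_div_assoc, div_self (exp_ne_zero _),
      mul_one]
  have hD0 : ∀ w ∈ S', deriv (fun w => H (exp w) - κ * w) w = 0 := by
    intro w hw
    have h1 := (hDd.differentiableAt (hS'o.mem_nhds hw)).hasDerivAt.cexp
    have h2 : (fun w => exp (H (exp w) - κ * w)) =ᶠ[𝓝 w] fun _ => u := by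
      filter_upwards [hS'o.mem_nhds hw] with v hv
      exact hDe v hv
    have h3 := h1.unique ((hasDerivAt_const w u).congr_of_eventuallyEq h2)
    exact (mul_eq_zero.1 h3).resolve_left (exp_ne_zero _)
  -- Near the inner circle `H ∘ exp - κ w` is constant. A turn by `2πi` leaves `H ∘ exp` unchanged
  -- but shifts `κ w` by `2πiκ`, hence `κ = 0`.
  have hκ0 : κ = 0 := by
    obtain ⟨t, ht1, ht2⟩ := exists_between (Real.log_lt_log hr hs'r)
    have m1 : (t : ℂ) ∈ S' := ⟨by simpa using ht1, by simpa using ht2⟩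
    have m2 : (t : ℂ) + 2 * Real.pi * I ∈ S' := ⟨by simpa using ht1, by simpa using ht2⟩
    have := hS'o.is_const_of_deriv_eq_zero hS'c.isPreconnected hDd hD0 m1 m2
    simp only [exp_periodic (t : ℂ)] at this
    have h2 : (κ : ℂ) * (2 * Real.pi * I) = 0 := by linear_combination this
    rcases mul_eq_zero.1 h2 with e | e
    · exact_mod_cast e
    · exact absurd e two_pi_I_ne_zero
  refine ⟨u, hone w₀ hw₀, fun z hz => ?_⟩
  have hz0 : z ≠ 0 := norm_pos_iff.1 (hnorm0 z hz)
  have hm : log z ∈ S := (exp_mem_annulus_iff hr).1 (by rwa [exp_log hz0])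
  have := hfu _ hm
  rwa [exp_log hz0, hκ0, ofReal_zero, zero_mul, exp_zero, mul_one] at this

end

theorem circularArc_subset_neg_slitPlane {ρ β : ℝ} (hρ : 0 < ρ) (hβ : β < Real.pi) :
    circularArc ρ (Real.pi - β) (Real.pi + β) ⊆ {w : ℂ | -w ∈ slitPlane} := by
  rintro _ ⟨t, ht, rfl⟩
  have e : -((ρ : ℂ) * exp (t * I)) = ρ * exp ((t - Real.pi : ℝ) * I) := by
    push_cast
    rw [sub_mul, exp_sub, exp_pi_mul_I]
    ring
  show -((ρ : ℂ) * exp (t * I)) ∈ slitPlane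
  rw [e, mem_slitPlane_iff_arg]
  have h1 := ht.1
  have h2 := ht.2
  refine ⟨?_, mul_ne_zero (by exact_mod_cast hρ.ne') (exp_ne_zero _)⟩
  rw [exp_mul_I, arg_mul_cos_add_sin_mul_I hρ ⟨by linarith, by linarith⟩]
  linarith

theorem slit_smul {r : ℝ} {f g : ℂ → ℂ} {u : ℂ} (hu : ‖u‖ = 1)
    (h : ∀ z ∈ annulus r 1, g z = u * f z) : slit r g = (fun w => u * w) '' slit r f := by
  have hu0 : u ≠ 0 := norm_ne_zero_iff.1 (by rw [hu]; exact one_ne_zero)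
  have himg : g '' annulus r 1 = (fun w => u * w) '' (f '' annulus r 1) := by
    rw [image_image]
    exact image_congr h
  have hball : (fun w => u * w) '' ball (0 : ℂ) 1 = ball 0 1 := by
    ext w
    constructor
    · rintro ⟨v, hv, rfl⟩
      simpa [hu] using hv
    · intro hw
      refine ⟨u⁻¹ * w, by simpa [hu] using hw, ?_⟩
      show u * (u⁻¹ * w) = w
      rw [← mul_assoc, mul_inv_cancel₀ hu0, one_mul]
  rw [slit, slit, image_sdiff (mul_right_injective₀ hu0), himg, hball]

/-- Uniqueness of the canonical slit map. -/
theorem IsCanonicalMap.eqOn {r x : ℝ} (hr : 0 < r) (hx : x ∈ Ioo r 1) {g₁ g₂ : ℂ → ℂ}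
    (h₁ : IsCanonicalMap r x g₁) (h₂ : IsCanonicalMap r x g₂) : EqOn g₁ g₂ (annulus r 1) := by
  have hr1 : r < 1 := hx.1.trans hx.2
  have hxn : ‖(x : ℂ)‖ = x := by simp [abs_of_pos (hr.trans hx.1)]
  have hxA : (x : ℂ) ∈ annulus r 1 := ⟨by rw [hxn]; exact hx.1, by rw [hxn]; exact hx.2⟩
  have hAx := (isOpen_annulus r 1).mem_nhds hxA
  -- Dividing out the common simple zero at `x` makes the quotient of the two maps zero-free on the
  -- whole annulus.
  have hd : ∀ {g : ℂ → ℂ}, IsCanonicalMap r x g →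
      DifferentiableOn ℂ (dslope g x) (annulus r 1) ∧
      (∀ z, g z = (z - x) * dslope g x z) ∧ ∀ z ∈ annulus r 1, dslope g x z ≠ 0 := by
    intro g hg
    have hmul : ∀ z, g z = (z - x) * dslope g x z := by
      intro z
      have := sub_smul_dslope g (x : ℂ) z
      rw [hg.map_zero, sub_zero, smul_eq_mul] at this
      exact this.symm
    refine ⟨(differentiableOn_dslope hAx).2 hg.holo, hmul, fun z hz h0 => ?_⟩
    by_cases hzx : z = x
    · rw [hzx, dslope_same] at h0
      exact hg.deriv_ne_zero hxA h0
    · have h1 := hmul z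
      rw [h0, mul_zero, ← hg.map_zero] at h1
      exact hzx (hg.inj hz hxA h1)
  obtain ⟨d₁, m₁, n₁⟩ := hd h₁
  obtain ⟨d₂, m₂, n₂⟩ := hd h₂
  obtain ⟨ρ₁, β₁, hρ₁, -, hβ₁, hβ₁', e₁⟩ := h₁.exists_slit_eq
  obtain ⟨ρ₂, β₂, hρ₂, -, hβ₂, hβ₂', e₂⟩ := h₂.exists_slit_eq
  have hquot : ∀ z : ℂ, z ≠ x → dslope g₁ x z / dslope g₂ x z = g₁ z / g₂ z := by
    intro z hz
    rw [m₁ z, m₂ z, mul_div_mul_left _ _ (sub_ne_zero.2 hz)]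
  have hnx : ∀ s : ℝ, s = r ∨ s = 1 → ∀ᶠ z : ℂ in circleFilter r s, z ≠ x := by
    intro s hs
    have hsx : s ≠ x := by
      rcases hs with rfl | rfl
      · exact hx.1.ne
      · exact hx.2.ne'
    have ht : Tendsto (fun z : ℂ => ‖z‖) (circleFilter r s) (𝓝 s) :=
      tendsto_comap.mono_left inf_le_left
    filter_upwards [ht.eventually_ne hsx] with z hz
    rintro rfl
    exact hz hxn
  have hinner : ∀ {g : ℂ → ℂ} {ρ β : ℝ}, IsCanonicalMap r x g → 0 < ρ →
      slit r g = circularArc ρ (Real.pi - β) (Real.pi + β) →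
      Tendsto (fun z => ‖g z‖) (circleFilter r r) (𝓝 ρ) := by
    intro g ρ β hg hρ e
    rw [tendsto_def]
    intro t ht
    obtain ⟨O, hOt, hO, h1⟩ := _root_.mem_nhds_iff.1 ht
    filter_upwards [hg.eventually_mem_inner hr hr1 (hO.preimage continuous_norm) (fun w hw => by
      show ‖w‖ ∈ O
      rw [e] at hw
      rwa [norm_of_mem_circularArc hρ hw])] with z hz
    exact hOt hz
  have hslit : ∀ {g : ℂ → ℂ} {ρ β : ℝ}, IsCanonicalMap r x g → 0 < ρ → β < Real.pi →
      slit r g = circularArc ρ (Real.pi - β) (Real.pi + β) →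
      ∀ᶠ z in circleFilter r r, -g z ∈ slitPlane := by
    intro g ρ β hg hρ hβ e
    exact hg.eventually_mem_inner hr hr1 (isOpen_slitPlane.preimage continuous_neg)
      (by rw [e]; exact circularArc_subset_neg_slitPlane hρ hβ)
  -- Near the inner circle both maps avoid the nonnegative axis, so `log (-g₁) - log (-g₂)` is a
  -- single-valued logarithm of the quotient.
  obtain ⟨ε, hε, hev⟩ := eventually_circleFilter.1
    (((hslit h₁ hρ₁ hβ₁' e₁).and (hslit h₂ hρ₂ hβ₂' e₂)).and (hnx r (Or.inl rfl)))
  have hthin : ∀ z ∈ annulus r (r + ε) ∩ annulus r 1,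
      (-g₁ z ∈ slitPlane ∧ -g₂ z ∈ slitPlane) ∧ z ≠ x := by
    rintro z ⟨hz1, hz2⟩
    refine hev z hz2 ?_
    rw [abs_of_pos (by linarith [hz1.1])]
    linarith [hz1.2]
  obtain ⟨u, hu1, hu⟩ := exists_eq_const_of_tendsto_norm hr hr1
    (f := fun z => dslope g₁ x z / dslope g₂ x z) (c := ρ₁ / ρ₂) (s := r + ε)
    (H := fun z => log (-g₁ z) - log (-g₂ z)) (div_pos hρ₁ hρ₂) (by linarith)
    (d₁.div d₂ n₂) (fun z hz => div_ne_zero (n₁ z hz) (n₂ z hz))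
    (by
      have := (hinner h₁ hρ₁ e₁).div (hinner h₂ hρ₂ e₂) hρ₂.ne'
      refine this.congr' ?_
      filter_upwards [hnx r (Or.inl rfl)] with z hz
      rw [hquot z hz, norm_div]
      rfl)
    (by
      have := h₁.tendsto_norm_outer.div h₂.tendsto_norm_outer one_ne_zero
      rw [div_one] at this
      refine this.congr' ?_
      filter_upwards [hnx 1 (Or.inr rfl)] with z hz
      rw [hquot z hz, norm_div]
      rfl)
    (by
      refine DifferentiableOn.sub ?_ ?_
      · exact (h₁.holo.mono inter_subset_right).neg.clog fun z hz => (hthin z hz).1.1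
      · exact (h₂.holo.mono inter_subset_right).neg.clog fun z hz => (hthin z hz).1.2)
    (by
      intro z hz
      obtain ⟨⟨s1, s2⟩, hzx⟩ := hthin z hz
      rw [exp_sub, exp_log (slitPlane_ne_zero s1), exp_log (slitPlane_ne_zero s2), neg_div_neg_eq,
        hquot z hzx])
  have hmul : ∀ z ∈ annulus r 1, g₁ z = u * g₂ z := by
    intro z hz
    rw [← hu z hz, m₁ z, m₂ z]
    have := n₂ z hz
    field_simp
  have hs := slit_smul hu1 hmul
  set φ := arg u with hφ
  have hue : u = exp (φ * I) := by
    have := norm_mul_exp_arg_mul_I u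
    rw [hu1, ofReal_one, one_mul] at this
    exact this.symm
  have hrot : (fun w => u * w) '' circularArc ρ₂ (Real.pi - β₂) (Real.pi + β₂) =
      circularArc ρ₂ (Real.pi - β₂ + φ) (Real.pi + β₂ + φ) := by
    have hmulexp : ∀ t : ℝ, u * ((ρ₂ : ℂ) * exp (t * I)) = ρ₂ * exp ((t + φ : ℝ) * I) := by
      intro t
      rw [hue, ofReal_add, add_mul, exp_add]
      ring
    ext w
    constructor
    · rintro ⟨_, ⟨t, ht, rfl⟩, rfl⟩
      exact ⟨t + φ, ⟨by linarith [ht.1], by linarith [ht.2]⟩, (hmulexp t).symm⟩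
    · rintro ⟨t, ht, rfl⟩
      refine ⟨_, ⟨t - φ, ⟨by linarith [ht.1], by linarith [ht.2]⟩, rfl⟩, ?_⟩
      have := hmulexp (t - φ)
      rw [sub_add_cancel] at this
      exact this
  rw [e₁, e₂, hrot] at hs
  have hρ := circularArc_radius hρ₁ hρ₂ (by linarith) hs
  rw [← hρ] at hs
  -- Both arcs are centred at angle `π`; adding the two endpoint equations shows that the rotation
  -- angle is a multiple of `2π`.
  obtain ⟨n, hn1, hn2⟩ := circularArc_inj hρ₁ (by linarith) (by linarith) (by linarith)
    (by linarith) hs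
  have hφn : φ = n * (2 * Real.pi) := by linarith
  have hu_one : u = 1 := by
    rw [hue, exp_eq_one_iff]
    refine ⟨n, ?_⟩
    rw [hφn]
    push_cast
    ring
  intro z hz
  rw [hmul z hz, hu_one, one_mul]

/-! ### A Hopf-type lemma. -/

/-- A holomorphic version of the Hopf boundary lemma on a half-plane. -/
theorem im_deriv_neg_of_im_neg {g : ℂ → ℂ} {w₀ : ℂ} (hg : AnalyticAt ℂ g w₀)
    (hneg : ∀ᶠ w in 𝓝 w₀, w₀.re < w.re → (g w).im < 0)
    (hzero : ∀ᶠ w in 𝓝 w₀, w.re = w₀.re → (g w).im = 0) : (deriv g w₀).im < 0 := by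
  have hg0 : (g w₀).im = 0 := hzero.self_of_nhds rfl
  have hray : ∀ d : ℂ, Tendsto (fun t : ℝ => w₀ + t * d) (𝓝[>] 0) (𝓝 w₀) := by
    intro d
    have : Continuous fun t : ℝ => w₀ + t * d := by fun_prop
    simpa using (this.tendsto 0).mono_left nhdsWithin_le_nhds
  have hne : ¬ ∀ᶠ w in 𝓝 w₀, g w - g w₀ = 0 := by
    intro hev
    obtain ⟨t, ⟨h1, h2⟩, h3⟩ :=
      (((hray 1).eventually (hev.and hneg)).and self_mem_nhdsWithin).exists
    have h4 := h2 (by simpa using h3)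
    rw [sub_eq_zero.1 h1, hg0] at h4
    exact lt_irrefl _ h4
  obtain ⟨n, k, hk, hk0, hev⟩ :=
    (hg.sub analyticAt_const).exists_eventuallyEq_pow_smul_nonzero_iff.2 hne
  simp only [Pi.sub_apply, smul_eq_mul] at hev
  -- Only the leading term `k w₀ (w - w₀)ⁿ` matters along a ray, so its imaginary part is
  -- nonpositive in every direction of the closed right half-plane.
  have hdir : ∀ d : ℂ, 0 ≤ d.re → (d ^ n * k w₀).im ≤ 0 := by
    intro d hd
    have ht : Tendsto (fun t : ℝ => (d ^ n * k (w₀ + t * d)).im) (𝓝[>] 0)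
        (𝓝 (d ^ n * k w₀).im) :=
      (continuous_im.tendsto _).comp ((hk.continuousAt.tendsto.comp (hray d)).const_mul (d ^ n))
    refine le_of_tendsto ht ?_
    filter_upwards [(hray d).eventually (hev.and (hneg.and hzero)), self_mem_nhdsWithin]
      with t ⟨h1, h2, h3⟩ h4
    have ht0 : 0 < t := h4
    have hre : (w₀ + t * d).re = w₀.re + t * d.re := by simp
    have hle : (g (w₀ + t * d)).im ≤ 0 := by
      rcases hd.eq_or_lt with c | c
      · exact (h3 (by rw [hre, ← c, mul_zero, add_zero])).le
      · exact (h2 (by rw [hre]; nlinarith)).le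
    have h5 : (g (w₀ + t * d)).im = t ^ n * (d ^ n * k (w₀ + t * d)).im := by
      have := congrArg Complex.im h1
      rw [sub_im, hg0, sub_zero] at this
      rw [this, ← im_ofReal_mul]
      congr 1
      push_cast
      ring
    rw [h5] at hle
    exact nonpos_of_mul_nonpos_right hle (pow_pos ht0 n)
  have hn0 : n ≠ 0 := by
    rintro rfl
    have := hev.self_of_nhds
    simp at this
    exact hk0 this.symm
  by_cases hn1 : n = 1
  · subst hn1
    have hd : HasDerivAt g (k w₀) w₀ := by
      have h1 := (((hasDerivAt_id w₀).sub_const w₀).mul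
        hk.differentiableAt.hasDerivAt).add_const (g w₀)
      simp only [id, sub_self, zero_mul, add_zero, one_mul] at h1
      refine h1.congr_of_eventuallyEq ?_
      filter_upwards [hev] with w hw
      rw [pow_one] at hw
      simp only [Pi.mul_apply]
      linear_combination hw
    rw [hd.deriv]
    have a1 := hdir 1 (by simp)
    have a2 := hdir I (by simp)
    have a3 := hdir (-I) (by simp)
    simp at a1 a2 a3
    refine lt_of_le_of_ne a1 fun e => hk0 (Complex.ext (le_antisymm a2 a3) e)
  · exfalso
    have hn2 : (2 : ℝ) ≤ n := by
      have : 2 ≤ n := by omega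
      exact_mod_cast this
    have hnpos : (0 : ℝ) < n := by linarith
    have hπ := Real.pi_pos
    -- For `n ≥ 2` the `n`-th powers of directions in the half-plane cover all directions, and no
    -- nonzero `k w₀` has nonpositive imaginary part after every rotation.
    have hroot : ∀ s : ℝ, |s| ≤ Real.pi → (exp (s * I) * k w₀).im ≤ 0 := by
      intro s hs
      have h1 := hdir (exp ((s / n : ℝ) * I)) (by
        rw [exp_ofReal_mul_I_re]
        have h2 : |s / n| ≤ Real.pi / 2 := by
          rw [abs_div, abs_of_pos hnpos, div_le_iff₀ hnpos]
          nlinarith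
        exact Real.cos_nonneg_of_neg_pi_div_two_le_of_le (abs_le.1 h2).1 (abs_le.1 h2).2)
      rw [← exp_nat_mul] at h1
      have h3 : (n : ℂ) * ((s / n : ℝ) * I) = s * I := by
        have : (n : ℂ) ≠ 0 := by exact_mod_cast hn0
        push_cast
        field_simp
      rwa [h3] at h1
    have a1 := hroot 0 (by simpa using hπ.le)
    have a2 := hroot Real.pi (by rw [abs_of_pos hπ])
    have a3 := hroot (Real.pi / 2) (by rw [abs_of_pos] <;> linarith)
    have a4 := hroot (-(Real.pi / 2)) (by rw [abs_neg, abs_of_pos] <;> linarith)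
    have e3 : exp ((Real.pi / 2 : ℝ) * I) = I := by
      push_cast
      exact exp_pi_div_two_mul_I
    have e4 : exp ((-(Real.pi / 2) : ℝ) * I) = -I := by
      push_cast
      rw [neg_mul, exp_neg, exp_pi_div_two_mul_I, inv_I]
    rw [exp_pi_mul_I] at a2
    rw [e3] at a3
    rw [e4] at a4
    simp at a1 a2 a3 a4
    exact hk0 (Complex.ext (le_antisymm a3 a4) (le_antisymm a1 a2))

/-! ### Joint smoothness, the derivative at the zero, and critical points on the inner circle. -/

theorem pochLog_ofReal (q t : ℝ) :
    pochLog q t = ((-∑' n : ℕ, t ^ (n + 1) / ((n + 1) * (1 - q ^ (n + 1))) : ℝ) : ℂ) := by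
  rw [pochLog]
  push_cast
  rfl

theorem summable_pochLog_real {q t : ℝ} (hq0 : 0 < q) (hq1 : q < 1) (ht : |t| < 1) :
    Summable fun n : ℕ => t ^ (n + 1) / ((n + 1) * (1 - q ^ (n + 1))) := by
  have := summable_pochLog hq0 hq1 (ζ := (t : ℂ)) (by simpa using ht)
  rw [← Complex.summable_ofReal]
  refine this.congr fun n => ?_
  push_cast
  rfl

theorem contDiffAt_comp_of_analyticAt {E : Type*} [NormedAddCommGroup E] [NormedSpace ℝ E]
    {f : ℂ → ℂ} {a : E → ℂ} {p : E} (ha : ContDiffAt ℝ ∞ a p) (hf : AnalyticAt ℂ f (a p)) :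
    ContDiffAt ℝ ∞ (fun p => f (a p)) p :=
  ContDiffAt.comp p (hf.contDiffAt.restrict_scalars ℝ) ha

namespace CanonParams

variable {q x : ℝ} (h : CanonParams q x)

include h

theorem contDiffAt_args {z : ℂ} (hz : z ≠ 0) :
    ContDiffAt ℝ ∞ (fun p : ℝ × ℂ => (q : ℂ) * p.2 / p.1) (x, z) ∧
    ContDiffAt ℝ ∞ (fun p : ℝ × ℂ => (q : ℂ) * p.1 / p.2) (x, z) ∧
    ContDiffAt ℝ ∞ (fun p : ℝ × ℂ => p.2 * p.1) (x, z) ∧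
    ContDiffAt ℝ ∞ (fun p : ℝ × ℂ => (q : ℂ) / (p.2 * p.1)) (x, z) := by
  have h1 : ContDiffAt ℝ ∞ (fun p : ℝ × ℂ => (p.1 : ℂ)) (x, z) :=
    ofRealCLM.contDiff.contDiffAt.comp _ contDiffAt_fst
  have h2 : ContDiffAt ℝ ∞ (fun p : ℝ × ℂ => p.2) (x, z) := contDiffAt_snd
  have h3 := h2.mul h1
  refine ⟨?_, ?_, h3, ?_⟩
  · simp only [div_eq_mul_inv]
    exact (contDiffAt_const.mul h2).mul (h1.inv h.x_ne_zero)
  · simp only [div_eq_mul_inv]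
    exact (contDiffAt_const.mul h1).mul (h2.inv hz)
  · simp only [div_eq_mul_inv]
    exact contDiffAt_const.mul (h3.inv (mul_ne_zero hz h.x_ne_zero))

theorem contDiffAt_canonMap {z : ℂ} (hz : z ∈ annulus (q / x) (1 / x)) :
    ContDiffAt ℝ ∞ (fun p : ℝ × ℂ => canonMap q p.1 p.2) (x, z) := by
  obtain ⟨a1, a2, a3, a4⟩ := h.contDiffAt_args (h.ne_zero_of_mem hz)
  have d : ∀ {w : ℂ}, ‖w‖ < 1 → AnalyticAt ℂ (pochLog q) w := fun hw =>
    analyticOnNhd_pochLog h.q_pos h.q_lt_one _ (by simpa using hw)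
  have h1 : ContDiffAt ℝ ∞ (fun p : ℝ × ℂ => (p.1 : ℂ)) (x, z) :=
    ofRealCLM.contDiff.contDiffAt.comp _ contDiffAt_fst
  have h2 : ContDiffAt ℝ ∞ (fun p : ℝ × ℂ => p.2) (x, z) := contDiffAt_snd
  have h3 : ContDiffAt ℝ ∞ (fun p : ℝ × ℂ => canonExp q p.1 p.2) (x, z) :=
    ((((contDiffAt_comp_of_analyticAt a1 (d (h.norm_arg₁ hz))).add
      (contDiffAt_comp_of_analyticAt a2 (d (h.norm_arg₂ hz)))).sub
      (contDiffAt_comp_of_analyticAt a3 (d (h.norm_arg₃ hz)))).sub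
      (contDiffAt_comp_of_analyticAt a4 (d (h.norm_arg₄ hz))))
  exact (h2.sub h1).mul (contDiffAt_comp_of_analyticAt h3 analyticAt_cexp)

theorem contDiffAt_canonLogDer {z : ℂ} (hz : z ∈ annulus (q / x) (1 / x)) (hzx : z ≠ x) :
    ContDiffAt ℝ ∞ (fun p : ℝ × ℂ => canonLogDer q p.1 p.2) (x, z) := by
  obtain ⟨a1, a2, a3, a4⟩ := h.contDiffAt_args (h.ne_zero_of_mem hz)
  have d : ∀ {w : ℂ}, ‖w‖ < 1 → AnalyticAt ℂ (pochDer q) w := fun hw =>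
    analyticOnNhd_pochDer h.q_pos h.q_lt_one _ (by simpa using hw)
  have h1 : ContDiffAt ℝ ∞ (fun p : ℝ × ℂ => (p.1 : ℂ)) (x, z) :=
    ofRealCLM.contDiff.contDiffAt.comp _ contDiffAt_fst
  have h2 : ContDiffAt ℝ ∞ (fun p : ℝ × ℂ => p.2) (x, z) := contDiffAt_snd
  have h3 : ContDiffAt ℝ ∞ (fun p : ℝ × ℂ => p.2 / (p.2 - p.1)) (x, z) := by
    simp only [div_eq_mul_inv]
    exact h2.mul ((h2.sub h1).inv (sub_ne_zero.2 hzx))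
  exact ((((h3.add (contDiffAt_comp_of_analyticAt a1 (d (h.norm_arg₁ hz)))).sub
      (contDiffAt_comp_of_analyticAt a2 (d (h.norm_arg₂ hz)))).sub
      (contDiffAt_comp_of_analyticAt a3 (d (h.norm_arg₃ hz)))).add
      (contDiffAt_comp_of_analyticAt a4 (d (h.norm_arg₄ hz))))

-- Exchanging `x` and `z` swaps the first two Pochhammer arguments and fixes the product `zx`, so
-- only `z - x` changes sign.
omit h in
theorem canonMap_antisymm (q x α : ℝ) : canonMap q α x = -canonMap q x α := by
  simp only [canonMap, canonExp]
  have e : (x : ℂ) * α = α * x := mul_comm _ _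
  rw [e]
  have e2 : ∀ a b c d : ℂ, a + b - c - d = b + a - c - d := fun a b c d => by ring
  rw [e2]
  ring

/-- At the zero only the exponential factor survives, giving `T(q)² / (T(x²) T(q/x²))`. Splitting `1
- x²` off `T(x²)` leaves `T(q)² / (T(qx²) T(q/x²))`. This exceeds `1` because, with `y =
x^{2(n+1)}`, each term of the logarithmic series reduces to `y + 1/y > 2`. -/
theorem exists_hasDerivAt_canonMap :
    ∃ d : ℝ, HasDerivAt (canonMap q x) (d : ℂ) (x : ℂ) ∧ 1 / (1 - x ^ 2) < d := by
  have hx := h.x_pos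
  have hx1 := h.x_lt_one
  have hq := h.q_pos
  have hq1 := h.q_lt_one
  have hxx : (x : ℂ) ∈ annulus (q / x) (1 / x) :=
    h.annulus_subset (Real.sqrt_pos.2 hq) (Real.sq_sqrt hq.le)
      (h.x_mem (Real.sq_sqrt hq.le))
  have hx2 : x ^ 2 < 1 := by nlinarith
  have hqx : q / x ^ 2 < 1 := (div_lt_one (by positivity)).2 h.q_lt
  have habs : ∀ {t : ℝ}, 0 < t → t < 1 → |t| < 1 := fun h0 h1 => by rwa [abs_of_pos h0]
  set l : ℝ → ℝ := fun t => -∑' n : ℕ, t ^ (n + 1) / ((n + 1) * (1 - q ^ (n + 1))) with hl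
  have hlog : ∀ t : ℝ, pochLog q t = (l t : ℂ) := pochLog_ofReal q
  have e1 : canonExp q x x = ((l q + l q - l (x ^ 2) - l (q / x ^ 2) : ℝ) : ℂ) := by
    have hx0 := h.x_ne_zero
    rw [canonExp, mul_div_assoc, div_self hx0, mul_one, ← sq]
    have := hlog (x ^ 2)
    have h2 := hlog (q / x ^ 2)
    push_cast at this h2 ⊢
    rw [this, h2, hlog]
  have e2 : l (x ^ 2) = Real.log (1 - x ^ 2) + l (q * x ^ 2) := by
    have := pochLog_sub hq hq1 (ζ := ((x ^ 2 : ℝ) : ℂ))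
      (by rw [Complex.norm_real]; exact habs (by positivity) hx2)
    rw [hlog, ← ofReal_mul, hlog, ← ofReal_one, ← ofReal_sub, ← ofReal_log (by linarith)] at this
    exact_mod_cast this
  have e3 : 0 < l q + l q - l (q * x ^ 2) - l (q / x ^ 2) := by
    have s1 := summable_pochLog_real hq hq1 (habs hq hq1)
    have s2 := summable_pochLog_real hq hq1 (t := q * x ^ 2) (habs (by positivity) (by nlinarith))
    have s3 := summable_pochLog_real hq hq1 (habs (by positivity) hqx)
    have hterm : ∀ n : ℕ, q ^ (n + 1) / ((n + 1) * (1 - q ^ (n + 1))) +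
        q ^ (n + 1) / ((n + 1) * (1 - q ^ (n + 1))) <
        (q * x ^ 2) ^ (n + 1) / ((n + 1) * (1 - q ^ (n + 1))) +
          (q / x ^ 2) ^ (n + 1) / ((n + 1) * (1 - q ^ (n + 1))) := by
      intro n
      have hpos : 0 < ((n : ℝ) + 1) * (1 - q ^ (n + 1)) := by
        have := one_sub_pow_lower hq hq1 n
        linarith
      rw [← add_div, ← add_div]
      refine div_lt_div_of_pos_right ?_ hpos
      rw [mul_pow, div_pow]
      set y := (x ^ 2) ^ (n + 1) with hy
      have hy0 : 0 < y := by positivity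
      have hy1 : y < 1 := pow_lt_one₀ (by positivity) hx2 (Nat.succ_ne_zero n)
      have hqn : 0 < q ^ (n + 1) := pow_pos hq _
      have : q ^ (n + 1) * y + q ^ (n + 1) / y - (q ^ (n + 1) + q ^ (n + 1)) =
          q ^ (n + 1) * ((1 - y) ^ 2 / y) := by
        field_simp
        ring
      have h4 : 0 < q ^ (n + 1) * ((1 - y) ^ 2 / y) := by
        have : 0 < 1 - y := by linarith
        positivity
      linarith
    have := Summable.tsum_lt_tsum (i := 0) (fun n => (hterm n).le) (hterm 0) (s1.add s1)
      (s2.add s3)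
    rw [s1.tsum_add s1, s2.tsum_add s3] at this
    simp only [hl]
    linarith
  refine ⟨Real.exp (l q + l q - l (x ^ 2) - l (q / x ^ 2)), ?_, ?_⟩
  · refine (h.hasDerivAt_canonMap' hxx).congr_deriv ?_
    rw [sub_self, zero_mul, add_zero, e1, ofReal_exp]
  · have hpos : 0 < 1 - x ^ 2 := by linarith
    rw [one_div, ← Real.exp_log hpos, ← Real.exp_neg, Real.exp_lt_exp]
    rw [e2]
    linarith

variable {r : ℝ} (hr : 0 < r) (hrq : r ^ 2 = q)

include hr hrq

/-- On the upper half of the inner circle, the angular derivative of `arg f` has positive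
derivative. -/
theorem exists_hasDerivAt_canonLogDer_inner {θ : ℝ} (hθ : θ ∈ Ioo 0 Real.pi) :
    ∃ D : ℝ, 0 < D ∧
      HasDerivAt (fun t : ℝ => (canonLogDer q x (r * exp (t * I))).re) D θ := by
  have hpd : ∀ t : ℝ, (r : ℂ) * exp (t * I) = exp (Real.log r + t * I) := fun t => by
    rw [exp_add, ← ofReal_exp, Real.exp_log hr]
  set w₀ : ℂ := Real.log r + θ * I with hw₀
  have hw₀re : w₀.re = Real.log r := by simp [hw₀]
  have hw₀im : w₀.im = θ := by simp [hw₀]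
  set g : ℂ → ℂ := fun w => canonLogDer q x (exp w) with hg
  have hmem : exp w₀ ∈ annulus (q / x) (1 / x) \ {(x : ℂ)} := by
    rw [hw₀, ← hpd]
    exact ⟨h.inner_subset (h.inner_mem hr hrq θ), h.inner_ne hr hrq θ⟩
  have hopen : IsOpen (annulus (q / x) (1 / x) \ {(x : ℂ)}) :=
    (isOpen_annulus _ _).sdiff isClosed_singleton
  have hga : AnalyticAt ℂ g w₀ :=
    (h.differentiableOn_canonLogDer.analyticAt (hopen.mem_nhds hmem)).comp analyticAt_cexp
  have hder : (deriv g w₀).im < 0 := by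
    refine im_deriv_neg_of_im_neg hga ?_ ?_
    · have h1 : ∀ᶠ w in 𝓝 w₀, w.re < Real.log 1 := by
        refine (isOpen_lt continuous_re continuous_const).mem_nhds ?_
        show w₀.re < Real.log 1
        rw [hw₀re]
        exact Real.log_lt_log hr (h.r_lt_one hrq)
      have h2 : ∀ᶠ w in 𝓝 w₀, 0 < w.im ∧ w.im < Real.pi := by
        refine ((isOpen_lt continuous_const continuous_im).inter
          (isOpen_lt continuous_im continuous_const)).mem_nhds ?_
        show 0 < w₀.im ∧ w₀.im < Real.pi
        rw [hw₀im]
        exact hθ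
      filter_upwards [h1, h2] with w h1 h2 h3
      have hm : exp w ∈ annulus r 1 ∩ {z | 0 < z.im} := by
        rw [upper_annulus_eq_exp_image hr one_pos]
        exact mem_image_of_mem _ ⟨⟨hw₀re ▸ h3, h1⟩, h2⟩
      exact h.canonLogDer_im_neg hr hrq hm.1 hm.2
    · refine Eventually.of_forall fun w hw => ?_
      refine h.canonLogDer_im_of_norm_sq ?_
      rw [norm_exp, hw, hw₀re, Real.exp_log hr, hrq]
  -- Moving along the circle is the direction `I` in the logarithmic coordinate, and `Re (I g') =
  -- -Im g'`.
  refine ⟨-(deriv g w₀).im, by linarith, ?_⟩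
  have h2 : HasDerivAt (fun t : ℝ => (Real.log r : ℂ) + t * I) I θ := by
    simpa using ((hasDerivAt_id θ).ofReal_comp.mul_const I).const_add (Real.log r : ℂ)
  have h3 := reCLM.hasFDerivAt.comp_hasDerivAt θ
    (HasDerivAt.comp θ (show HasDerivAt g _ _ from hga.differentiableAt.hasDerivAt) h2)
  refine (h3.congr_of_eventuallyEq (Eventually.of_forall fun t => ?_)).congr_deriv (by simp)
  simp only [hg, Function.comp, hpd, reCLM_apply]

/-- The positive derivative holds on the whole open semicircle, so the function is strictly
increasing there. -/
theorem canonLogDer_inner_unique {θ₁ θ₂ : ℝ} (h₁ : θ₁ ∈ Ioo 0 Real.pi) (h₂ : θ₂ ∈ Ioo 0 Real.pi)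
    (e₁ : (canonLogDer q x (r * exp (θ₁ * I))).re = 0)
    (e₂ : (canonLogDer q x (r * exp (θ₂ * I))).re = 0) : θ₁ = θ₂ := by
  have hmono : StrictMonoOn (fun t : ℝ => (canonLogDer q x (r * exp (t * I))).re)
      (Ioo 0 Real.pi) := by
    refine strictMonoOn_of_deriv_pos (convex_Ioo _ _) (fun t ht => ?_) (fun t ht => ?_)
    · obtain ⟨D, -, hD⟩ := h.exists_hasDerivAt_canonLogDer_inner hr hrq ht
      exact hD.continuousAt.continuousWithinAt
    · rw [interior_Ioo] at ht
      obtain ⟨D, hD0, hD⟩ := h.exists_hasDerivAt_canonLogDer_inner hr hrq ht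
      rwa [hD.deriv]
  exact hmono.injOn h₁ h₂ (e₁.trans e₂.symm)

end CanonParams

/-! ### Smooth dependence of the endpoint on `x`. -/

/-- The solution of a scalar equation `F(x, t) = 0` that is unique in an open interval is smooth,
provided that `∂F/∂t` does not vanish. -/
theorem contDiffOn_of_unique_zero {F : ℝ × ℝ → ℝ} {s : Set ℝ} {a b : ℝ} {θ : ℝ → ℝ}
    (hs : IsOpen s) (hθ : ∀ x ∈ s, θ x ∈ Ioo a b ∧ F (x, θ x) = 0)
    (huniq : ∀ x ∈ s, ∀ t ∈ Ioo a b, F (x, t) = 0 → t = θ x)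
    (hF : ∀ x ∈ s, ContDiffAt ℝ ∞ F (x, θ x))
    (hD : ∀ x ∈ s, ∃ D : ℝ, D ≠ 0 ∧ HasDerivAt (fun t => F (x, t)) D (θ x)) :
    ContDiffOn ℝ ∞ θ s := by
  intro x hx
  obtain ⟨D, hD0, hDd⟩ := hD x hx
  have hfd := ((hF x hx).differentiableAt (by simp)).hasFDerivAt
  have hD1 : fderiv ℝ F (x, θ x) (0, 1) = D := by
    have h1 : HasDerivAt (fun t : ℝ => (x, t)) ((0 : ℝ), (1 : ℝ)) (θ x) :=
      (hasDerivAt_const _ _).prodMk (hasDerivAt_id _)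
    exact (hfd.comp_hasDerivAt (θ x) h1).unique hDd
  have hinv : (fderiv ℝ F (x, θ x) ∘L .inr ℝ ℝ ℝ).IsInvertible := by
    refine ⟨ContinuousLinearEquiv.unitsEquivAut ℝ (Units.mk0 D hD0), ?_⟩
    ext
    simp [hD1]
  have hn : (∞ : WithTop ℕ∞) ≠ 0 := by simp
  set ψ := (hF x hx).implicitFunction hn hinv with hψ
  have hψc : ContDiffAt ℝ ∞ ψ x := (hF x hx).contDiffAt_implicitFunction hn hinv
  have hψx : ψ x = θ x := (hF x hx).implicitFunction_apply_self hn hinv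
  have hψe : ∀ᶠ y in 𝓝 x, F (y, ψ y) = F (x, θ x) :=
    (hF x hx).eventually_apply_implicitFunction hn hinv
  have hψm : ∀ᶠ y in 𝓝 x, ψ y ∈ Ioo a b :=
    hψc.continuousAt.eventually (isOpen_Ioo.mem_nhds (by rw [hψx]; exact (hθ x hx).1))
  -- Uniqueness of the zero in the interval identifies `θ` with the local implicit function; no
  -- continuity of `θ` is needed beforehand.
  refine (hψc.congr_of_eventuallyEq ?_).contDiffWithinAt
  filter_upwards [hψe, hψm, hs.mem_nhds hx] with y h1 h2 h3
  exact (huniq y h3 _ h2 (h1.trans (hθ x hx).2)).symm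

theorem canonParams_of_mem {r x : ℝ} (hr : 0 < r) (hx : x ∈ Ioo r 1) : CanonParams (r ^ 2) x where
  q_pos := by positivity
  x_pos := hr.trans hx.1
  x_lt_one := hx.2
  q_lt := by
    have := hx.1
    gcongr

theorem exists_contDiffOn_endpoint {r : ℝ} (hr : 0 < r) :
    ∃ e : ℝ → ℂ, ContDiffOn ℝ ∞ e (Ioo r 1) ∧ ∀ x ∈ Ioo r 1, ∃ m ∈ Ioo 0 Real.pi,
      e x = x * exp (m * I) ∧
      slit r (canonMap (r ^ 2) x) = circularArc x m (2 * Real.pi - m) := by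
  have hex : ∀ x ∈ Ioo r 1, _ := fun x hx =>
    (canonParams_of_mem hr hx).exists_slit_canonMap hr rfl
  choose! θ hθ m hm he hcrit hslit using hex
  have hinner : ∀ {x t : ℝ}, x ∈ Ioo r 1 →
      ContDiffAt ℝ ∞ (fun p : ℝ × ℝ => (p.1, (r : ℂ) * exp (p.2 * I))) (x, t) := by
    intro x t _
    refine contDiffAt_fst.prodMk (contDiffAt_const.mul ?_)
    exact contDiffAt_comp_of_analyticAt
      ((ofRealCLM.contDiff.contDiffAt.comp _ contDiffAt_snd).mul contDiffAt_const) analyticAt_cexp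
  have hθs : ContDiffOn ℝ ∞ θ (Ioo r 1) := by
    refine contDiffOn_of_unique_zero
      (F := fun p : ℝ × ℝ => (canonLogDer (r ^ 2) p.1 (r * exp (p.2 * I))).re)
      (a := 0) (b := Real.pi) isOpen_Ioo (fun x hx => ⟨hθ x hx, by simp [hcrit x hx]⟩) ?_ ?_ ?_
    · intro x hx t ht e
      exact (canonParams_of_mem hr hx).canonLogDer_inner_unique hr rfl ht (hθ x hx) e
        (by simp [hcrit x hx])
    · intro x hx
      have hp := canonParams_of_mem hr hx
      have h1 := hp.contDiffAt_canonLogDer (hp.inner_subset (hp.inner_mem hr rfl (θ x)))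
        (hp.inner_ne hr rfl (θ x))
      exact reCLM.contDiff.contDiffAt.comp _
        (ContDiffAt.comp (x, θ x) (g := fun p : ℝ × ℂ => canonLogDer (r ^ 2) p.1 p.2) h1
          (hinner hx))
    · intro x hx
      obtain ⟨D, hD0, hD⟩ :=
        (canonParams_of_mem hr hx).exists_hasDerivAt_canonLogDer_inner hr rfl (hθ x hx)
      exact ⟨D, hD0.ne', hD⟩
  refine ⟨fun x => canonMap (r ^ 2) x (r * exp (θ x * I)), ?_,
    fun x hx => ⟨m x, hm x hx, he x hx, hslit x hx⟩⟩
  intro x hx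
  have hp := canonParams_of_mem hr hx
  have h1 := hp.contDiffAt_canonMap (hp.inner_subset (hp.inner_mem hr rfl (θ x)))
  have h2 := ContDiffAt.comp (x, θ x) (g := fun p : ℝ × ℂ => canonMap (r ^ 2) p.1 p.2) h1
    (hinner hx)
  have h3 : ContDiffAt ℝ ∞ (fun y : ℝ => (y, θ y)) x :=
    contDiffAt_id.prodMk ((hθs x hx).contDiffAt (isOpen_Ioo.mem_nhds hx))
  exact (ContDiffAt.comp x h2 h3).contDiffWithinAt

/-- `IsArcEndpoint` allows any parametrisation of the arc; by `circularArc_inj` all of them have the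
same two ends, and the one at angle `2π - m` lies in the lower half-plane. -/
theorem isArcEndpoint_circularArc_iff {x m : ℝ} (hx : 0 < x) (hm : m ∈ Ioo 0 Real.pi) (w : ℂ) :
    (IsArcEndpoint (circularArc x m (2 * Real.pi - m)) w ∧ 0 < w.im) ↔ w = x * exp (m * I) := by
  have h1 := hm.1
  have h2 := hm.2
  have hsin : 0 < Real.sin m := Real.sin_pos_of_pos_of_lt_pi h1 h2
  constructor
  · rintro ⟨⟨ρ, a, b, hρ, hab, hab2, e, hw⟩, hi⟩
    have hρx := circularArc_radius hx hρ (by linarith) e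
    subst hρx
    obtain ⟨n, rfl, rfl⟩ := circularArc_inj hx (by linarith) (by linarith) hab hab2 e
    rcases hw with rfl | rfl
    · congr 1
      rw [exp_eq_exp_iff_exists_int]
      refine ⟨n, ?_⟩
      push_cast
      ring
    · exfalso
      rw [im_ofReal_mul, exp_ofReal_mul_I_im, Real.sin_add_int_mul_two_pi,
        Real.sin_two_pi_sub] at hi
      nlinarith
  · rintro rfl
    refine ⟨⟨x, m, 2 * Real.pi - m, hx, by linarith, by linarith, rfl, Or.inl rfl⟩, ?_⟩
    rw [im_ofReal_mul, exp_ofReal_mul_I_im]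
    exact mul_pos hx hsin

/-! ### Transfer from the explicit map to an arbitrary family of canonical maps. -/

theorem lemma5p1 (r : ℝ) (hr0 : 0 < r) (hr1 : r < 1) :
    -- the canonical map exists and is unique, as a map on the annulus
    (∀ x ∈ Set.Ioo r 1, ∃ f : ℂ → ℂ, IsCanonicalMap r x f ∧
      ∀ g : ℂ → ℂ, IsCanonicalMap r x g → Set.EqOn g f (annulus r 1)) ∧
    ∀ f : ℝ → ℂ → ℂ, (∀ x ∈ Set.Ioo r 1, IsCanonicalMap r x (f x)) →
      -- (A) holomorphic extension, jointly smooth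
      (∃ F : ℝ → ℂ → ℂ,
        (∀ x ∈ Set.Ioo r 1, Set.EqOn (F x) (f x) (annulus r 1) ∧
          DifferentiableOn ℂ (F x) (annulus (r ^ 2 / x) (1 / x))) ∧
        ContDiffOn ℝ ∞ (fun p : ℝ × ℂ => F p.1 p.2)
          {p : ℝ × ℂ | p.1 ∈ Set.Ioo r 1 ∧ p.2 ∈ annulus (r ^ 2 / p.1) (1 / p.1)}) ∧
      -- (B) antisymmetry and derivative
      (∀ x ∈ Set.Ioo r 1, ∀ α ∈ Set.Ioo r 1, f α (x : ℂ) = -f x (α : ℂ)) ∧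
      (∀ x ∈ Set.Ioo r 1, ∃ d : ℝ, HasDerivAt (f x) (d : ℂ) (x : ℂ) ∧
        HasDerivAt (fun α : ℝ => f α (x : ℂ)) (-(d : ℂ)) x ∧ -d < -(1 / (1 - x ^ 2))) ∧
      -- (C) intersection of the slit with the real line
      (∀ x ∈ Set.Ioo r 1, slit r (f x) ∩ {w : ℂ | w.im = 0} = {(-x : ℂ)}) ∧
      -- (D) the endpoint in the upper half-plane
      (∃ e : ℝ → ℂ,
        (∀ x ∈ Set.Ioo r 1, ∀ w : ℂ,
          (IsArcEndpoint (slit r (f x)) w ∧ 0 < w.im) ↔ w = e x) ∧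
        ContDiffOn ℝ ∞ e (Set.Ioo r 1)) := by
  have hp : ∀ x ∈ Ioo r 1, CanonParams (r ^ 2) x := fun x hx => canonParams_of_mem hr0 hx
  have hcan : ∀ x ∈ Ioo r 1, IsCanonicalMap r x (canonMap (r ^ 2) x) := fun x hx =>
    (hp x hx).isCanonicalMap_canonMap hr0 rfl
  refine ⟨fun x hx => ⟨_, hcan x hx, fun g hg => hg.eqOn hr0 hx (hcan x hx)⟩, fun f hf => ?_⟩
  have heq : ∀ x ∈ Ioo r 1, EqOn (f x) (canonMap (r ^ 2) x) (annulus r 1) := fun x hx =>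
    (hf x hx).eqOn hr0 hx (hcan x hx)
  have hslit : ∀ x ∈ Ioo r 1, slit r (f x) = slit r (canonMap (r ^ 2) x) := fun x hx => by
    rw [slit, slit, image_congr (heq x hx)]
  have hmem : ∀ x ∈ Ioo r 1, (x : ℂ) ∈ annulus r 1 := fun x hx => (hp x hx).x_mem rfl
  have hanti : ∀ x ∈ Ioo r 1, ∀ α ∈ Ioo r 1, f α (x : ℂ) = -f x (α : ℂ) := by
    intro x hx α hα
    rw [heq α hα (hmem x hx), heq x hx (hmem α hα)]
    exact CanonParams.canonMap_antisymm _ _ _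
  refine ⟨⟨canonMap (r ^ 2), fun x hx => ⟨(heq x hx).symm, (hp x hx).differentiableOn_canonMap⟩,
    ?_⟩, hanti, ?_, ?_, ?_⟩
  · rintro ⟨x, z⟩ ⟨hx, hz⟩
    exact ((hp x hx).contDiffAt_canonMap hz).contDiffWithinAt
  · intro x hx
    obtain ⟨d, hd, hlt⟩ := (hp x hx).exists_hasDerivAt_canonMap
    have hfd : HasDerivAt (f x) (d : ℂ) (x : ℂ) := by
      refine hd.congr_of_eventuallyEq ?_
      filter_upwards [(isOpen_annulus r 1).mem_nhds (hmem x hx)] with z hz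
      exact heq x hx hz
    refine ⟨d, hfd, ?_, neg_lt_neg hlt⟩
    -- By antisymmetry the derivative in the parameter is minus the derivative in the variable.
    refine hfd.comp_ofReal.neg.congr_of_eventuallyEq ?_
    filter_upwards [isOpen_Ioo.mem_nhds hx] with α hα
    exact hanti x hx α hα
  · intro x hx
    rw [hslit x hx]
    exact (hp x hx).slit_canonMap_inter_real hr0 rfl
  · obtain ⟨e, he, hm⟩ := exists_contDiffOn_endpoint hr0
    refine ⟨e, fun x hx w => ?_, he⟩
    obtain ⟨m, hm1, hm2, hm3⟩ := hm x hx
    rw [hslit x hx, hm3, hm2]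
    exact isArcEndpoint_circularArc_iff (hp x hx).x_pos hm1 w
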